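/- **Setting.** Let $\xi$ be a random variable with law $P$, let $d_2\ge 1$, and let $F(x,y;\xi)$, $(x,y)\in\mathbb R^{d_1}\times\mathbb R^{d_2}$, be real valued, with finite mean and differentiable in $(x,y)$. Put $f(x,y)=\mathbb E\,F(x,y;\xi)$, $\Phi(x)=\max_{y}f(x,y)$, $\Phi^*=\inf_x\Phi(x)$, $G_x=\nabla_xF$, $G_y=\nabla_yF$. Assume, for constants $\ell,\mu,\sigma>0$: 1. $\Phi^*>-\infty$; 2. $\mathbb E\|\nabla F(x,y;\xi)-\nabla F(x',y';\xi)\|^2\le \ell^2(\|x-x'\|^2+\|y-y'\|^2)$ for all $x,y,x',y'$; 3. $F(x,\cdot\,;\xi)$ is concave for all $x,\xi$; 4. $f(x,\cdot)$ is $\mu$-strongly concave for all $x$; 5. $\mathbb E\|\nabla F(x,y;\xi)-\nabla f(x,y)\|^2\le\sigma^2$ for all $x,y$. Let $\kappa=\ell/\mu$, $\varepsilon>0$, $x_0\in\mathbb R^{d_1}$, $w_0\in\mathbb R^{d_2}$. **Algorithm.** All samples drawn are i.i.d. copies of $\xi$, all random indices are uniform, and all draws are independent. *Initialization (iSARAH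 on $h=-f(x_0,\cdot)$, $H=-F(x_0,\cdot\,;\cdot)$, with parameters $\gamma>0$ and integers $m',b\ge1$, $T\ge0$).* Start with $\tilde w_0=w_0$. In epoch $s=1,\dots,T$, restart with $w_0:=\tilde w_{s-1}$, let $v_0$ be the mean of $\nabla H(w_0;\cdot)$ over $b$ samples, and $w_1=w_0-\gamma v_0$; for $t=1,\dots,m'-1$ draw one sample $\xi_t$ and set $v_t=\nabla H(w_t;\xi_t)-\nabla H(w_{t-1};\xi_t)+v_{t-1}$, $w_{t+1}=w_t-\gamma v_t$. Then $\tilde w_s=w_{t'}$ with $t'$ uniform on $\{0,\dots,m'\}$. Output $y_0=\tilde w_T$. *Main loop (SREDA).* For $k=0,\dots,K-1$: if $q\mid k$, let $(v_k,u_k)$ be the mean of $(G_x,G_y)(x_k,y_k;\cdot)$ over $S_1$ samples; otherwise $(v_k,u_k)=(\tilde v_{k-1,s_{k-1}+1},\tilde u_{k-1,s_{k-1}+1})$. Set $x_{k+1}=x_k-\eta_kv_k$ and run the concave maximizer: put $\tilde x_{k,-1}=x_k$, $\tilde x_{k,t}=x_{k+1}$ for $t\ge0$, $\tilde y_{k,-1}=\tilde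 y_{k,0}=y_k$, $(\tilde v_{k,-1},\tilde u_{k,-1})=(v_k,u_k)$; for $t=0,\dots,m+1$ draw $S_2$ samples, let $(\tilde v_{k,t},\tilde u_{k,t})$ be $(\tilde v_{k,t-1},\tilde u_{k,t-1})$ plus the mean over these samples of $(G_x,G_y)(\tilde x_{k,t},\tilde y_{k,t};\cdot)-(G_x,G_y)(\tilde x_{k,t-1},\tilde y_{k,t-1};\cdot)$, and set $\tilde y_{k,t+1}=\tilde y_{k,t}+\lambda\tilde u_{k,t}$. Draw $s_k$ uniformly from $\{0,\dots,m\}$ and set $y_{k+1}=\tilde y_{k,s_k+1}$. The output is $\hat x=x_{\hat k}$ with $\hat k$ uniform on $\{0,\dots,K-1\}$ (for $K\ge 1$). **Parameters.** $$\zeta=\kappa^{-2}\varepsilon^2,\quad \eta_k=\min\Big(\frac{\varepsilon}{5\kappa\ell\|v_k\|},\frac1{10\kappa\ell}\Big),\quad \lambda=\frac{2}{7\ell},\quad q=\lceil\varepsilon^{-1}\rceil,\quad S_1=\lceil 24\sigma^2\kappa^2\varepsilon^{-2}\rceil,$$ $$S_2=\Big\lceil\tfrac{7368}{175}\kappa q\Big\rceil,\quad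 K=\Big\lceil\frac{100\kappa\ell\varepsilon^{-2}\Delta_f}{9}\Big\rceil,\quad m=\lceil28\kappa-1\rceil,\qquad \Delta_f=\mathbb E f(x_0,y_0)+\frac{\kappa^{-2}\varepsilon^2}{2\mu}-\Phi^*.$$ **Theorem.** $\Phi$ is differentiable, and: (a) Whenever the initialization reaches the accuracy $\mathbb E\|\nabla_yf(x_0,y_0)\|^2\le\zeta$, $f(x_0,y_0)$ is integrable, and the output satisfies $$\mathbb E\|\nabla\Phi(\hat x)\|\le\frac{1073}{108}\,\varepsilon .$$ (b) Parameters $\gamma,m',b,T$ with which iSARAH reaches this accuracy $\zeta$ exist, and can be chosen such that for $\varepsilon\le1$ the total number of stochastic gradient evaluations $\nabla F(x,y;\xi)$ made by the initialization and the main loop is at most $C\kappa^3\varepsilon^{-3}$, i.e. $O(\kappa^3\varepsilon^{-3})$. Here $C$ depends only on $\ell$, $\sigma$ and on upper bounds $D\ge\Phi(x_0)-\Phi^*$ and $G\ge\|\nabla_yf(x_0,w_0)\|$, and $\gamma,m',b,T$ depend only on these quantities, $\mu$ and $\varepsilon$. -/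

import Mathlib

open MeasureTheory ProbabilityTheory

noncomputable section

namespace Sreda

/-- Euclidean space of dimension `d`. -/
abbrev Vec (d : ℕ) := EuclideanSpace ℝ (Fin d)

variable {d₁ d₂ : ℕ} {Ξ : Type*}

/-! ### The minimax problem -/

/-- Partial gradient in `x` of the component function: `G_x(x, y; ξ)`. -/
def gradX (F : Vec d₁ → Vec d₂ → Ξ → ℝ) (x : Vec d₁) (y : Vec d₂) (ξ : Ξ) : Vec d₁ :=
  gradient (fun x' => F x' y ξ) x

/-- Partial gradient in `y` of the component function: `G_y(x, y; ξ)`. -/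
def gradY (F : Vec d₁ → Vec d₂ → Ξ → ℝ) (x : Vec d₁) (y : Vec d₂) (ξ : Ξ) : Vec d₂ :=
  gradient (fun y' => F x y' ξ) y

section Problem

variable [MeasurableSpace Ξ]

/-- The objective `f(x, y) = 𝔼 F(x, y; ξ)`, where `ξ` has law `P`. -/
def obj (P : Measure Ξ) (F : Vec d₁ → Vec d₂ → Ξ → ℝ) (x : Vec d₁) (y : Vec d₂) : ℝ :=
  ∫ ξ, F x y ξ ∂P

/-- `∇ₓ f(x, y)`. -/
def objGradX (P : Measure Ξ) (F : Vec d₁ → Vec d₂ → Ξ → ℝ) (x : Vec d₁) (y : Vec d₂) : Vec d₁ :=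
  gradient (fun x' => obj P F x' y) x

/-- `∇_y f(x, y)`. -/
def objGradY (P : Measure Ξ) (F : Vec d₁ → Vec d₂ → Ξ → ℝ) (x : Vec d₁) (y : Vec d₂) : Vec d₂ :=
  gradient (fun y' => obj P F x y') y

/-- The primal function `Φ(x) = max_y f(x, y)`. -/
def Phi (P : Measure Ξ) (F : Vec d₁ → Vec d₂ → Ξ → ℝ) (x : Vec d₁) : ℝ :=
  ⨆ y, obj P F x y

/-- `Φ* = inf_x Φ(x)`. -/
def PhiStar (P : Measure Ξ) (F : Vec d₁ → Vec d₂ → Ξ → ℝ) : ℝ :=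
  ⨅ x, Phi P F x

/-- The standing assumptions on the stochastic nonconvex-strongly-concave problem. The squared norm
of the full gradient is the sum of the squared norms of its two blocks. -/
structure Assumptions (P : Measure Ξ) (F : Vec d₁ → Vec d₂ → Ξ → ℝ) (ℓ μ σ : ℝ) : Prop where
  ell_pos : 0 < ℓ
  mu_pos : 0 < μ
  sigma_pos : 0 < σ
  /-- the component function is a random variable with finite mean, differentiable in `(x, y)` -/
  measurable : ∀ x y, Measurable (F x y)
  integrable : ∀ x y, Integrable (F x y) P
  differentiable : ∀ ξ, Differentiable ℝ (fun z : Vec d₁ × Vec d₂ => F z.1 z.2 ξ)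
  /-- `Φ` is bounded below -/
  bddBelow : BddBelow (Set.range (Phi P F))
  /-- average `ℓ`-Lipschitz gradient -/
  avg_lipschitz : ∀ x y x' y',
    Integrable (fun ξ => ‖gradX F x y ξ - gradX F x' y' ξ‖ ^ 2
      + ‖gradY F x y ξ - gradY F x' y' ξ‖ ^ 2) P ∧
    ∫ ξ, (‖gradX F x y ξ - gradX F x' y' ξ‖ ^ 2
      + ‖gradY F x y ξ - gradY F x' y' ξ‖ ^ 2) ∂P ≤ ℓ ^ 2 * (‖x - x'‖ ^ 2 + ‖y - y'‖ ^ 2)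
  /-- every component function is concave in `y` -/
  concave : ∀ x y y' ξ, F x y ξ ≤ F x y' ξ + inner ℝ (gradY F x y' ξ) (y - y')
  /-- `f` is `μ`-strongly concave in `y` -/
  strong_concave : ∀ x y y',
    obj P F x y ≤ obj P F x y' + inner ℝ (objGradY P F x y') (y - y') - μ / 2 * ‖y - y'‖ ^ 2
  /-- bounded variance of the stochastic gradients -/
  variance : ∀ x y,
    Integrable (fun ξ => ‖gradX F x y ξ - objGradX P F x y‖ ^ 2
      + ‖gradY F x y ξ - objGradY P F x y‖ ^ 2) P ∧
    ∫ ξ, (‖gradX F x y ξ - objGradX P F x y‖ ^ 2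
      + ‖gradY F x y ξ - objGradY P F x y‖ ^ 2) ∂P ≤ σ ^ 2

/-! ### The randomness used by the algorithm

Every draw has its own label, so that distinct draws are distinct (independent) variables. -/

/-- Labels of the draws of `ξ`. -/
inductive SampleId where
  /-- `i`-th sample of the large batch in epoch `s` of iSARAH -/
  | initBatch (s i : ℕ)
  /-- the sample of inner step `t` in epoch `s` of iSARAH -/
  | initStep (s t : ℕ)
  /-- `i`-th sample of the large batch of SREDA at iteration `k` -/
  | large (k i : ℕ)
  /-- `i`-th sample of the small batch of step `t` of the concave maximizer at iteration `k` -/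
  | small (k t i : ℕ)

/-- Labels of the random indices. -/
inductive ChoiceId where
  /-- the index `t'` at the end of epoch `s` of iSARAH -/
  | init (s : ℕ)
  /-- the index `s_k` of the concave maximizer at iteration `k` -/
  | inner (k : ℕ)

/-- On the probability space `(Ω, Q)`: the samples `ξ i` are i.i.d. with law `P`, the indices
`t'` are uniform on `{0, …, m'}`, the indices `s_k` are uniform on `{0, …, m}`, and all of these
draws are mutually independent. -/
structure IsTape {Ω : Type*} [MeasurableSpace Ω] (Q : Measure Ω) (P : Measure Ξ) (m' m : ℕ)
    (ξ : SampleId → Ω → Ξ) (c : ChoiceId → Ω → ℕ) : Prop where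
  measurable_sample : ∀ i, Measurable (ξ i)
  measurable_choice : ∀ j, Measurable (c j)
  law_sample : ∀ i, Measure.map (ξ i) Q = P
  law_init : ∀ s, Measure.map (c (.init s)) Q = uniformOn (Set.Iic m')
  law_inner : ∀ k, Measure.map (c (.inner k)) Q = uniformOn (Set.Iic m)
  indep_sample : iIndepFun ξ Q
  indep_choice : iIndepFun c Q
  indep_sample_choice : IndepFun (fun ω i => ξ i ω) (fun ω j => c j ω) Q

end Problem

/-! ### The algorithms

They are deterministic functions of the drawn samples `ξ` and indices `c`. The field `evals` counts
the stochastic gradient evaluations: one for each pair of a point and a sample at which the gradient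
of the component function is evaluated. -/

/-- `(1/n) ∑_{i<n} g i`. -/
def batchMean {d : ℕ} (n : ℕ) (g : ℕ → Vec d) : Vec d :=
  (n : ℝ)⁻¹ • ∑ i ∈ Finset.range n, g i

/-- Input of iSARAH: learning rate `γ`, inner loop size `m'`, batch size `b`, number of epochs
`T`. -/
structure ISarahParams where
  γ : ℝ
  m' : ℕ
  b : ℕ
  T : ℕ
  γ_pos : 0 < γ
  m'_pos : 0 < m'
  b_pos : 0 < b

/-- State of the inner loop of iSARAH after `t` steps: `wPrev = w_t`, `w = w_{t+1}`, `v = v_t`. -/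
structure ISarahInner (d : ℕ) where
  wPrev : Vec d
  w : Vec d
  v : Vec d
  evals : ℕ

/-- The inner loop in epoch `s` of iSARAH, started at `w₀`, for a component function with gradient
`gradH`. -/
def iSarahInner {d : ℕ} (gradH : Vec d → Ξ → Vec d) (J : ISarahParams) (ξ : SampleId → Ξ)
    (s : ℕ) (w₀ : Vec d) : ℕ → ISarahInner d
  | 0 =>
    let v₀ := batchMean J.b (fun i => gradH w₀ (ξ (.initBatch s i)))
    { wPrev := w₀, w := w₀ - J.γ • v₀, v := v₀, evals := J.b }
  | t + 1 =>
    let S := iSarahInner gradH J ξ s w₀ t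
    let z := ξ (.initStep s (t + 1))
    let v := gradH S.w z - gradH S.wPrev z + S.v
    { wPrev := S.w, w := S.w - J.γ • v, v := v, evals := S.evals + 2 }

/-- The iterate `w_t` (`0 ≤ t ≤ m'`) of the inner loop in epoch `s` of iSARAH. -/
def iSarahIterate {d : ℕ} (gradH : Vec d → Ξ → Vec d) (J : ISarahParams) (ξ : SampleId → Ξ)
    (s : ℕ) (w₀ : Vec d) : ℕ → Vec d
  | 0 => w₀
  | t + 1 => (iSarahInner gradH J ξ s w₀ t).w

/-- iSARAH: the pair of the point `w̃_s` and the number of gradient evaluations after `s`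
epochs. The inner loop of each epoch makes the steps `t = 1, …, m' - 1`. -/
def iSarah {d : ℕ} (gradH : Vec d → Ξ → Vec d) (J : ISarahParams) (ξ : SampleId → Ξ)
    (c : ChoiceId → ℕ) (w₀ : Vec d) : ℕ → Vec d × ℕ
  | 0 => (w₀, 0)
  | s + 1 =>
    let S := iSarah gradH J ξ c w₀ s
    (iSarahIterate gradH J ξ s S.1 (c (.init s)),
      S.2 + (iSarahInner gradH J ξ s S.1 (J.m' - 1)).evals)

/-- Parameters of SREDA: accuracy `ζ` of the initialization, step size `η` as a function of
the norm of `v_k`, step size `lam` of the concave maximizer, period `q`, batch sizes `S₁`, `S₂`,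
inner loop size `m`. -/
structure Params where
  ζ : ℝ
  η : ℝ → ℝ
  lam : ℝ
  q : ℕ
  S₁ : ℕ
  S₂ : ℕ
  m : ℕ

/-- State of the concave maximizer after step `t`: `y = ỹ_t`, `yNext = ỹ_{t+1}`, `v = ṽ_t`,
`u = ũ_t`. -/
structure InnerState (d₁ d₂ : ℕ) where
  y : Vec d₂
  yNext : Vec d₂
  v : Vec d₁
  u : Vec d₂
  evals : ℕ

/-- The concave maximizer at iteration `k`, with `x = x_k`, `xNext = x_{k+1}`, `y = y_k`,
`v = v_k`, `u = u_k`; during its steps the first argument stays at `x_{k+1}`. -/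
def concaveMaximizer (F : Vec d₁ → Vec d₂ → Ξ → ℝ) (p : Params) (ξ : SampleId → Ξ) (k : ℕ)
    (x xNext : Vec d₁) (y : Vec d₂) (v : Vec d₁) (u : Vec d₂) : ℕ → InnerState d₁ d₂
  | 0 =>
    let z := fun i => ξ (.small k 0 i)
    let v₀ := v + batchMean p.S₂ (fun i => gradX F xNext y (z i))
      - batchMean p.S₂ (fun i => gradX F x y (z i))
    let u₀ := u + batchMean p.S₂ (fun i => gradY F xNext y (z i))
      - batchMean p.S₂ (fun i => gradY F x y (z i))
    { y := y, yNext := y + p.lam • u₀, v := v₀, u := u₀, evals := 2 * p.S₂ }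
  | t + 1 =>
    let S := concaveMaximizer F p ξ k x xNext y v u t
    let z := fun i => ξ (.small k (t + 1) i)
    let v' := S.v + batchMean p.S₂ (fun i => gradX F xNext S.yNext (z i))
      - batchMean p.S₂ (fun i => gradX F xNext S.y (z i))
    let u' := S.u + batchMean p.S₂ (fun i => gradY F xNext S.yNext (z i))
      - batchMean p.S₂ (fun i => gradY F xNext S.y (z i))
    { y := S.yNext, yNext := S.yNext + p.lam • u', v := v', u := u',
      evals := S.evals + 2 * p.S₂ }

/-- State of SREDA at the start of iteration `k`: `x = x_k`, `y = y_k`, and the estimates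
`v = ṽ_{k-1, s_{k-1}+1}`, `u = ũ_{k-1, s_{k-1}+1}` passed on by the concave maximizer (unused if
`q ∣ k`, in particular for `k = 0`). -/
structure State (d₁ d₂ : ℕ) where
  x : Vec d₁
  y : Vec d₂
  v : Vec d₁
  u : Vec d₂
  evals : ℕ

/-- Iteration `k` of SREDA; the concave maximizer makes the steps `t = 0, …, m + 1`. -/
def sredaStep (F : Vec d₁ → Vec d₂ → Ξ → ℝ) (p : Params) (ξ : SampleId → Ξ) (c : ChoiceId → ℕ)
    (k : ℕ) (S : State d₁ d₂) : State d₁ d₂ :=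
  let v := if k % p.q = 0 then
    batchMean p.S₁ (fun i => gradX F S.x S.y (ξ (.large k i))) else S.v
  let u := if k % p.q = 0 then
    batchMean p.S₁ (fun i => gradY F S.x S.y (ξ (.large k i))) else S.u
  let xNext := S.x - p.η ‖v‖ • v
  let R := concaveMaximizer F p ξ k S.x xNext S.y v u
  let s := c (.inner k)
  { x := xNext
    y := (R s).yNext
    v := (R (s + 1)).v
    u := (R (s + 1)).u
    evals := S.evals + (if k % p.q = 0 then p.S₁ else 0) + (R (p.m + 1)).evals }

/-- The initialization `y₀` of SREDA, together with the number of gradient evaluations it used: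
iSARAH applied to `-f(x₀, ·)`, started at `w₀`. -/
def sredaInit (F : Vec d₁ → Vec d₂ → Ξ → ℝ) (J : ISarahParams) (ξ : SampleId → Ξ)
    (c : ChoiceId → ℕ) (x₀ : Vec d₁) (w₀ : Vec d₂) : Vec d₂ × ℕ :=
  iSarah (fun w z => gradient (fun w' => -F x₀ w' z) w) J ξ c w₀ J.T

/-- The state of SREDA after `k` iterations. -/
def sreda (F : Vec d₁ → Vec d₂ → Ξ → ℝ) (J : ISarahParams) (p : Params) (ξ : SampleId → Ξ)
    (c : ChoiceId → ℕ) (x₀ : Vec d₁) (w₀ : Vec d₂) : ℕ → State d₁ d₂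
  | 0 =>
    let I := sredaInit F J ξ c x₀ w₀
    { x := x₀, y := I.1, v := 0, u := 0, evals := I.2 }
  | k + 1 => sredaStep F p ξ c k (sreda F J p ξ c x₀ w₀ k)

/-! ### The choice of parameters -/

/-- The prescribed parameters, with `κ = ℓ / μ`. For `v_k = 0` the value of `η_k` is
irrelevant, as it multiplies `v_k`. -/
def params (ℓ μ σ ε : ℝ) : Params where
  ζ := (ℓ / μ)⁻¹ ^ 2 * ε ^ 2
  η := fun r => min (ε / (5 * (ℓ / μ) * ℓ * r)) (1 / (10 * (ℓ / μ) * ℓ))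
  lam := 2 / (7 * ℓ)
  q := ⌈ε⁻¹⌉₊
  S₁ := ⌈24 * σ ^ 2 * (ℓ / μ) ^ 2 * ε⁻¹ ^ 2⌉₊
  S₂ := ⌈7368 / 175 * (ℓ / μ) * (⌈ε⁻¹⌉₊ : ℝ)⌉₊
  m := ⌈28 * (ℓ / μ) - 1⌉₊

section Guarantees

variable [MeasurableSpace Ξ]

/-- The initialization has accuracy `ζ`: `𝔼 ‖∇_y f(x₀, y₀)‖² ≤ ζ`. -/
def InitAccurate {Ω : Type*} [MeasurableSpace Ω] (Q : Measure Ω) (P : Measure Ξ)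
    (F : Vec d₁ → Vec d₂ → Ξ → ℝ) (x₀ : Vec d₁) (ζ : ℝ) (y₀ : Ω → Vec d₂) : Prop :=
  Integrable (fun ω => ‖objGradY P F x₀ (y₀ ω)‖ ^ 2) Q ∧
    ∫ ω, ‖objGradY P F x₀ (y₀ ω)‖ ^ 2 ∂Q ≤ ζ

/-- `Δ_f = 𝔼 f(x₀, y₀) + κ⁻² ε² / (2 μ) - Φ*`. -/
def deltaF {Ω : Type*} [MeasurableSpace Ω] (Q : Measure Ω) (P : Measure Ξ)
    (F : Vec d₁ → Vec d₂ → Ξ → ℝ) (ℓ μ ε : ℝ) (x₀ : Vec d₁) (y₀ : Ω → Vec d₂) : ℝ :=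
  (∫ ω, obj P F x₀ (y₀ ω) ∂Q) + (ℓ / μ)⁻¹ ^ 2 * ε ^ 2 / (2 * μ) - PhiStar P F

/-- The number of iterations `K = ⌈100 κ ℓ ε⁻² Δ_f / 9⌉`. -/
def numIter (ℓ μ ε Δf : ℝ) : ℕ :=
  ⌈100 * (ℓ / μ) * ℓ * ε⁻¹ ^ 2 * Δf / 9⌉₊

end Guarantees

end Sreda

end

open Sreda

/-!
Both inner algorithms are inexact gradient ascent for the strongly concave functions `f(x, ·)`, and
the main loop is inexact gradient descent for `Φ`. The proof bounds the errors of the directions in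
mean square and shows that the progress of the iterations pays for them.

*The problem.* Only mean-square smoothness of the component functions is assumed, so their
gradients may be discontinuous in the point. Along a segment they are nevertheless derivatives that
are integrable for almost every sample; the fundamental theorem of calculus and Fubini's theorem
show that the gradients of `f` are the means of the stochastic gradients and are `ℓ`-Lipschitz
(`integral_sub_eq_segment`, `abs_integral_sub_linear_le`). Hence each partial stochastic gradient is
an `IsOracle`. Strong concavity gives a maximizer `y*(x)` that is `κ`-Lipschitz in `x`, and `Φ` is
squeezed between two quadratic functions with the common linear part `⟨∇ₓ f(x, y*(x)), ·⟩`
(`Assumptions.Phi_le_linear`, `Assumptions.linear_le_Phi`), which makes it differentiable with a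
Lipschitz gradient.

*The randomness.* By `IsTape.map_eq` the draws may be taken from a product measure, which is
invariant under redrawing a single coordinate. A quantity that does not depend on a coordinate can
therefore be treated as a constant when this coordinate is integrated out
(`integrable_integral_le_of_sample`, `integrable_integral_eq_of_choice`). So the mean-square error
of a recursive estimator grows in each step by at most the squared step length times `ℓ²`, divided
by the batch size (`IsOracle.integral_sq_update_sub_le`).

*Ascent in `y`.* Both the epochs of iSARAH and the concave maximizer are ascent loops `y ↦ y + λ u`
with recursive estimators `u` (`AscentLoop`). The ascent inequality bounds
`∑ (‖∇_y f‖² + (1 - λ ℓ) ‖u‖²)` by `‖∇_y f(y₀)‖² / (λ μ) + ∑ ‖u - ∇_y f‖²`, where the first term is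
the Polyak-Łojasiewicz inequality. The errors on the right are at most the initial error plus a
small multiple of `∑ ‖u‖²`, which the left side absorbs (`sum_le_of_error_growth`). No cocoercivity
of the component gradients is needed. A uniformly drawn iterate has the average squared gradient.
For iSARAH with steps of order `μ / ℓ²` and epochs of length of order `κ²`, an epoch divides the
squared gradient by `4` up to the batch error. The number of epochs of order `κ / ε` is far more than
the logarithm needed, but as an epoch costs `O(κ² ε⁻²)` the total remains `O(κ³ ε⁻³)`, with no
logarithmic factor.

*The main loop.* `RunInvariant`: at the start of each iteration `𝔼 ‖∇_y f(x_k, y_k)‖² ≤ ζ`, and the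
gradient estimates of iteration `k` have mean-square error at most
`ζ (1 / 24 + (k mod q) / (10 q))`. One call of the maximizer preserves both (`maximizer_step`).
Therefore `v_k` differs from `∇Φ(x_k)` by `O(ε)` in mean square, and the descent inequality
`Phi_step_le` for the clipped step, summed over `K` iterations, bounds the average of
`𝔼 ‖∇Φ(x_k)‖` by `25 / 4 ε`, which is below `1073 / 108 ε`.
-/

noncomputable section

namespace Sreda

/-! ### Differentiation under the expectation -/

theorem inner_gradient_eq {d : ℕ} {h : Vec d → ℝ} {w : Vec d} (hh : DifferentiableAt ℝ h w)
    (v : Vec d) : inner ℝ (gradient h w) v = fderiv ℝ h w v := by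
  have := hh.hasGradientAt.hasFDerivAt.fderiv
  rw [this]; simp

theorem hasDerivAt_segment {d : ℕ} {h : Vec d → ℝ} (hh : Differentiable ℝ h) (w v : Vec d)
    (t : ℝ) : HasDerivAt (fun s : ℝ => h (w + s • v)) (inner ℝ (gradient h (w + t • v)) v) t := by
  have h1 : HasDerivAt (fun s : ℝ => w + s • v) v t := by
    simpa using ((hasDerivAt_id t).smul_const v).const_add w
  rw [inner_gradient_eq (hh _)]
  exact (hh (w + t • v)).hasFDerivAt.comp_hasDerivAt t h1

/-- A gradient is a pointwise limit of difference quotients in the coordinate directions, so it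
depends measurably on the point and on any parameter. -/
theorem measurable_gradient {d : ℕ} {α : Type*} [MeasurableSpace α] {h : Vec d → α → ℝ}
    (hm : Measurable (fun p : Vec d × α => h p.1 p.2))
    (hd : ∀ a, Differentiable ℝ (fun w => h w a)) :
    Measurable (fun p : Vec d × α => gradient (fun w => h w p.2) p.1) := by
  have key : ∀ v : Vec d,
      Measurable (fun p : Vec d × α => inner ℝ (gradient (fun w => h w p.2) p.1) v) := by
    intro v
    have hpt : ∀ p : Vec d × α, Filter.Tendsto
        (fun n : ℕ => ((n : ℝ) + 1) * (h (p.1 + (1 / ((n : ℝ) + 1)) • v) p.2 - h p.1 p.2))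
        Filter.atTop (nhds (inner ℝ (gradient (fun w => h w p.2) p.1) v)) := by
      intro p
      have h1 := hasDerivAt_segment (hd p.2) p.1 v 0
      rw [hasDerivAt_iff_tendsto_slope] at h1
      simp only [zero_smul, add_zero] at h1
      have h2 : Filter.Tendsto (fun n : ℕ => 1 / ((n : ℝ) + 1)) Filter.atTop
          (nhdsWithin 0 {0}ᶜ) := by
        refine tendsto_nhdsWithin_iff.2 ⟨tendsto_one_div_add_atTop_nhds_zero_nat, ?_⟩
        filter_upwards with n
        have : (0 : ℝ) < 1 / ((n : ℝ) + 1) := by positivity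
        exact this.ne'
      refine (h1.comp h2).congr fun n => ?_
      simp [slope]
    refine measurable_of_tendsto_metrizable
      (f := fun (n : ℕ) (p : Vec d × α) =>
        ((n : ℝ) + 1) * (h (p.1 + (1 / ((n : ℝ) + 1)) • v) p.2 - h p.1 p.2)) ?_ ?_
    · intro n
      refine Measurable.const_mul (Measurable.sub ?_ hm) _
      exact hm.comp (((measurable_fst).add_const _).prodMk measurable_snd)
    · exact tendsto_pi_nhds.2 hpt
  have hrep : ∀ p : Vec d × α, gradient (fun w => h w p.2) p.1 =
      ∑ i, (inner ℝ (gradient (fun w => h w p.2) p.1) (EuclideanSpace.basisFun (Fin d) ℝ i)) •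
        (EuclideanSpace.basisFun (Fin d) ℝ i) := by
    intro p
    conv_lhs => rw [← (EuclideanSpace.basisFun (Fin d) ℝ).sum_repr
      (gradient (fun w => h w p.2) p.1)]
    refine Finset.sum_congr rfl fun i _ => ?_
    rw [OrthonormalBasis.repr_apply_apply, real_inner_comm]
  rw [show (fun p : Vec d × α => gradient (fun w => h w p.2) p.1) = fun p => _ from funext hrep]
  exact Finset.measurable_sum _ fun i _ => (key _).smul_const _

theorem measurable_gradient_right {d : ℕ} {α : Type*} [MeasurableSpace α] {h : Vec d → α → ℝ}
    (hm : ∀ w, Measurable (h w)) (hd : ∀ a, Differentiable ℝ (fun w => h w a)) :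
    Measurable (fun p : Vec d × α => gradient (fun w => h w p.2) p.1) :=
  measurable_gradient (measurable_uncurry_of_continuous_of_measurable
    (u := h) (fun a => (hd a).continuous) hm) hd

theorem integrable_norm_of_sq {Ξ : Type*} [MeasurableSpace Ξ] {P : Measure Ξ} [IsFiniteMeasure P]
    {E : Type*} [NormedAddCommGroup E] {X : Ξ → E} (hm : AEStronglyMeasurable X P)
    (h : Integrable (fun z => ‖X z‖ ^ 2) P) : Integrable X P :=
  ((memLp_two_iff_integrable_sq_norm hm).2 h).integrable (by norm_num)

/-- Jensen's inequality for the square of the norm. -/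
theorem norm_integral_sq_le {Ξ : Type*} [MeasurableSpace Ξ] {P : Measure Ξ}
    [IsProbabilityMeasure P] {E : Type*} [NormedAddCommGroup E] [NormedSpace ℝ E]
    {X : Ξ → E} (hm : AEStronglyMeasurable X P)
    (h : Integrable (fun z => ‖X z‖ ^ 2) P) : ‖∫ z, X z ∂P‖ ^ 2 ≤ ∫ z, ‖X z‖ ^ 2 ∂P := by
  have hi := (integrable_norm_of_sq hm h).norm
  set a := ∫ z, ‖X z‖ ∂P
  have h0 : 0 ≤ ∫ z, (‖X z‖ - a) ^ 2 ∂P := integral_nonneg fun z => sq_nonneg _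
  have h1 : ∫ z, (‖X z‖ - a) ^ 2 ∂P = (∫ z, ‖X z‖ ^ 2 ∂P) - a ^ 2 := by
    have : (fun z => (‖X z‖ - a) ^ 2) = fun z => ‖X z‖ ^ 2 - (2 * a) * ‖X z‖ + a ^ 2 := by
      funext z; ring
    have hs : Integrable (fun z => ‖X z‖ ^ 2 - (2 * a) * ‖X z‖) P := h.sub (hi.const_mul _)
    rw [this, integral_add hs (integrable_const _),
      integral_sub h (hi.const_mul _), integral_const_mul]
    simp only [integral_const, probReal_univ, smul_eq_mul, one_mul]
    change _ - 2 * a * a + a ^ 2 = _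
    ring
  have h2 : ‖∫ z, X z ∂P‖ ≤ a := norm_integral_le_integral_norm _
  have h3 : ‖∫ z, X z ∂P‖ ^ 2 ≤ a ^ 2 := by gcongr
  linarith

section Block

variable {d : ℕ} {Ξ : Type*} [MeasurableSpace Ξ] {P : Measure Ξ} [IsProbabilityMeasure P]
  {h : Vec d → Ξ → ℝ} {ℓ : ℝ}

/-- The mean of the component functions increases along a segment by the integral of the mean
gradient. The component gradients need not be continuous: along the segment they are derivatives,
and they are square integrable there for almost every sample, so that the fundamental theorem of
calculus applies to almost every component. -/
theorem integral_sub_eq_segment (hm : ∀ w, Measurable (h w))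
    (hi : ∀ w, Integrable (h w) P)
    (hd : ∀ z, Differentiable ℝ (fun w => h w z))
    (hg : ∀ w, Integrable (fun z => ‖gradient (fun w => h w z) w‖ ^ 2) P)
    (hL : ∀ w w', Integrable (fun z => ‖gradient (fun w => h w z) w
        - gradient (fun w => h w z) w'‖ ^ 2) P ∧
      ∫ z, ‖gradient (fun w => h w z) w - gradient (fun w => h w z) w'‖ ^ 2 ∂P
        ≤ ℓ ^ 2 * ‖w - w'‖ ^ 2) (w v : Vec d) :
    (∫ z, h (w + v) z ∂P) - ∫ z, h w z ∂P
      = ∫ t in (0 : ℝ)..1, inner ℝ (∫ z, gradient (fun w => h w z) (w + t • v) ∂P) v := by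
  have hmeas := measurable_gradient_right hm hd
  have hmw : ∀ w, Measurable (fun z => gradient (fun w => h w z) w) := fun w =>
    hmeas.comp (measurable_const.prodMk measurable_id)
  have hgi : ∀ w, Integrable (fun z => gradient (fun w => h w z) w) P := fun w =>
    integrable_norm_of_sq (hmw w).aestronglyMeasurable (hg w)
  set φ : ℝ → Ξ → ℝ := fun t z => inner ℝ (gradient (fun w => h w z) (w + t • v)) v with hφ
  have hφm : Measurable (Function.uncurry φ) := by
    have : Measurable (fun p : ℝ × Ξ => gradient (fun w => h w p.2) (w + p.1 • v)) :=
      hmeas.comp (((measurable_fst.smul_const v).const_add w).prodMk measurable_snd)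
    exact this.inner_const
  have hbound : ∀ t : ℝ, t ∈ Set.uIoc (0 : ℝ) 1 → ∫ z, ‖φ t z‖ ∂P ≤
      ((∫ z, ‖gradient (fun w => h w z) w‖ ∂P) + (1 + ℓ ^ 2 * ‖v‖ ^ 2)) * ‖v‖ := by
    intro t ht
    rw [Set.uIoc_of_le zero_le_one] at ht
    have e1 := hL (w + t • v) w
    have e2 : ∫ z, ‖gradient (fun w => h w z) (w + t • v)‖ ∂P ≤
        (∫ z, ‖gradient (fun w => h w z) w‖ ∂P) + (1 + ℓ ^ 2 * ‖v‖ ^ 2) := by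
      have e3 : ∫ z, ‖gradient (fun w => h w z) (w + t • v)‖ ∂P ≤
          ∫ z, (‖gradient (fun w => h w z) w‖ + (1 + ‖gradient (fun w => h w z) (w + t • v)
            - gradient (fun w => h w z) w‖ ^ 2)) ∂P := by
        refine integral_mono (hgi _).norm ((hgi w).norm.add ((integrable_const _).add e1.1)) ?_
        intro z
        simp only
        have := norm_le_norm_add_norm_sub' (gradient (fun w => h w z) (w + t • v))
          (gradient (fun w => h w z) w)
        nlinarith [sq_nonneg (‖gradient (fun w => h w z) (w + t • v)
            - gradient (fun w => h w z) w‖ - 1)]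
      have e5 : Integrable (fun z => 1 + ‖gradient (fun w => h w z) (w + t • v)
          - gradient (fun w => h w z) w‖ ^ 2) P := (integrable_const _).add e1.1
      rw [integral_add (hgi w).norm e5, integral_add (integrable_const _) e1.1] at e3
      simp only [integral_const, probReal_univ, smul_eq_mul, one_mul] at e3
      have e4 : ℓ ^ 2 * ‖w + t • v - w‖ ^ 2 ≤ ℓ ^ 2 * ‖v‖ ^ 2 := by
        rw [add_sub_cancel_left, norm_smul, mul_pow]
        have : ‖t‖ ^ 2 ≤ 1 := by
          rw [Real.norm_eq_abs, sq_abs]; nlinarith [ht.1, ht.2]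
        have h5 : 0 ≤ ‖v‖ ^ 2 := by positivity
        have h6 : ‖t‖ ^ 2 * ‖v‖ ^ 2 ≤ ‖v‖ ^ 2 := by nlinarith
        exact mul_le_mul_of_nonneg_left h6 (sq_nonneg _)
      linarith [e1.2]
    calc ∫ z, ‖φ t z‖ ∂P ≤ ∫ z, ‖gradient (fun w => h w z) (w + t • v)‖ * ‖v‖ ∂P :=
          integral_mono_of_nonneg (Filter.Eventually.of_forall fun z => norm_nonneg _)
            ((hgi _).norm.mul_const _)
            (Filter.Eventually.of_forall fun z => norm_inner_le_norm _ _)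
      _ = (∫ z, ‖gradient (fun w => h w z) (w + t • v)‖ ∂P) * ‖v‖ := integral_mul_const _ _
      _ ≤ _ := by gcongr
  have hφi : ∀ t, Integrable (φ t) P := fun t => (hgi _).inner_const v
  have hint : Integrable (Function.uncurry φ) ((volume.restrict (Set.uIoc (0 : ℝ) 1)).prod P) := by
    rw [integrable_prod_iff hφm.aestronglyMeasurable]
    refine ⟨Filter.Eventually.of_forall hφi, ?_⟩
    have : IsFiniteMeasure (volume.restrict (Set.uIoc (0 : ℝ) 1)) := by
      rw [Set.uIoc_of_le zero_le_one]; infer_instance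
    refine Integrable.of_bound
      (hφm.norm.stronglyMeasurable.integral_prod_right'.aestronglyMeasurable)
      (((∫ z, ‖gradient (fun w => h w z) w‖ ∂P) + (1 + ℓ ^ 2 * ‖v‖ ^ 2)) * ‖v‖) ?_
    refine (ae_restrict_iff' measurableSet_uIoc).2 (Filter.Eventually.of_forall fun t ht => ?_)
    rw [Real.norm_of_nonneg (integral_nonneg fun z => norm_nonneg _)]
    exact hbound t ht
  have hsec : ∀ᵐ z ∂P, h (w + v) z - h w z = ∫ t in (0 : ℝ)..1, φ t z := by
    filter_upwards [hint.prod_left_ae] with z hz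
    have := intervalIntegral.integral_eq_sub_of_hasDerivAt (a := 0) (b := 1)
      (f := fun s : ℝ => h (w + s • v) z) (f' := fun t => φ t z)
      (fun t _ => hasDerivAt_segment (hd z) w v t) (intervalIntegrable_iff.2 hz)
    rw [this]; simp
  rw [← integral_sub (hi _) (hi _), integral_congr_ae hsec, ← intervalIntegral_integral_swap hint]
  refine intervalIntegral.integral_congr fun t _ => ?_
  simp only [hφ]
  rw [integral_congr_ae (Filter.Eventually.of_forall fun z => real_inner_comm _ _),
    integral_inner (hgi _), real_inner_comm]

/-- The mean gradient inherits the average Lipschitz constant. -/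
theorem norm_integral_gradient_sub_le {α : Type*} {E : Type*} [NormedAddCommGroup E]
    [NormedSpace ℝ E] {g : α → Ξ → E} (hgi : ∀ w, Integrable (g w) P) {w w' : α} {r : ℝ}
    (hr : 0 ≤ r)
    (hL : Integrable (fun z => ‖g w z - g w' z‖ ^ 2) P ∧ ∫ z, ‖g w z - g w' z‖ ^ 2 ∂P ≤ r ^ 2) :
    ‖(∫ z, g w z ∂P) - ∫ z, g w' z ∂P‖ ≤ r := by
  rw [← integral_sub (hgi _) (hgi _)]
  have := norm_integral_sq_le ((hgi w).sub (hgi w')).aestronglyMeasurable hL.1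
  exact abs_le_of_sq_le_sq' (this.trans hL.2) hr |>.2

/-- Quadratic bound for the error of the linearization of the mean. -/
theorem abs_integral_sub_linear_le (hℓ : 0 ≤ ℓ) (hm : ∀ w, Measurable (h w))
    (hi : ∀ w, Integrable (h w) P)
    (hd : ∀ z, Differentiable ℝ (fun w => h w z))
    (hg : ∀ w, Integrable (fun z => ‖gradient (fun w => h w z) w‖ ^ 2) P)
    (hL : ∀ w w', Integrable (fun z => ‖gradient (fun w => h w z) w
        - gradient (fun w => h w z) w'‖ ^ 2) P ∧
      ∫ z, ‖gradient (fun w => h w z) w - gradient (fun w => h w z) w'‖ ^ 2 ∂P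
        ≤ ℓ ^ 2 * ‖w - w'‖ ^ 2) (w w' : Vec d) :
    |(∫ z, h w' z ∂P) - (∫ z, h w z ∂P)
        - inner ℝ (∫ z, gradient (fun w => h w z) w ∂P) (w' - w)| ≤ ℓ / 2 * ‖w' - w‖ ^ 2 := by
  have hmeas := measurable_gradient_right hm hd
  have hgi : ∀ w, Integrable (fun z => gradient (fun w => h w z) w) P := fun w =>
    integrable_norm_of_sq (hmeas.comp (measurable_const.prodMk measurable_id)).aestronglyMeasurable
      (hg w)
  set v := w' - w with hv
  set g := fun w => ∫ z, gradient (fun w => h w z) w ∂P with hgdef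
  have hlip : ∀ a b, ‖g a - g b‖ ≤ ℓ * ‖a - b‖ := fun a b =>
    norm_integral_gradient_sub_le hgi (by positivity) (by rw [mul_pow]; exact hL a b)
  have hcont : Continuous g := by
    refine (LipschitzWith.of_dist_le_mul (K := ⟨ℓ, hℓ⟩) fun a b => ?_).continuous
    rw [dist_eq_norm, dist_eq_norm]; exact hlip a b
  have key := integral_sub_eq_segment hm hi hd hg hL w v
  have hw : w + v = w' := by rw [hv]; abel
  rw [hw] at key
  have hc : Continuous fun t : ℝ => inner ℝ (g (w + t • v)) v := by fun_prop
  have e1 : (∫ z, h w' z ∂P) - (∫ z, h w z ∂P) - inner ℝ (g w) v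
      = ∫ t in (0 : ℝ)..1, (inner ℝ (g (w + t • v)) v - inner ℝ (g w) v) := by
    rw [key, intervalIntegral.integral_sub (hc.intervalIntegrable _ _)
      (continuous_const.intervalIntegrable _ _)]
    simp [hgdef]
  change |(∫ z, h w' z ∂P) - (∫ z, h w z ∂P) - inner ℝ (g w) v| ≤ _
  rw [e1]
  have e2 : ‖∫ t in (0 : ℝ)..1, (inner ℝ (g (w + t • v)) v - inner ℝ (g w) v)‖
      ≤ ∫ t in (0 : ℝ)..1, (ℓ * ‖v‖ ^ 2) * t := by
    refine intervalIntegral.norm_integral_le_of_norm_le zero_le_one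
      (Filter.Eventually.of_forall fun t ht => ?_)
      ((continuous_const.mul continuous_id).intervalIntegrable _ _)
    rw [← inner_sub_left]
    refine (norm_inner_le_norm _ _).trans ?_
    have := hlip (w + t • v) w
    rw [add_sub_cancel_left, norm_smul, Real.norm_of_nonneg ht.1.le] at this
    calc ‖g (w + t • v) - g w‖ * ‖v‖ ≤ (ℓ * (t * ‖v‖)) * ‖v‖ := by gcongr
      _ = _ := by ring
  rw [intervalIntegral.integral_const_mul, integral_id] at e2
  rw [← Real.norm_eq_abs]
  linarith

theorem hasGradientAt_of_abs_sub_le {H : Vec d → ℝ} {g w : Vec d} {C : ℝ}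
    (hH : ∀ w', |H w' - H w - inner ℝ g (w' - w)| ≤ C * ‖w' - w‖ ^ 2) : HasGradientAt H g w := by
  rw [hasGradientAt_iff_isLittleO]
  have h1 : (fun w' => H w' - H w - inner ℝ g (w' - w)) =O[nhds w] fun w' => ‖w' - w‖ ^ 2 := by
    refine Asymptotics.IsBigO.of_bound C (Filter.Eventually.of_forall fun w' => ?_)
    rw [Real.norm_eq_abs, Real.norm_of_nonneg (by positivity : (0:ℝ) ≤ ‖w' - w‖ ^ 2)]
    exact hH w'
  refine h1.trans_isLittleO ?_
  exact Asymptotics.isLittleO_pow_sub_sub w one_lt_two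

end Block

/-! ### Stochastic gradients and the gradients of the objective -/

/-- A stochastic oracle `G` for the vector field `g`: it is unbiased with variance at most `σ²`
and mean-square Lipschitz with constant `ℓ`. Both partial gradients of the component function are
oracles of this kind, for the corresponding partial gradient of the objective. -/
structure IsOracle {d₁ d₂ d : ℕ} {Ξ : Type*} [MeasurableSpace Ξ] (P : Measure Ξ)
    (G : Vec d₁ → Vec d₂ → Ξ → Vec d) (g : Vec d₁ → Vec d₂ → Vec d) (ℓ σ : ℝ) : Prop where
  measurable : Measurable (fun p : (Vec d₁ × Vec d₂) × Ξ => G p.1.1 p.1.2 p.2)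
  integrable : ∀ x y, Integrable (G x y) P
  mean : ∀ x y, ∫ z, G x y z ∂P = g x y
  lipschitz : ∀ x y x' y', Integrable (fun z => ‖G x y z - G x' y' z‖ ^ 2) P ∧
    ∫ z, ‖G x y z - G x' y' z‖ ^ 2 ∂P ≤ ℓ ^ 2 * (‖x - x'‖ ^ 2 + ‖y - y'‖ ^ 2)
  variance : ∀ x y, Integrable (fun z => ‖G x y z - g x y‖ ^ 2) P ∧
    ∫ z, ‖G x y z - g x y‖ ^ 2 ∂P ≤ σ ^ 2

theorem integrable_left_of_add {Ξ : Type*} [MeasurableSpace Ξ] {P : Measure Ξ} {f g : Ξ → ℝ}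
    (hf : AEStronglyMeasurable f P) (h0f : ∀ z, 0 ≤ f z) (h0 : ∀ z, 0 ≤ g z) {C : ℝ}
    (h : Integrable (fun z => f z + g z) P ∧ ∫ z, (f z + g z) ∂P ≤ C) :
    Integrable f P ∧ ∫ z, f z ∂P ≤ C := by
  have hi : Integrable f P := h.1.mono' hf (Filter.Eventually.of_forall fun z => by
    rw [Real.norm_of_nonneg (h0f z)]; linarith [h0 z])
  exact ⟨hi, (integral_mono hi h.1 fun z => by simp only; linarith [h0 z]).trans h.2⟩

namespace IsOracle

variable {d₁ d₂ d : ℕ} {Ξ : Type*} [MeasurableSpace Ξ] {P : Measure Ξ} [IsProbabilityMeasure P]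
  {G : Vec d₁ → Vec d₂ → Ξ → Vec d} {g : Vec d₁ → Vec d₂ → Vec d} {ℓ σ : ℝ}

theorem norm_sub_le (O : IsOracle P G g ℓ σ) (hℓ : 0 ≤ ℓ) (x x' : Vec d₁) (y y' : Vec d₂) :
    ‖g x y - g x' y'‖ ≤ ℓ * (‖x - x'‖ + ‖y - y'‖) := by
  have h := O.lipschitz x y x' y'
  rw [← O.mean x y, ← O.mean x' y']
  refine norm_integral_gradient_sub_le (α := Vec d₁ × Vec d₂) (g := fun p => G p.1 p.2)
    (w := (x, y)) (w' := (x', y')) (fun p => O.integrable _ _) (by positivity)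
    ⟨h.1, h.2.trans ?_⟩
  rw [mul_pow]
  have : 0 ≤ ‖x - x'‖ * ‖y - y'‖ := by positivity
  exact mul_le_mul_of_nonneg_left (by nlinarith) (sq_nonneg _)

theorem norm_sub_le_right (O : IsOracle P G g ℓ σ) (hℓ : 0 ≤ ℓ) (x : Vec d₁) (y y' : Vec d₂) :
    ‖g x y - g x y'‖ ≤ ℓ * ‖y - y'‖ := by
  simpa using O.norm_sub_le hℓ x x y y'

theorem norm_sub_le_left (O : IsOracle P G g ℓ σ) (hℓ : 0 ≤ ℓ) (x x' : Vec d₁) (y : Vec d₂) :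
    ‖g x y - g x' y‖ ≤ ℓ * ‖x - x'‖ := by
  simpa using O.norm_sub_le hℓ x x' y y

theorem continuous_field (O : IsOracle P G g ℓ σ) (hℓ : 0 ≤ ℓ) :
    Continuous (fun p : Vec d₁ × Vec d₂ => g p.1 p.2) := by
  refine (LipschitzWith.of_dist_le_mul (K := ⟨ℓ * 2, by positivity⟩) fun p p' => ?_).continuous
  rw [dist_eq_norm, dist_eq_norm]
  refine (O.norm_sub_le hℓ _ _ _ _).trans ?_
  change _ ≤ ℓ * 2 * ‖p - p'‖
  have h1 : ‖p.1 - p'.1‖ ≤ ‖p - p'‖ := norm_fst_le (p - p')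
  have h2 : ‖p.2 - p'.2‖ ≤ ‖p - p'‖ := norm_snd_le (p - p')
  nlinarith

end IsOracle

namespace Assumptions

variable {d₁ d₂ : ℕ} {Ξ : Type*} [MeasurableSpace Ξ] {P : Measure Ξ}
  {F : Vec d₁ → Vec d₂ → Ξ → ℝ} {ℓ μ σ : ℝ} (A : Assumptions P F ℓ μ σ)

include A

theorem measurable_uncurry :
    Measurable (fun p : (Vec d₁ × Vec d₂) × Ξ => F p.1.1 p.1.2 p.2) :=
  measurable_uncurry_of_continuous_of_measurable
    (u := fun (z : Vec d₁ × Vec d₂) ξ => F z.1 z.2 ξ) (fun ξ => (A.differentiable ξ).continuous)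
    (fun z => A.measurable z.1 z.2)

theorem differentiable_left (y : Vec d₂) (ξ : Ξ) : Differentiable ℝ (fun x => F x y ξ) :=
  (A.differentiable ξ).comp (f := fun x : Vec d₁ => (x, y)) (by fun_prop)

theorem differentiable_right (x : Vec d₁) (ξ : Ξ) : Differentiable ℝ (fun y => F x y ξ) :=
  (A.differentiable ξ).comp (f := fun y : Vec d₂ => (x, y)) (by fun_prop)

theorem measurable_gradX :
    Measurable (fun p : (Vec d₁ × Vec d₂) × Ξ => gradX F p.1.1 p.1.2 p.2) := by
  have h := measurable_gradient (α := Vec d₂ × Ξ) (h := fun x a => F x a.1 a.2)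
    (A.measurable_uncurry.comp (g := fun p : (Vec d₁ × Vec d₂) × Ξ => F p.1.1 p.1.2 p.2)
      (f := fun p : Vec d₁ × (Vec d₂ × Ξ) => ((p.1, p.2.1), p.2.2)) (by fun_prop))
    (fun a => A.differentiable_left a.1 a.2)
  exact h.comp (f := fun p : (Vec d₁ × Vec d₂) × Ξ => (p.1.1, (p.1.2, p.2))) (by fun_prop)

theorem measurable_gradY :
    Measurable (fun p : (Vec d₁ × Vec d₂) × Ξ => gradY F p.1.1 p.1.2 p.2) := by
  have h := measurable_gradient (α := Vec d₁ × Ξ) (h := fun y a => F a.1 y a.2)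
    (A.measurable_uncurry.comp (g := fun p : (Vec d₁ × Vec d₂) × Ξ => F p.1.1 p.1.2 p.2)
      (f := fun p : Vec d₂ × (Vec d₁ × Ξ) => ((p.2.1, p.1), p.2.2)) (by fun_prop))
    (fun a => A.differentiable_right a.1 a.2)
  exact h.comp (f := fun p : (Vec d₁ × Vec d₂) × Ξ => (p.1.2, (p.1.1, p.2))) (by fun_prop)

theorem measurable_gradX_apply (x : Vec d₁) (y : Vec d₂) : Measurable (gradX F x y) :=
  A.measurable_gradX.comp (f := fun z : Ξ => ((x, y), z)) (by fun_prop)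

theorem measurable_gradY_apply (x : Vec d₁) (y : Vec d₂) : Measurable (gradY F x y) :=
  A.measurable_gradY.comp (f := fun z : Ξ => ((x, y), z)) (by fun_prop)

theorem lipschitz_gradX (x : Vec d₁) (y : Vec d₂) (x' : Vec d₁) (y' : Vec d₂) :
    Integrable (fun z => ‖gradX F x y z - gradX F x' y' z‖ ^ 2) P ∧
    ∫ z, ‖gradX F x y z - gradX F x' y' z‖ ^ 2 ∂P ≤ ℓ ^ 2 * (‖x - x'‖ ^ 2 + ‖y - y'‖ ^ 2) :=
  integrable_left_of_add (((A.measurable_gradX_apply x y).sub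
    (A.measurable_gradX_apply x' y')).norm.pow_const 2).aestronglyMeasurable
    (fun z => by positivity) (fun z => by positivity) (A.avg_lipschitz x y x' y')

theorem lipschitz_gradY (x : Vec d₁) (y : Vec d₂) (x' : Vec d₁) (y' : Vec d₂) :
    Integrable (fun z => ‖gradY F x y z - gradY F x' y' z‖ ^ 2) P ∧
    ∫ z, ‖gradY F x y z - gradY F x' y' z‖ ^ 2 ∂P ≤ ℓ ^ 2 * (‖x - x'‖ ^ 2 + ‖y - y'‖ ^ 2) :=
  integrable_left_of_add (f := fun z => ‖gradY F x y z - gradY F x' y' z‖ ^ 2)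
    (g := fun z => ‖gradX F x y z - gradX F x' y' z‖ ^ 2)
    (((A.measurable_gradY_apply x y).sub
      (A.measurable_gradY_apply x' y')).norm.pow_const 2).aestronglyMeasurable
    (fun z => by positivity) (fun z => by positivity)
    (by simpa only [add_comm] using A.avg_lipschitz x y x' y')

theorem variance_gradX (x : Vec d₁) (y : Vec d₂) :
    Integrable (fun z => ‖gradX F x y z - objGradX P F x y‖ ^ 2) P ∧
    ∫ z, ‖gradX F x y z - objGradX P F x y‖ ^ 2 ∂P ≤ σ ^ 2 :=
  integrable_left_of_add (((A.measurable_gradX_apply x y).sub_const _).norm.pow_const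
    2).aestronglyMeasurable
    (fun z => by positivity) (fun z => by positivity) (A.variance x y)

theorem variance_gradY (x : Vec d₁) (y : Vec d₂) :
    Integrable (fun z => ‖gradY F x y z - objGradY P F x y‖ ^ 2) P ∧
    ∫ z, ‖gradY F x y z - objGradY P F x y‖ ^ 2 ∂P ≤ σ ^ 2 :=
  integrable_left_of_add (g := fun z => ‖gradX F x y z - objGradX P F x y‖ ^ 2)
    (((A.measurable_gradY_apply x y).sub_const _).norm.pow_const 2).aestronglyMeasurable
    (fun z => by positivity) (fun z => by positivity)
    (by simpa only [add_comm] using A.variance x y)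

variable [IsProbabilityMeasure P]

omit A in
theorem integrable_sq_of_sub_const {E : Type*} [NormedAddCommGroup E] {X : Ξ → E} {c : E}
    (hX : AEStronglyMeasurable X P) (h : Integrable (fun z => ‖X z - c‖ ^ 2) P) :
    Integrable (fun z => ‖X z‖ ^ 2) P := by
  have h1 : MemLp (fun z => X z - c) 2 P :=
    (memLp_two_iff_integrable_sq_norm (hX.sub aestronglyMeasurable_const)).2 h
  have h2 : MemLp (fun z => (X z - c) + c) 2 P := h1.add (memLp_const c)
  simp only [sub_add_cancel] at h2
  exact (memLp_two_iff_integrable_sq_norm hX).1 h2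

theorem integrable_sq_gradX (x : Vec d₁) (y : Vec d₂) :
    Integrable (fun z => ‖gradX F x y z‖ ^ 2) P :=
  integrable_sq_of_sub_const (A.measurable_gradX_apply x y).aestronglyMeasurable
    (A.variance_gradX x y).1

theorem integrable_sq_gradY (x : Vec d₁) (y : Vec d₂) :
    Integrable (fun z => ‖gradY F x y z‖ ^ 2) P :=
  integrable_sq_of_sub_const (A.measurable_gradY_apply x y).aestronglyMeasurable
    (A.variance_gradY x y).1

theorem abs_obj_sub_left_le_integral (x x' : Vec d₁) (y : Vec d₂) :
    |obj P F x' y - obj P F x y - inner ℝ (∫ z, gradX F x y z ∂P) (x' - x)|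
      ≤ ℓ / 2 * ‖x' - x‖ ^ 2 :=
  abs_integral_sub_linear_le (h := fun x z => F x y z) A.ell_pos.le (fun x => A.measurable x y)
    (fun x => A.integrable x y) (fun z => A.differentiable_left y z)
    (fun x => A.integrable_sq_gradX x y)
    (fun w w' => by simpa [gradX] using A.lipschitz_gradX w y w' y) x x'

theorem abs_obj_sub_right_le_integral (x : Vec d₁) (y y' : Vec d₂) :
    |obj P F x y' - obj P F x y - inner ℝ (∫ z, gradY F x y z ∂P) (y' - y)|
      ≤ ℓ / 2 * ‖y' - y‖ ^ 2 :=
  abs_integral_sub_linear_le (h := fun y z => F x y z) A.ell_pos.le (fun y => A.measurable x y)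
    (fun y => A.integrable x y) (fun z => A.differentiable_right x z)
    (fun y => A.integrable_sq_gradY x y)
    (fun w w' => by simpa [gradY] using A.lipschitz_gradY x w x w') y y'

theorem integral_gradX (x : Vec d₁) (y : Vec d₂) :
    ∫ z, gradX F x y z ∂P = objGradX P F x y :=
  (hasGradientAt_of_abs_sub_le (H := fun x => obj P F x y)
    fun x' => A.abs_obj_sub_left_le_integral x x' y).gradient.symm

theorem integral_gradY (x : Vec d₁) (y : Vec d₂) :
    ∫ z, gradY F x y z ∂P = objGradY P F x y :=
  (hasGradientAt_of_abs_sub_le (H := fun y => obj P F x y)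
    fun y' => A.abs_obj_sub_right_le_integral x y y').gradient.symm

theorem abs_obj_sub_left_le (x x' : Vec d₁) (y : Vec d₂) :
    |obj P F x' y - obj P F x y - inner ℝ (objGradX P F x y) (x' - x)|
      ≤ ℓ / 2 * ‖x' - x‖ ^ 2 := by
  rw [← A.integral_gradX]; exact A.abs_obj_sub_left_le_integral x x' y

theorem abs_obj_sub_right_le (x : Vec d₁) (y y' : Vec d₂) :
    |obj P F x y' - obj P F x y - inner ℝ (objGradY P F x y) (y' - y)|
      ≤ ℓ / 2 * ‖y' - y‖ ^ 2 := by
  rw [← A.integral_gradY]; exact A.abs_obj_sub_right_le_integral x y y'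

theorem oracleX : IsOracle P (gradX F) (objGradX P F) ℓ σ where
  measurable := A.measurable_gradX
  integrable x y := integrable_norm_of_sq (A.measurable_gradX_apply x y).aestronglyMeasurable
    (A.integrable_sq_gradX x y)
  mean := A.integral_gradX
  lipschitz := A.lipschitz_gradX
  variance := A.variance_gradX

theorem oracleY : IsOracle P (gradY F) (objGradY P F) ℓ σ where
  measurable := A.measurable_gradY
  integrable x y := integrable_norm_of_sq (A.measurable_gradY_apply x y).aestronglyMeasurable
    (A.integrable_sq_gradY x y)
  mean := A.integral_gradY
  lipschitz := A.lipschitz_gradY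
  variance := A.variance_gradY

/-! ### The inner maximization and the primal function -/

theorem hasGradientAt_obj_right (x : Vec d₁) (y : Vec d₂) :
    HasGradientAt (fun y => obj P F x y) (objGradY P F x y) y :=
  hasGradientAt_of_abs_sub_le (A.abs_obj_sub_right_le x y)

theorem continuous_obj_right (x : Vec d₁) : Continuous (fun y => obj P F x y) :=
  continuous_iff_continuousAt.2 fun y => (A.hasGradientAt_obj_right x y).continuousAt

theorem exists_maximizer (x : Vec d₁) : ∃ y, ∀ y', obj P F x y' ≤ obj P F x y := by
  refine (A.continuous_obj_right x).exists_forall_ge ?_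
  have h : Filter.Tendsto (fun y : Vec d₂ => obj P F x 0
      + ‖y‖ * (‖objGradY P F x 0‖ - μ / 2 * ‖y‖)) (Filter.cocompact _) Filter.atBot := by
    refine Filter.tendsto_atBot_add_const_left _ _ ?_
    refine Filter.Tendsto.atTop_mul_atBot₀ (tendsto_norm_cocompact_atTop) ?_
    refine Filter.tendsto_atBot_add_const_left _ _ ?_
    refine Filter.tendsto_neg_atTop_atBot.comp ?_
    exact (tendsto_norm_cocompact_atTop).const_mul_atTop (by linarith [A.mu_pos])
  refine Filter.tendsto_atBot_mono (fun y => ?_) h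
  have h1 := A.strong_concave x y 0
  have h2 := real_inner_le_norm (objGradY P F x 0) (y - 0)
  rw [sub_zero] at h1 h2
  nlinarith

omit A in
/-- A maximizer of `f(x, ·)`; the junk value `0` is used only if there is none, which strong
concavity excludes. -/
def argmax (P : Measure Ξ) (F : Vec d₁ → Vec d₂ → Ξ → ℝ) (x : Vec d₁) : Vec d₂ :=
  open Classical in
  if h : ∃ y, ∀ y', obj P F x y' ≤ obj P F x y then h.choose else 0

theorem obj_le_argmax (x : Vec d₁) (y : Vec d₂) : obj P F x y ≤ obj P F x (argmax P F x) := by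
  have h := A.exists_maximizer x
  rw [argmax, dif_pos h]
  exact h.choose_spec y

theorem objGradY_argmax (x : Vec d₁) : objGradY P F x (argmax P F x) = 0 := by
  have h := (A.hasGradientAt_obj_right x (argmax P F x)).hasFDerivAt
  have h0 : IsLocalMax (fun y => obj P F x y) (argmax P F x) :=
    Filter.Eventually.of_forall fun y => A.obj_le_argmax x y
  have := h0.hasFDerivAt_eq_zero h
  simpa using this

theorem Phi_eq (x : Vec d₁) : Phi P F x = obj P F x (argmax P F x) :=
  le_antisymm (ciSup_le fun y => A.obj_le_argmax x y)
    (le_ciSup (f := fun y => obj P F x y)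
      ⟨_, Set.forall_mem_range.2 fun y => A.obj_le_argmax x y⟩ _)

theorem obj_le_Phi (x : Vec d₁) (y : Vec d₂) : obj P F x y ≤ Phi P F x := by
  rw [A.Phi_eq]; exact A.obj_le_argmax x y

omit [IsProbabilityMeasure P] in
theorem PhiStar_le (x : Vec d₁) : PhiStar P F ≤ Phi P F x := ciInf_le A.bddBelow x

/-- The Polyak-Łojasiewicz inequality. -/
theorem Phi_sub_obj_le (x : Vec d₁) (y : Vec d₂) :
    Phi P F x - obj P F x y ≤ ‖objGradY P F x y‖ ^ 2 / (2 * μ) := by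
  rw [A.Phi_eq]
  have h1 := A.strong_concave x (argmax P F x) y
  have h2 := real_inner_le_norm (objGradY P F x y) (argmax P F x - y)
  have hμ := A.mu_pos
  have h3 : ‖objGradY P F x y‖ * ‖argmax P F x - y‖ - μ / 2 * ‖argmax P F x - y‖ ^ 2
      ≤ ‖objGradY P F x y‖ ^ 2 / (2 * μ) := by
    rw [le_div_iff₀ (by positivity)]
    nlinarith [sq_nonneg (‖objGradY P F x y‖ - μ * ‖argmax P F x - y‖)]
  linarith

omit [IsProbabilityMeasure P] in
theorem strong_monotone (x : Vec d₁) (y y' : Vec d₂) :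
    μ * ‖y - y'‖ ≤ ‖objGradY P F x y - objGradY P F x y'‖ := by
  have h1 := A.strong_concave x y y'
  have h2 := A.strong_concave x y' y
  have h3 : inner ℝ (objGradY P F x y) (y' - y) = - inner ℝ (objGradY P F x y) (y - y') := by
    rw [← inner_neg_right, neg_sub]
  have h4 := real_inner_le_norm (objGradY P F x y' - objGradY P F x y) (y - y')
  rw [inner_sub_left] at h4
  rw [norm_sub_rev y' y] at h2
  rw [norm_sub_rev (objGradY P F x y')] at h4
  rcases (norm_nonneg (y - y')).eq_or_lt with h0 | h0
  · rw [← h0]; simp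
  · by_contra hc
    push Not at hc
    nlinarith

theorem mu_le_ell (hd : 0 < d₂) : μ ≤ ℓ := by
  set e : Vec d₂ := EuclideanSpace.single ⟨0, hd⟩ 1 with he
  have hn : ‖e‖ = 1 := by rw [he]; simp
  have h1 := A.strong_monotone 0 e 0
  have h2 := A.oracleY.norm_sub_le_right A.ell_pos.le 0 e 0
  rw [sub_zero, hn] at h1 h2
  linarith

theorem norm_sub_argmax_le (x : Vec d₁) (y : Vec d₂) :
    μ * ‖y - argmax P F x‖ ≤ ‖objGradY P F x y‖ := by
  simpa [A.objGradY_argmax] using A.strong_monotone x y (argmax P F x)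

theorem norm_argmax_sub_le (x x' : Vec d₁) :
    ‖argmax P F x - argmax P F x'‖ ≤ ℓ / μ * ‖x - x'‖ := by
  have h1 := A.norm_sub_argmax_le x' (argmax P F x)
  have h2 := A.oracleY.norm_sub_le_left A.ell_pos.le x x' (argmax P F x)
  rw [A.objGradY_argmax, zero_sub, norm_neg] at h2
  rw [div_mul_eq_mul_div, le_div_iff₀ A.mu_pos]
  linarith

theorem norm_objGradX_argmax_sub_le (x x' : Vec d₁) :
    ‖objGradX P F x (argmax P F x) - objGradX P F x' (argmax P F x')‖
      ≤ ℓ * (1 + ℓ / μ) * ‖x - x'‖ := by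
  have h1 := A.oracleX.norm_sub_le A.ell_pos.le x x' (argmax P F x) (argmax P F x')
  have h2 := A.norm_argmax_sub_le x x'
  have h3 := mul_le_mul_of_nonneg_left h2 A.ell_pos.le
  linarith

theorem Phi_le_linear (x x' : Vec d₁) :
    Phi P F x' ≤ Phi P F x + inner ℝ (objGradX P F x (argmax P F x)) (x' - x)
      + ℓ * (3 / 2 + ℓ / μ) * ‖x' - x‖ ^ 2 := by
  have h1 := (abs_le.1 (A.abs_obj_sub_left_le x' x (argmax P F x'))).1
  have h2 := A.obj_le_Phi x (argmax P F x')
  rw [← A.Phi_eq] at h1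
  have h3 : inner ℝ (objGradX P F x' (argmax P F x')) (x - x')
      = - inner ℝ (objGradX P F x' (argmax P F x') - objGradX P F x (argmax P F x)) (x' - x)
        - inner ℝ (objGradX P F x (argmax P F x)) (x' - x) := by
    rw [inner_sub_left, ← neg_sub x' x, inner_neg_right]; ring
  have h4 := real_inner_le_norm
    (objGradX P F x' (argmax P F x') - objGradX P F x (argmax P F x)) (x' - x)
  have h5 := mul_le_mul_of_nonneg_right (A.norm_objGradX_argmax_sub_le x' x)
    (norm_nonneg (x' - x))
  rw [norm_sub_rev x x'] at h1
  nlinarith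

theorem linear_le_Phi (x x' : Vec d₁) :
    Phi P F x + inner ℝ (objGradX P F x (argmax P F x)) (x' - x) - ℓ / 2 * ‖x' - x‖ ^ 2
      ≤ Phi P F x' := by
  have h1 := (abs_le.1 (A.abs_obj_sub_left_le x x' (argmax P F x))).1
  have h2 := A.obj_le_Phi x' (argmax P F x)
  rw [A.Phi_eq x]
  linarith

theorem hasGradientAt_Phi (x : Vec d₁) :
    HasGradientAt (Phi P F) (objGradX P F x (argmax P F x)) x := by
  refine hasGradientAt_of_abs_sub_le (C := ℓ * (3 / 2 + ℓ / μ)) fun x' => ?_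
  have h1 := A.Phi_le_linear x x'
  have h2 := A.linear_le_Phi x x'
  have hl := A.ell_pos
  have h3 : 0 < ℓ * (ℓ / μ) := by have := A.mu_pos; positivity
  have h4 : ℓ / 2 * ‖x' - x‖ ^ 2 ≤ ℓ * (3 / 2 + ℓ / μ) * ‖x' - x‖ ^ 2 := by
    gcongr; nlinarith
  exact abs_le.2 ⟨by linarith, by linarith⟩

theorem differentiable_Phi : Differentiable ℝ (Phi P F) := fun x =>
  (A.hasGradientAt_Phi x).differentiableAt

theorem gradient_Phi (x : Vec d₁) :
    gradient (Phi P F) x = objGradX P F x (argmax P F x) := (A.hasGradientAt_Phi x).gradient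

theorem norm_gradient_Phi_sub_le (x x' : Vec d₁) :
    ‖gradient (Phi P F) x - gradient (Phi P F) x'‖ ≤ ℓ * (1 + ℓ / μ) * ‖x - x'‖ := by
  rw [A.gradient_Phi, A.gradient_Phi]; exact A.norm_objGradX_argmax_sub_le x x'

theorem continuous_gradient_Phi : Continuous (gradient (Phi P F)) := by
  have hpos : 0 ≤ ℓ * (1 + ℓ / μ) := by have := A.ell_pos; have := A.mu_pos; positivity
  refine (LipschitzWith.of_dist_le_mul (K := ⟨_, hpos⟩) fun x x' => ?_).continuous
  rw [dist_eq_norm, dist_eq_norm]; exact A.norm_gradient_Phi_sub_le x x'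

theorem norm_gradient_Phi_sub_objGradX_le (x : Vec d₁) (y : Vec d₂) :
    ‖gradient (Phi P F) x - objGradX P F x y‖ ≤ ℓ / μ * ‖objGradY P F x y‖ := by
  rw [A.gradient_Phi]
  have h1 := A.oracleX.norm_sub_le_right A.ell_pos.le x (argmax P F x) y
  have h2 := A.norm_sub_argmax_le x y
  rw [norm_sub_rev] at h2
  rw [div_mul_eq_mul_div, le_div_iff₀ A.mu_pos]
  nlinarith [A.ell_pos, A.mu_pos]

/-- Gradient ascent on `f(x, ·)` with inexact directions `u t`: the true gradients and the
directions used are summable up to the error of the directions. -/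
theorem sum_ascent_le (x : Vec d₁) {lam : ℝ} (hlam : 0 < lam) (y u : ℕ → Vec d₂)
    (hy : ∀ t, y (t + 1) = y t + lam • u t) (n : ℕ) :
    ∑ t ∈ Finset.range n, (‖objGradY P F x (y t)‖ ^ 2 + (1 - lam * ℓ) * ‖u t‖ ^ 2)
      ≤ ‖objGradY P F x (y 0)‖ ^ 2 / (lam * μ)
        + ∑ t ∈ Finset.range n, ‖u t - objGradY P F x (y t)‖ ^ 2 := by
  have hstep : ∀ t, lam / 2 * (‖objGradY P F x (y t)‖ ^ 2 + (1 - lam * ℓ) * ‖u t‖ ^ 2)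
      ≤ (obj P F x (y (t + 1)) - obj P F x (y t))
        + lam / 2 * ‖u t - objGradY P F x (y t)‖ ^ 2 := by
    intro t
    have h1 := (abs_le.1 (A.abs_obj_sub_right_le x (y t) (y (t + 1)))).1
    rw [hy t, add_sub_cancel_left, inner_smul_right, norm_smul, Real.norm_of_nonneg hlam.le,
      ← hy t] at h1
    have h2 := norm_sub_sq_real (u t) (objGradY P F x (y t))
    rw [real_inner_comm] at h2
    rw [h2]
    nlinarith
  have hsum := Finset.sum_le_sum fun t (_ : t ∈ Finset.range n) => hstep t
  rw [Finset.sum_add_distrib, Finset.sum_range_sub (fun t => obj P F x (y t)), ← Finset.mul_sum,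
    ← Finset.mul_sum] at hsum
  have h3 := A.Phi_sub_obj_le x (y 0)
  have h4 := A.obj_le_Phi x (y n)
  have hμ := A.mu_pos
  have h5 : ‖objGradY P F x (y 0)‖ ^ 2 / (lam * μ)
      = 2 / lam * (‖objGradY P F x (y 0)‖ ^ 2 / (2 * μ)) := by field_simp
  have h6 : obj P F x (y n) - obj P F x (y 0) ≤ ‖objGradY P F x (y 0)‖ ^ 2 / (2 * μ) := by
    linarith
  have h7 : (lam / 2) * (∑ t ∈ Finset.range n, (‖objGradY P F x (y t)‖ ^ 2
      + (1 - lam * ℓ) * ‖u t‖ ^ 2)) ≤ (lam / 2) * (‖objGradY P F x (y 0)‖ ^ 2 / (lam * μ)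
        + ∑ t ∈ Finset.range n, ‖u t - objGradY P F x (y t)‖ ^ 2) := by
    rw [mul_add, h5, ← mul_assoc, show lam / 2 * (2 / lam) = 1 by field_simp]
    linarith
  exact le_of_mul_le_mul_left h7 (by positivity)

end Assumptions

/-! ### Independent draws -/

section Resampling

/-- Redrawing one coordinate of a product measure independently leaves the measure invariant. -/
theorem map_update_infinitePi {ι : Type*} [DecidableEq ι] {X : ι → Type*}
    [∀ i, MeasurableSpace (X i)] (ν : ∀ i, Measure (X i)) [∀ i, IsProbabilityMeasure (ν i)]
    (i : ι) : Measure.map (fun p : (∀ j, X j) × X i => Function.update p.1 i p.2)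
      ((Measure.infinitePi ν).prod (ν i)) = Measure.infinitePi ν := by
  have hmeas : Measurable (fun p : (∀ j, X j) × X i => Function.update p.1 i p.2) :=
    measurable_update'
  refine Measure.eq_infinitePi ν fun s t ht => ?_
  rw [Measure.map_apply hmeas (MeasurableSet.pi s.countable_toSet fun j _ => ht j)]
  by_cases hi : i ∈ s
  · have : (fun p : (∀ j, X j) × X i => Function.update p.1 i p.2) ⁻¹' (s : Set ι).pi t
        = ((s.erase i : Finset ι) : Set ι).pi t ×ˢ t i := by
      ext p
      simp only [Set.mem_preimage, Set.mem_pi, Finset.mem_coe, Set.mem_prod, Finset.mem_erase]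
      constructor
      · intro h
        refine ⟨fun j hj => ?_, by simpa using h i hi⟩
        simpa [Function.update_of_ne hj.1] using h j hj.2
      · rintro ⟨h1, h2⟩ j hj
        by_cases hji : j = i
        · subst hji; simpa using h2
        · simpa [Function.update_of_ne hji] using h1 j ⟨hji, hj⟩
    rw [this, Measure.prod_prod, Measure.infinitePi_pi _ (fun j _ => ht j), mul_comm,
      Finset.mul_prod_erase s (fun j => ν j (t j)) hi]
  · have : (fun p : (∀ j, X j) × X i => Function.update p.1 i p.2) ⁻¹' (s : Set ι).pi t
        = (s : Set ι).pi t ×ˢ Set.univ := by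
      ext p
      simp only [Set.mem_preimage, Set.mem_pi, Finset.mem_coe, Set.mem_prod, Set.mem_univ,
        and_true]
      refine forall₂_congr fun j hj => ?_
      rw [Function.update_of_ne (show j ≠ i from fun h => hi (by rw [← h]; exact hj))]
    rw [this, Measure.prod_prod, Measure.infinitePi_pi _ (fun j _ => ht j)]
    simp

theorem lintegral_infinitePi_update {ι : Type*} [DecidableEq ι] {X : ι → Type*}
    [∀ i, MeasurableSpace (X i)] (ν : ∀ i, Measure (X i)) [∀ i, IsProbabilityMeasure (ν i)]
    (i : ι) {h : (∀ j, X j) → ENNReal} (hh : Measurable h) :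
    ∫⁻ x, h x ∂(Measure.infinitePi ν)
      = ∫⁻ x, ∫⁻ z, h (Function.update x i z) ∂(ν i) ∂(Measure.infinitePi ν) := by
  have hmeas : Measurable (fun p : (∀ j, X j) × X i => Function.update p.1 i p.2) :=
    measurable_update'
  conv_lhs => rw [← map_update_infinitePi ν i, lintegral_map hh hmeas]
  exact lintegral_prod _ (hh.comp hmeas).aemeasurable

theorem lintegral_uniformOn_finset (s : Finset ℕ) (h : ℕ → ENNReal) :
    ∫⁻ x, h x ∂(uniformOn (s : Set ℕ)) = (s.card : ENNReal)⁻¹ * ∑ x ∈ s, h x := by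
  rw [uniformOn, ProbabilityTheory.cond, lintegral_smul_measure, lintegral_finset]
  simp

end Resampling

/-- All the random draws of a run. -/
abbrev Tape (Ξ : Type*) := (SampleId → Ξ) × (ChoiceId → ℕ)

/-- The largest value of a random index. -/
def choiceBound (m' m : ℕ) : ChoiceId → ℕ
  | .init _ => m'
  | .inner _ => m

/-- The law of the draws of a run. -/
def tapeMeasure {Ξ : Type*} [MeasurableSpace Ξ] (P : Measure Ξ) (m' m : ℕ) : Measure (Tape Ξ) :=
  (Measure.infinitePi fun _ : SampleId => P).prod
    (Measure.infinitePi fun j => uniformOn (Set.Iic (choiceBound m' m j)))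

open Classical in
/-- Replace the sample with label `l`. -/
def setSample {Ξ : Type*} (τ : Tape Ξ) (l : SampleId) (z : Ξ) : Tape Ξ :=
  (Function.update τ.1 l z, τ.2)

open Classical in
/-- Replace the random index with label `j`. -/
def setChoice {Ξ : Type*} (τ : Tape Ξ) (j : ChoiceId) (s : ℕ) : Tape Ξ :=
  (τ.1, Function.update τ.2 j s)

/-- The quantity `X` does not depend on the sample with label `l`; under `tapeMeasure` it is then
independent of it. -/
def FreeOfSample {Ξ α : Type*} (l : SampleId) (X : Tape Ξ → α) : Prop :=
  ∀ τ z, X (setSample τ l z) = X τ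

/-- The quantity `X` does not depend on the random index with label `j`. -/
def FreeOfChoice {Ξ α : Type*} (j : ChoiceId) (X : Tape Ξ → α) : Prop :=
  ∀ τ s, X (setChoice τ j s) = X τ

section Tape

variable {Ξ : Type*} [MeasurableSpace Ξ] {P : Measure Ξ} [IsProbabilityMeasure P] {m' m : ℕ}

instance isProbabilityMeasure_uniformOn_Iic (n : ℕ) :
    IsProbabilityMeasure (uniformOn (Set.Iic n)) :=
  isProbabilityMeasure_uniformOn (Set.finite_Iic n) ⟨n, Set.mem_Iic.2 le_rfl⟩

instance isProbabilityMeasure_tapeMeasure : IsProbabilityMeasure (tapeMeasure P m' m) := by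
  unfold tapeMeasure; infer_instance

omit [MeasurableSpace Ξ] in
theorem setSample_apply_of_ne (τ : Tape Ξ) (z : Ξ) {l l' : SampleId} (h : l' ≠ l) :
    (setSample τ l z).1 l' = τ.1 l' := by
  classical
  simp [setSample, Function.update_of_ne h]

omit [MeasurableSpace Ξ] in
theorem setChoice_apply_of_ne (τ : Tape Ξ) (s : ℕ) {j j' : ChoiceId} (h : j' ≠ j) :
    (setChoice τ j s).2 j' = τ.2 j' := by
  classical
  simp [setChoice, Function.update_of_ne h]

omit [IsProbabilityMeasure P] in
/-- The joint law of the draws of a run is `tapeMeasure`. -/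
theorem IsTape.map_eq {Ω : Type*} [MeasurableSpace Ω] {Q : Measure Ω} [IsProbabilityMeasure Q]
    {ξ : SampleId → Ω → Ξ} {c : ChoiceId → Ω → ℕ} (h : IsTape Q P m' m ξ c) :
    Measure.map (fun ω => ((fun i => ξ i ω), (fun j => c j ω))) Q = tapeMeasure P m' m := by
  have hξ : Measurable (fun ω i => ξ i ω) := measurable_pi_lambda _ h.measurable_sample
  have hc : Measurable (fun ω j => c j ω) := measurable_pi_lambda _ h.measurable_choice
  rw [(indepFun_iff_map_prod_eq_prod_map_map hξ.aemeasurable hc.aemeasurable).1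
    h.indep_sample_choice, tapeMeasure]
  congr 1
  · rw [(iIndepFun_iff_map_fun_eq_infinitePi_map h.measurable_sample).1 h.indep_sample]
    congr 1; funext i; exact h.law_sample i
  · rw [(iIndepFun_iff_map_fun_eq_infinitePi_map h.measurable_choice).1 h.indep_choice]
    congr 1; funext j
    cases j with
    | init s => exact h.law_init s
    | inner k => exact h.law_inner k

theorem lintegral_tape_setSample (l : SampleId) {h : Tape Ξ → ENNReal} (hh : Measurable h) :
    ∫⁻ τ, h τ ∂(tapeMeasure P m' m)
      = ∫⁻ τ, ∫⁻ z, h (setSample τ l z) ∂P ∂(tapeMeasure P m' m) := by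
  classical
  have hmeas : Measurable (fun p : (Tape Ξ) × Ξ => setSample p.1 l p.2) := by
    refine Measurable.prodMk (measurable_pi_lambda _ fun j => ?_) (by fun_prop)
    by_cases hj : j = l
    · subst hj; simpa using measurable_snd
    · simp only [Function.update_of_ne hj]
      fun_prop
  rw [tapeMeasure, lintegral_prod_symm _ hh.aemeasurable, lintegral_prod_symm]
  · refine lintegral_congr fun y => ?_
    rw [lintegral_infinitePi_update (fun _ : SampleId => P) l
      (h := fun x => h (x, y)) (hh.comp (by fun_prop))]
    refine lintegral_congr fun x => lintegral_congr fun z => ?_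
    congr!
  · exact (Measurable.lintegral_prod_right' (f := fun p : (Tape Ξ) × Ξ => h (setSample p.1 l p.2))
      (hh.comp hmeas)).aemeasurable

omit [IsProbabilityMeasure P] in
theorem lintegral_tape_setChoice (j : ChoiceId) {h : Tape Ξ → ENNReal} (hh : Measurable h) :
    ∫⁻ τ, h τ ∂(tapeMeasure P m' m)
      = ∫⁻ τ, ∫⁻ s, h (setChoice τ j s) ∂(uniformOn (Set.Iic (choiceBound m' m j)))
        ∂(tapeMeasure P m' m) := by
  classical
  have hmeas : Measurable (fun p : (Tape Ξ) × ℕ => setChoice p.1 j p.2) := by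
    refine Measurable.prodMk (by fun_prop) (measurable_pi_lambda _ fun i => ?_)
    by_cases hj : i = j
    · subst hj; simpa using measurable_snd
    · simp only [Function.update_of_ne hj]
      fun_prop
  rw [tapeMeasure, lintegral_prod _ hh.aemeasurable, lintegral_prod]
  · refine lintegral_congr fun x => ?_
    rw [lintegral_infinitePi_update (fun j => uniformOn (Set.Iic (choiceBound m' m j))) j
      (h := fun y => h (x, y)) (hh.comp (by fun_prop))]
    refine lintegral_congr fun y => lintegral_congr fun z => ?_
    congr!
  · exact (Measurable.lintegral_prod_right' (f := fun p : (Tape Ξ) × ℕ => h (setChoice p.1 j p.2))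
      (hh.comp hmeas)).aemeasurable

/-- Bounding an expectation by conditioning on everything but one sample. -/
theorem integrable_integral_le_of_sample {l : SampleId} {φ : Tape Ξ → Ξ → ℝ}
    (hm : Measurable (fun p : Tape Ξ × Ξ => φ p.1 p.2)) (h0 : ∀ τ z, 0 ≤ φ τ z)
    (hfree : FreeOfSample l φ) {B : Tape Ξ → ℝ} (hB : Integrable B (tapeMeasure P m' m))
    (hφ : ∀ τ, Integrable (φ τ) P ∧ ∫ z, φ τ z ∂P ≤ B τ) :
    Integrable (fun τ => φ τ (τ.1 l)) (tapeMeasure P m' m) ∧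
      ∫ τ, φ τ (τ.1 l) ∂(tapeMeasure P m' m) ≤ ∫ τ, B τ ∂(tapeMeasure P m' m) := by
  have hmm : Measurable (fun τ : Tape Ξ => φ τ (τ.1 l)) :=
    hm.comp (f := fun τ : Tape Ξ => (τ, τ.1 l)) (by fun_prop)
  have hB0 : ∀ τ, 0 ≤ B τ := fun τ => (integral_nonneg (h0 τ)).trans (hφ τ).2
  have key : ∫⁻ τ, ENNReal.ofReal (φ τ (τ.1 l)) ∂(tapeMeasure P m' m)
      ≤ ENNReal.ofReal (∫ τ, B τ ∂(tapeMeasure P m' m)) := by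
    rw [lintegral_tape_setSample l hmm.ennreal_ofReal,
      ofReal_integral_eq_lintegral_ofReal hB (Filter.Eventually.of_forall hB0)]
    refine lintegral_mono fun τ => ?_
    have : ∀ z, φ (setSample τ l z) ((setSample τ l z).1 l) = φ τ z := by
      intro z
      rw [hfree τ z]; simp [setSample]
    simp only [this]
    rw [← ofReal_integral_eq_lintegral_ofReal (hφ τ).1 (Filter.Eventually.of_forall (h0 τ))]
    exact ENNReal.ofReal_le_ofReal (hφ τ).2
  have hint : Integrable (fun τ => φ τ (τ.1 l)) (tapeMeasure P m' m) := by
    refine ⟨hmm.aestronglyMeasurable, ?_⟩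
    rw [hasFiniteIntegral_iff_ofReal (Filter.Eventually.of_forall fun τ => h0 _ _)]
    exact key.trans_lt ENNReal.ofReal_lt_top
  refine ⟨hint, ?_⟩
  rw [← ofReal_integral_eq_lintegral_ofReal hint (Filter.Eventually.of_forall fun τ => h0 _ _)]
    at key
  exact (ENNReal.ofReal_le_ofReal_iff (integral_nonneg hB0)).1 key

omit [IsProbabilityMeasure P] in
/-- A uniform index averages a family that does not depend on it. -/
theorem integrable_integral_eq_of_choice {j : ChoiceId} {φ : ℕ → Tape Ξ → ℝ}
    (hm : ∀ s, Measurable (φ s)) (h0 : ∀ s τ, 0 ≤ φ s τ)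
    (hfree : ∀ s, FreeOfChoice j (φ s))
    (hi : ∀ s ≤ choiceBound m' m j, Integrable (φ s) (tapeMeasure P m' m)) :
    Integrable (fun τ => φ (τ.2 j) τ) (tapeMeasure P m' m) ∧
      ∫ τ, φ (τ.2 j) τ ∂(tapeMeasure P m' m)
        = ((choiceBound m' m j : ℝ) + 1)⁻¹ * ∑ s ∈ Finset.range (choiceBound m' m j + 1),
          ∫ τ, φ s τ ∂(tapeMeasure P m' m) := by
  set n := choiceBound m' m j with hn
  have hmm : Measurable (fun τ : Tape Ξ => φ (τ.2 j) τ) := by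
    have : Measurable (fun p : ℕ × Tape Ξ => φ p.1 p.2) :=
      measurable_from_prod_countable_right hm
    exact this.comp (f := fun τ : Tape Ξ => (τ.2 j, τ)) (by fun_prop)
  have hset : Set.Iic n = ((Finset.range (n + 1) : Finset ℕ) : Set ℕ) := by
    ext x; simp
  have hS0 : 0 ≤ ((n : ℝ) + 1)⁻¹ * ∑ s ∈ Finset.range (n + 1),
      ∫ τ, φ s τ ∂(tapeMeasure P m' m) :=
    mul_nonneg (by positivity) (Finset.sum_nonneg fun s _ => integral_nonneg (h0 s))
  have key : ∫⁻ τ, ENNReal.ofReal (φ (τ.2 j) τ) ∂(tapeMeasure P m' m)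
      = ENNReal.ofReal (((n : ℝ) + 1)⁻¹ * ∑ s ∈ Finset.range (n + 1),
          ∫ τ, φ s τ ∂(tapeMeasure P m' m)) := by
    rw [lintegral_tape_setChoice j hmm.ennreal_ofReal, ← hn, hset]
    have : ∀ τ : Tape Ξ, ∀ s, φ ((setChoice τ j s).2 j) (setChoice τ j s) = φ s τ := by
      intro τ s
      rw [hfree _ τ s]; simp [setChoice]
    simp only [this, lintegral_uniformOn_finset]
    rw [lintegral_const_mul _ (Finset.measurable_sum _ fun s _ => (hm s).ennreal_ofReal),
      lintegral_finsetSum _ (fun s _ => (hm s).ennreal_ofReal),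
      ENNReal.ofReal_mul (by positivity), ENNReal.ofReal_inv_of_pos (by positivity),
      ENNReal.ofReal_sum_of_nonneg (fun s _ => integral_nonneg (h0 s))]
    congr 1
    · rw [Finset.card_range, show ((n : ℝ) + 1) = ((n + 1 : ℕ) : ℝ) by push_cast; ring,
        ENNReal.ofReal_natCast]
    · refine Finset.sum_congr rfl fun s hs => ?_
      rw [ofReal_integral_eq_lintegral_ofReal
        (hi s (Nat.lt_succ_iff.1 (Finset.mem_range.1 hs))) (Filter.Eventually.of_forall (h0 s))]
  have hint : Integrable (fun τ => φ (τ.2 j) τ) (tapeMeasure P m' m) := by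
    refine ⟨hmm.aestronglyMeasurable, ?_⟩
    rw [hasFiniteIntegral_iff_ofReal (Filter.Eventually.of_forall fun τ => h0 _ _), key]
    exact ENNReal.ofReal_lt_top
  refine ⟨hint, ?_⟩
  rw [← ofReal_integral_eq_lintegral_ofReal hint (Filter.Eventually.of_forall fun τ => h0 _ _)]
    at key
  exact (ENNReal.ofReal_eq_ofReal_iff (integral_nonneg fun τ => h0 _ _) hS0).1 key

/-! ### Accumulated sampling errors -/

/-- Adding one centred sample increases the mean square by the variance only. -/
theorem integral_sq_add_sample_le {d : ℕ} {l : SampleId} {R : Tape Ξ → Vec d}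
    {g : Tape Ξ → Ξ → Vec d} (hRm : Measurable R)
    (hR : Integrable (fun τ => ‖R τ‖ ^ 2) (tapeMeasure P m' m)) (hRf : FreeOfSample l R)
    (hgm : Measurable (fun p : Tape Ξ × Ξ => g p.1 p.2)) (hgf : FreeOfSample l g)
    (hg0 : ∀ τ, ∫ z, g τ z ∂P = 0) {B : Tape Ξ → ℝ} (hB : Integrable B (tapeMeasure P m' m))
    (hgB : ∀ τ, Integrable (fun z => ‖g τ z‖ ^ 2) P ∧ ∫ z, ‖g τ z‖ ^ 2 ∂P ≤ B τ) (a : ℝ) :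
    Integrable (fun τ => ‖R τ + a • g τ (τ.1 l)‖ ^ 2) (tapeMeasure P m' m) ∧
      ∫ τ, ‖R τ + a • g τ (τ.1 l)‖ ^ 2 ∂(tapeMeasure P m' m)
        ≤ (∫ τ, ‖R τ‖ ^ 2 ∂(tapeMeasure P m' m))
          + a ^ 2 * ∫ τ, B τ ∂(tapeMeasure P m' m) := by
  have h := integrable_integral_le_of_sample (P := P) (m' := m') (m := m) (l := l)
    (φ := fun τ z => ‖R τ + a • g τ z‖ ^ 2) (B := fun τ => ‖R τ‖ ^ 2 + a ^ 2 * B τ)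
    (((hRm.comp measurable_fst).add (hgm.const_smul a)).norm.pow_const 2)
    (fun τ z => by positivity)
    (fun τ z => by funext z'; simp only; rw [hRf τ z, hgf τ z])
    (hR.add (hB.const_mul _)) (fun τ => ?_)
  · refine ⟨h.1, h.2.trans_eq ?_⟩
    rw [integral_add hR (hB.const_mul _), integral_const_mul]
  · have hgmτ : Measurable (g τ) := hgm.comp (f := fun z : Ξ => (τ, z)) (by fun_prop)
    have hgi : Integrable (g τ) P := integrable_norm_of_sq hgmτ.aestronglyMeasurable (hgB τ).1
    have hexp : (fun z => ‖R τ + a • g τ z‖ ^ 2)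
        = fun z => (‖R τ‖ ^ 2 + (2 * a) * inner ℝ (R τ) (g τ z)) + a ^ 2 * ‖g τ z‖ ^ 2 := by
      funext z
      rw [norm_add_sq_real, inner_smul_right, norm_smul, mul_pow, Real.norm_eq_abs, sq_abs]
      ring
    have hin : Integrable (fun z => inner ℝ (R τ) (g τ z)) P := hgi.const_inner _
    have h1 : Integrable (fun z => ‖R τ‖ ^ 2 + (2 * a) * inner ℝ (R τ) (g τ z)) P :=
      (integrable_const _).add (hin.const_mul _)
    have h2 : Integrable (fun z => a ^ 2 * ‖g τ z‖ ^ 2) P := (hgB τ).1.const_mul _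
    rw [hexp]
    refine ⟨h1.add h2, ?_⟩
    rw [integral_add h1 h2, integral_add (integrable_const _) (hin.const_mul _),
      integral_const_mul, integral_const_mul, integral_inner hgi, hg0]
    simp only [integral_const, probReal_univ, smul_eq_mul, one_mul, inner_zero_right, mul_zero,
      add_zero]
    have := mul_le_mul_of_nonneg_left (hgB τ).2 (sq_nonneg a)
    linarith

/-- Adding the mean of a batch of centred samples: the variance is divided by the batch size. -/
theorem integral_sq_add_batchMean_le {d : ℕ} {n : ℕ} (hn : 0 < n) {lab : ℕ → SampleId}
    (hlab : Function.Injective lab) {R : Tape Ξ → Vec d}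
    {g : Tape Ξ → Ξ → Vec d} (hRm : Measurable R)
    (hR : Integrable (fun τ => ‖R τ‖ ^ 2) (tapeMeasure P m' m))
    (hRf : ∀ i, FreeOfSample (lab i) R)
    (hgm : Measurable (fun p : Tape Ξ × Ξ => g p.1 p.2)) (hgf : ∀ i, FreeOfSample (lab i) g)
    (hg0 : ∀ τ, ∫ z, g τ z ∂P = 0) {B : Tape Ξ → ℝ} (hB : Integrable B (tapeMeasure P m' m))
    (hgB : ∀ τ, Integrable (fun z => ‖g τ z‖ ^ 2) P ∧ ∫ z, ‖g τ z‖ ^ 2 ∂P ≤ B τ) :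
    Integrable (fun τ => ‖R τ + batchMean n (fun i => g τ (τ.1 (lab i)))‖ ^ 2)
        (tapeMeasure P m' m) ∧
      ∫ τ, ‖R τ + batchMean n (fun i => g τ (τ.1 (lab i)))‖ ^ 2 ∂(tapeMeasure P m' m)
        ≤ (∫ τ, ‖R τ‖ ^ 2 ∂(tapeMeasure P m' m))
          + (∫ τ, B τ ∂(tapeMeasure P m' m)) / n := by
  have key : ∀ k : ℕ,
      Integrable (fun τ => ‖R τ + (n : ℝ)⁻¹ • ∑ i ∈ Finset.range k, g τ (τ.1 (lab i))‖ ^ 2)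
        (tapeMeasure P m' m) ∧
      ∫ τ, ‖R τ + (n : ℝ)⁻¹ • ∑ i ∈ Finset.range k, g τ (τ.1 (lab i))‖ ^ 2
          ∂(tapeMeasure P m' m)
        ≤ (∫ τ, ‖R τ‖ ^ 2 ∂(tapeMeasure P m' m))
          + k * (((n : ℝ)⁻¹) ^ 2 * ∫ τ, B τ ∂(tapeMeasure P m' m)) := by
    intro k
    induction k with
    | zero => simpa using hR
    | succ k ih =>
      have hm : Measurable (fun τ : Tape Ξ =>
          R τ + (n : ℝ)⁻¹ • ∑ i ∈ Finset.range k, g τ (τ.1 (lab i))) := by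
        refine hRm.add (Measurable.fun_const_smul (Finset.measurable_sum _ fun i _ => ?_) _)
        exact hgm.comp (f := fun τ : Tape Ξ => (τ, τ.1 (lab i))) (by fun_prop)
      have hf : FreeOfSample (lab k) (fun τ : Tape Ξ =>
          R τ + (n : ℝ)⁻¹ • ∑ i ∈ Finset.range k, g τ (τ.1 (lab i))) := by
        intro τ z
        simp only
        rw [hRf k τ z, hgf k τ z]
        congr 2
        refine Finset.sum_congr rfl fun i hi => ?_
        have : lab i ≠ lab k := fun h => (Finset.mem_range.1 hi).ne (hlab h)
        rw [setSample_apply_of_ne _ _ this]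
      have h := integral_sq_add_sample_le hm ih.1 hf hgm (hgf k) hg0 hB hgB (n : ℝ)⁻¹
      have heq : (fun τ : Tape Ξ =>
            ‖R τ + (n : ℝ)⁻¹ • ∑ i ∈ Finset.range (k + 1), g τ (τ.1 (lab i))‖ ^ 2)
          = fun τ => ‖R τ + (n : ℝ)⁻¹ • ∑ i ∈ Finset.range k, g τ (τ.1 (lab i))
            + (n : ℝ)⁻¹ • g τ (τ.1 (lab k))‖ ^ 2 := by
        funext τ
        rw [Finset.sum_range_succ, smul_add, add_assoc]
      rw [heq]
      refine ⟨h.1, h.2.trans ?_⟩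
      push_cast
      linarith [ih.2]
  have hk := key n
  refine ⟨hk.1, hk.2.trans_eq ?_⟩
  have : (n : ℝ) ≠ 0 := by positivity
  field_simp

end Tape

/-! ### Mean-square errors of recursive gradient estimators -/

section Estimators

theorem batchMean_sub {d n : ℕ} (f g : ℕ → Vec d) :
    batchMean n (fun i => f i - g i) = batchMean n f - batchMean n g := by
  simp [batchMean, smul_sub]

theorem batchMean_const {d n : ℕ} (hn : 0 < n) (a : Vec d) : batchMean n (fun _ => a) = a := by
  have : (n : ℝ) ≠ 0 := by positivity
  simp [batchMean, ← Nat.cast_smul_eq_nsmul ℝ, smul_smul, this]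

theorem batchMean_one {d : ℕ} (f : ℕ → Vec d) : batchMean 1 f = f 0 := by
  simp [batchMean]

theorem batchMean_neg {d n : ℕ} (f : ℕ → Vec d) :
    batchMean n (fun i => - f i) = - batchMean n f := by
  simp [batchMean]

theorem integrable_sq_add {α E : Type*} [MeasurableSpace α] {M : Measure α}
    [NormedAddCommGroup E] {X Y : α → E}
    (hXm : AEStronglyMeasurable X M) (hYm : AEStronglyMeasurable Y M)
    (hX : Integrable (fun τ => ‖X τ‖ ^ 2) M) (hY : Integrable (fun τ => ‖Y τ‖ ^ 2) M) :
    Integrable (fun τ => ‖X τ + Y τ‖ ^ 2) M :=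
  (memLp_two_iff_integrable_sq_norm (hXm.add hYm)).1
    (((memLp_two_iff_integrable_sq_norm hXm).2 hX).add
      ((memLp_two_iff_integrable_sq_norm hYm).2 hY))

/-- The variance is at most the second moment. -/
theorem integral_sq_sub_mean_le {Ξ : Type*} [MeasurableSpace Ξ] {P : Measure Ξ}
    [IsProbabilityMeasure P] {d : ℕ} {X : Ξ → Vec d} (hXi : Integrable X P)
    (hX : Integrable (fun z => ‖X z‖ ^ 2) P) :
    Integrable (fun z => ‖X z - ∫ z, X z ∂P‖ ^ 2) P ∧
      ∫ z, ‖X z - ∫ z, X z ∂P‖ ^ 2 ∂P ≤ ∫ z, ‖X z‖ ^ 2 ∂P := by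
  set a := ∫ z, X z ∂P with ha
  have hexp : (fun z => ‖X z - a‖ ^ 2)
      = fun z => (‖X z‖ ^ 2 - 2 * inner ℝ a (X z)) + ‖a‖ ^ 2 := by
    funext z
    rw [norm_sub_sq_real, real_inner_comm]
  have h1 : Integrable (fun z => 2 * inner ℝ a (X z)) P := (hXi.const_inner _).const_mul _
  have h2 : Integrable (fun z => ‖X z‖ ^ 2 - 2 * inner ℝ a (X z)) P := hX.sub h1
  rw [hexp]
  refine ⟨h2.add (integrable_const _), ?_⟩
  rw [integral_add h2 (integrable_const _), integral_sub hX h1, integral_const_mul,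
    integral_inner hXi, ← ha, real_inner_self_eq_norm_sq]
  simp only [integral_const, probReal_univ, smul_eq_mul, one_mul]
  nlinarith [sq_nonneg ‖a‖]

namespace IsOracle

variable {d₁ d₂ d : ℕ} {Ξ : Type*} [MeasurableSpace Ξ] {P : Measure Ξ} [IsProbabilityMeasure P]
  {m' m : ℕ} {G : Vec d₁ → Vec d₂ → Ξ → Vec d} {g : Vec d₁ → Vec d₂ → Vec d} {ℓ σ : ℝ}
  (O : IsOracle P G g ℓ σ)

include O

omit [IsProbabilityMeasure P] in
theorem measurable_comp {x : Tape Ξ → Vec d₁} {y : Tape Ξ → Vec d₂} (hx : Measurable x)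
    (hy : Measurable y) : Measurable (fun p : Tape Ξ × Ξ => G (x p.1) (y p.1) p.2) :=
  O.measurable.comp (f := fun p : Tape Ξ × Ξ => ((x p.1, y p.1), p.2)) (by fun_prop)

omit [IsProbabilityMeasure P] in
theorem measurable_batchMean {x : Tape Ξ → Vec d₁} {y : Tape Ξ → Vec d₂} (hx : Measurable x)
    (hy : Measurable y) (n : ℕ) (lab : ℕ → SampleId) :
    Measurable (fun τ => batchMean n (fun i => G (x τ) (y τ) (τ.1 (lab i)))) := by
  unfold batchMean
  refine Measurable.fun_const_smul (Finset.measurable_sum _ fun i _ => ?_) _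
  exact (O.measurable_comp hx hy).comp (f := fun τ : Tape Ξ => (τ, τ.1 (lab i))) (by fun_prop)

theorem measurable_field (hℓ : 0 ≤ ℓ) {α : Type*} [MeasurableSpace α] {x : α → Vec d₁}
    {y : α → Vec d₂} (hx : Measurable x) (hy : Measurable y) :
    Measurable (fun τ => g (x τ) (y τ)) :=
  (O.continuous_field hℓ).measurable.comp (f := fun τ => (x τ, y τ)) (by fun_prop)

/-- Mean-square error of a large batch. -/
theorem integral_sq_batchMean_sub_le (hℓ : 0 ≤ ℓ) {n : ℕ} (hn : 0 < n) {lab : ℕ → SampleId}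
    (hlab : Function.Injective lab) {x : Tape Ξ → Vec d₁} {y : Tape Ξ → Vec d₂}
    (hx : Measurable x) (hy : Measurable y) (hxf : ∀ i, FreeOfSample (lab i) x)
    (hyf : ∀ i, FreeOfSample (lab i) y) :
    Integrable (fun τ => ‖batchMean n (fun i => G (x τ) (y τ) (τ.1 (lab i))) - g (x τ) (y τ)‖ ^ 2)
        (tapeMeasure P m' m) ∧
      ∫ τ, ‖batchMean n (fun i => G (x τ) (y τ) (τ.1 (lab i))) - g (x τ) (y τ)‖ ^ 2
        ∂(tapeMeasure P m' m) ≤ σ ^ 2 / n := by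
  have h := integral_sq_add_batchMean_le (P := P) (m' := m') (m := m) hn hlab
    (R := fun _ => (0 : Vec d)) (g := fun τ z => G (x τ) (y τ) z - g (x τ) (y τ))
    (B := fun _ => σ ^ 2)
    measurable_const (by simp) (fun i τ z => rfl)
    ((O.measurable_comp hx hy).sub
      (O.measurable_field hℓ (hx.comp measurable_fst) (hy.comp measurable_fst)))
    (fun i τ z => by simp only; rw [hxf i τ z, hyf i τ z])
    (fun τ => by rw [integral_sub (O.integrable _ _) (integrable_const _), O.mean]; simp)
    (integrable_const _) (fun τ => O.variance _ _)
  have heq : ∀ τ : Tape Ξ, (0 : Vec d) + batchMean n (fun i => G (x τ) (y τ) (τ.1 (lab i))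
      - g (x τ) (y τ)) = batchMean n (fun i => G (x τ) (y τ) (τ.1 (lab i))) - g (x τ) (y τ) := by
    intro τ
    rw [batchMean_sub, batchMean_const hn, zero_add]
  simp only [heq] at h
  simpa using h

/-- Mean-square error of an estimator that is updated by the difference of the stochastic gradients
at the new and the old point. -/
theorem integral_sq_update_sub_le (hℓ : 0 ≤ ℓ) {n : ℕ} (hn : 0 < n) {lab : ℕ → SampleId}
    (hlab : Function.Injective lab) {x x' : Tape Ξ → Vec d₁} {y y' : Tape Ξ → Vec d₂}
    {v : Tape Ξ → Vec d} (hx : Measurable x) (hy : Measurable y) (hx' : Measurable x')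
    (hy' : Measurable y') (hv : Measurable v) (hxf : ∀ i, FreeOfSample (lab i) x)
    (hyf : ∀ i, FreeOfSample (lab i) y) (hxf' : ∀ i, FreeOfSample (lab i) x')
    (hyf' : ∀ i, FreeOfSample (lab i) y') (hvf : ∀ i, FreeOfSample (lab i) v)
    (he : Integrable (fun τ => ‖v τ - g (x τ) (y τ)‖ ^ 2) (tapeMeasure P m' m))
    {B : Tape Ξ → ℝ} (hB : Integrable B (tapeMeasure P m' m))
    (hd : ∀ τ, ‖x' τ - x τ‖ ^ 2 + ‖y' τ - y τ‖ ^ 2 ≤ B τ) :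
    Integrable (fun τ => ‖v τ + batchMean n (fun i => G (x' τ) (y' τ) (τ.1 (lab i)))
          - batchMean n (fun i => G (x τ) (y τ) (τ.1 (lab i))) - g (x' τ) (y' τ)‖ ^ 2)
        (tapeMeasure P m' m) ∧
      ∫ τ, ‖v τ + batchMean n (fun i => G (x' τ) (y' τ) (τ.1 (lab i)))
          - batchMean n (fun i => G (x τ) (y τ) (τ.1 (lab i))) - g (x' τ) (y' τ)‖ ^ 2
        ∂(tapeMeasure P m' m) ≤ (∫ τ, ‖v τ - g (x τ) (y τ)‖ ^ 2 ∂(tapeMeasure P m' m))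
          + ℓ ^ 2 * (∫ τ, B τ ∂(tapeMeasure P m' m)) / n := by
  have hgx := fun {x : Tape Ξ → Vec d₁} {y : Tape Ξ → Vec d₂} (hx : Measurable x)
    (hy : Measurable y) => O.measurable_field hℓ hx hy
  have h := integral_sq_add_batchMean_le (P := P) (m' := m') (m := m) hn hlab
    (R := fun τ => v τ - g (x τ) (y τ))
    (g := fun τ z => (G (x' τ) (y' τ) z - G (x τ) (y τ) z) - (g (x' τ) (y' τ) - g (x τ) (y τ)))
    (B := fun τ => ℓ ^ 2 * B τ)
    (hv.sub (hgx hx hy)) he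
    (fun i τ z => by simp only; rw [hxf i τ z, hyf i τ z, hvf i τ z])
    (((O.measurable_comp hx' hy').sub (O.measurable_comp hx hy)).sub
      ((O.measurable_field hℓ (hx'.comp measurable_fst) (hy'.comp measurable_fst)).sub
        (O.measurable_field hℓ (hx.comp measurable_fst) (hy.comp measurable_fst))))
    (fun i τ z => by simp only; rw [hxf i τ z, hyf i τ z, hxf' i τ z, hyf' i τ z])
    (fun τ => by
      have hi : Integrable (fun z => G (x' τ) (y' τ) z - G (x τ) (y τ) z) P :=
        (O.integrable _ _).sub (O.integrable _ _)
      rw [integral_sub hi (integrable_const _),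
        integral_sub (O.integrable _ _) (O.integrable _ _), O.mean, O.mean]
      simp)
    (hB.const_mul _) (fun τ => ?_)
  · have heq : ∀ τ : Tape Ξ, v τ - g (x τ) (y τ) + batchMean n (fun i =>
        (G (x' τ) (y' τ) (τ.1 (lab i)) - G (x τ) (y τ) (τ.1 (lab i)))
          - (g (x' τ) (y' τ) - g (x τ) (y τ)))
        = v τ + batchMean n (fun i => G (x' τ) (y' τ) (τ.1 (lab i)))
          - batchMean n (fun i => G (x τ) (y τ) (τ.1 (lab i))) - g (x' τ) (y' τ) := by
      intro τ
      rw [batchMean_sub, batchMean_const hn, batchMean_sub]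
      abel
    simp only [heq] at h
    rwa [integral_const_mul] at h
  · have hl := O.lipschitz (x' τ) (y' τ) (x τ) (y τ)
    have hs := integral_sq_sub_mean_le (P := P)
      (X := fun z => G (x' τ) (y' τ) z - G (x τ) (y τ) z)
      ((O.integrable _ _).sub (O.integrable _ _)) hl.1
    rw [integral_sub (O.integrable _ _) (O.integrable _ _), O.mean, O.mean] at hs
    exact ⟨hs.1, hs.2.trans (hl.2.trans
      (mul_le_mul_of_nonneg_left (hd τ) (sq_nonneg _)))⟩

end IsOracle

/-- A stochastic recursive gradient ascent loop for `f(x, ·)` with a random point `x`: `y t` are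
the iterates, `u t` the gradient estimates, and step `t + 1` uses the samples `lab t i`, `i < n`,
which are independent of what comes before. -/
structure AscentLoop {d₁ d₂ : ℕ} {Ξ : Type*} [MeasurableSpace Ξ]
    (F : Vec d₁ → Vec d₂ → Ξ → ℝ) (lam : ℝ) (n : ℕ) (lab : ℕ → ℕ → SampleId)
    (x : Tape Ξ → Vec d₁) (y u : ℕ → Tape Ξ → Vec d₂) : Prop where
  step : ∀ t τ, y (t + 1) τ = y t τ + lam • u t τ
  update : ∀ t τ, u (t + 1) τ = u t τ
    + batchMean n (fun i => gradY F (x τ) (y (t + 1) τ) (τ.1 (lab t i)))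
    - batchMean n (fun i => gradY F (x τ) (y t τ) (τ.1 (lab t i)))
  injective : ∀ t, Function.Injective (lab t)
  measurable_x : Measurable x
  measurable_y_zero : Measurable (y 0)
  measurable_u_zero : Measurable (u 0)
  free_x : ∀ t i, FreeOfSample (lab t i) x
  free_y : ∀ t i, FreeOfSample (lab t i) (y t)
  free_u : ∀ t i, FreeOfSample (lab t i) (u t)

namespace AscentLoop

variable {d₁ d₂ : ℕ} {Ξ : Type*} [MeasurableSpace Ξ] {P : Measure Ξ} [IsProbabilityMeasure P]
  {m' m : ℕ} {F : Vec d₁ → Vec d₂ → Ξ → ℝ} {ℓ μ σ lam : ℝ} {n : ℕ} {lab : ℕ → ℕ → SampleId}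
  {x : Tape Ξ → Vec d₁} {y u : ℕ → Tape Ξ → Vec d₂}

theorem free_y_succ (L : AscentLoop F lam n lab x y u) (t i : ℕ) :
    FreeOfSample (lab t i) (y (t + 1)) := by
  intro τ z
  rw [L.step, L.step, L.free_y t i τ z, L.free_u t i τ z]

theorem measurable (L : AscentLoop F lam n lab x y u) (A : Assumptions P F ℓ μ σ) (t : ℕ) :
    Measurable (y t) ∧ Measurable (u t) := by
  induction t with
  | zero => exact ⟨L.measurable_y_zero, L.measurable_u_zero⟩
  | succ t ih =>
    have hy : Measurable (y (t + 1)) := by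
      rw [show y (t + 1) = fun τ => y t τ + lam • u t τ from funext (L.step t)]
      exact ih.1.add (ih.2.const_smul lam)
    refine ⟨hy, ?_⟩
    rw [show u (t + 1) = _ from funext (L.update t)]
    exact (ih.2.add (A.oracleY.measurable_batchMean L.measurable_x hy n _)).sub
      (A.oracleY.measurable_batchMean L.measurable_x ih.1 n _)

/-- Errors accumulate in the mean square at the rate of the squared step lengths. This is stated for
an arbitrary estimator `v` updated along with the loop, such as the estimate of `∇ₓ f`. -/
theorem integral_sq_estimator_le (L : AscentLoop F lam n lab x y u) (A : Assumptions P F ℓ μ σ)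
    (hn : 0 < n) {d : ℕ} {G : Vec d₁ → Vec d₂ → Ξ → Vec d} {g : Vec d₁ → Vec d₂ → Vec d}
    (O : IsOracle P G g ℓ σ) {v v' : Tape Ξ → Vec d} (t : ℕ)
    (hv' : ∀ τ, v' τ = v τ + batchMean n (fun i => G (x τ) (y (t + 1) τ) (τ.1 (lab t i)))
      - batchMean n (fun i => G (x τ) (y t τ) (τ.1 (lab t i))))
    (hv : Measurable v) (hvf : ∀ i, FreeOfSample (lab t i) v)
    (he : Integrable (fun τ => ‖v τ - g (x τ) (y t τ)‖ ^ 2) (tapeMeasure P m' m))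
    (hu : Integrable (fun τ => ‖u t τ‖ ^ 2) (tapeMeasure P m' m)) :
    Integrable (fun τ => ‖v' τ - g (x τ) (y (t + 1) τ)‖ ^ 2) (tapeMeasure P m' m) ∧
      ∫ τ, ‖v' τ - g (x τ) (y (t + 1) τ)‖ ^ 2 ∂(tapeMeasure P m' m)
        ≤ (∫ τ, ‖v τ - g (x τ) (y t τ)‖ ^ 2 ∂(tapeMeasure P m' m))
          + ℓ ^ 2 * lam ^ 2 / n * ∫ τ, ‖u t τ‖ ^ 2 ∂(tapeMeasure P m' m) := by
  have h := O.integral_sq_update_sub_le (m' := m') (m := m) A.ell_pos.le hn (L.injective t)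
    (x := x) (x' := x) (y := y t)
    (y' := y (t + 1)) (v := v) (B := fun τ => lam ^ 2 * ‖u t τ‖ ^ 2)
    L.measurable_x (L.measurable A t).1 L.measurable_x (L.measurable A (t + 1)).1 hv
    (L.free_x t) (L.free_y t) (L.free_x t) (L.free_y_succ t) hvf he (hu.const_mul _)
    (fun τ => by
      rw [L.step, add_sub_cancel_left, sub_self, norm_zero, norm_smul, mul_pow,
        Real.norm_eq_abs, sq_abs]
      simp)
  simp only [← hv'] at h
  refine ⟨h.1, h.2.trans_eq ?_⟩
  rw [integral_const_mul]; ring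

theorem integrable (L : AscentLoop F lam n lab x y u) (A : Assumptions P F ℓ μ σ)
    (hlam : 0 ≤ lam) (hn : 0 < n)
    (h0 : Integrable (fun τ => ‖objGradY P F (x τ) (y 0 τ)‖ ^ 2) (tapeMeasure P m' m))
    (he0 : Integrable (fun τ => ‖u 0 τ - objGradY P F (x τ) (y 0 τ)‖ ^ 2) (tapeMeasure P m' m))
    (t : ℕ) :
    Integrable (fun τ => ‖objGradY P F (x τ) (y t τ)‖ ^ 2) (tapeMeasure P m' m) ∧
    Integrable (fun τ => ‖u t τ - objGradY P F (x τ) (y t τ)‖ ^ 2) (tapeMeasure P m' m) ∧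
    Integrable (fun τ => ‖u t τ‖ ^ 2) (tapeMeasure P m' m) := by
  have hgm : ∀ t, Measurable (fun τ => objGradY P F (x τ) (y t τ)) := fun t =>
    A.oracleY.measurable_field A.ell_pos.le L.measurable_x (L.measurable A t).1
  have hu : ∀ t, Integrable (fun τ => ‖objGradY P F (x τ) (y t τ)‖ ^ 2) (tapeMeasure P m' m) →
      Integrable (fun τ => ‖u t τ - objGradY P F (x τ) (y t τ)‖ ^ 2) (tapeMeasure P m' m) →
      Integrable (fun τ => ‖u t τ‖ ^ 2) (tapeMeasure P m' m) := by
    intro t h1 h2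
    have := integrable_sq_add
      (((L.measurable A t).2.sub (hgm t)).aestronglyMeasurable (μ := tapeMeasure P m' m))
      (hgm t).aestronglyMeasurable h2 h1
    simpa using this
  induction t with
  | zero => exact ⟨h0, he0, hu 0 h0 he0⟩
  | succ t ih =>
    have h2 := (L.integral_sq_estimator_le (m' := m') (m := m) A hn A.oracleY t (L.update t)
      (L.measurable A t).2
      (L.free_u t) ih.2.1 ih.2.2).1
    have h1 : Integrable (fun τ => ‖objGradY P F (x τ) (y (t + 1) τ)‖ ^ 2)
        (tapeMeasure P m' m) := by
      refine ((ih.1.const_mul 2).add (ih.2.2.const_mul (2 * (ℓ * lam) ^ 2))).mono'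
        ((hgm (t + 1)).norm.pow_const 2).aestronglyMeasurable
        (Filter.Eventually.of_forall fun τ => ?_)
      rw [Real.norm_of_nonneg (by positivity)]
      have e1 := A.oracleY.norm_sub_le_right A.ell_pos.le (x τ) (y (t + 1) τ) (y t τ)
      rw [L.step, add_sub_cancel_left, norm_smul, Real.norm_of_nonneg hlam, ← L.step] at e1
      have e2 := norm_le_norm_add_norm_sub' (objGradY P F (x τ) (y (t + 1) τ))
        (objGradY P F (x τ) (y t τ))
      have e3 : ‖objGradY P F (x τ) (y (t + 1) τ)‖
          ≤ ‖objGradY P F (x τ) (y t τ)‖ + ℓ * lam * ‖u t τ‖ := by linarith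
      have e4 := pow_le_pow_left₀ (norm_nonneg _) e3 2
      simp only [Pi.add_apply]
      nlinarith [sq_nonneg (‖objGradY P F (x τ) (y t τ)‖ - ℓ * lam * ‖u t τ‖)]
    exact ⟨h1, h2, hu _ h1 h2⟩

/-- The ascent inequality in expectation. -/
theorem sum_integral_le (L : AscentLoop F lam n lab x y u) (A : Assumptions P F ℓ μ σ)
    (hlam : 0 < lam) (hn : 0 < n)
    (h0 : Integrable (fun τ => ‖objGradY P F (x τ) (y 0 τ)‖ ^ 2) (tapeMeasure P m' m))
    (he0 : Integrable (fun τ => ‖u 0 τ - objGradY P F (x τ) (y 0 τ)‖ ^ 2) (tapeMeasure P m' m))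
    (N : ℕ) :
    ∑ t ∈ Finset.range N, ((∫ τ, ‖objGradY P F (x τ) (y t τ)‖ ^ 2 ∂(tapeMeasure P m' m))
        + (1 - lam * ℓ) * ∫ τ, ‖u t τ‖ ^ 2 ∂(tapeMeasure P m' m))
      ≤ (∫ τ, ‖objGradY P F (x τ) (y 0 τ)‖ ^ 2 ∂(tapeMeasure P m' m)) / (lam * μ)
        + ∑ t ∈ Finset.range N,
          ∫ τ, ‖u t τ - objGradY P F (x τ) (y t τ)‖ ^ 2 ∂(tapeMeasure P m' m) := by
  have hi := fun t => L.integrable (m' := m') (m := m) A hlam.le hn h0 he0 t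
  have hs : ∀ t, Integrable (fun τ => ‖objGradY P F (x τ) (y t τ)‖ ^ 2
      + (1 - lam * ℓ) * ‖u t τ‖ ^ 2) (tapeMeasure P m' m) := fun t =>
    (hi t).1.add ((hi t).2.2.const_mul _)
  have h1 : ∫ τ, ∑ t ∈ Finset.range N, (‖objGradY P F (x τ) (y t τ)‖ ^ 2
        + (1 - lam * ℓ) * ‖u t τ‖ ^ 2) ∂(tapeMeasure P m' m)
      ≤ ∫ τ, (‖objGradY P F (x τ) (y 0 τ)‖ ^ 2 / (lam * μ)
        + ∑ t ∈ Finset.range N, ‖u t τ - objGradY P F (x τ) (y t τ)‖ ^ 2)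
          ∂(tapeMeasure P m' m) := by
    refine integral_mono (integrable_finsetSum _ fun t _ => hs t)
      ((h0.div_const _).add (integrable_finsetSum _ fun t _ => (hi t).2.1)) fun τ => ?_
    exact A.sum_ascent_le (x τ) hlam (fun t => y t τ) (fun t => u t τ) (fun t => L.step t τ) N
  rw [integral_finsetSum _ fun t _ => hs t,
    integral_add (h0.div_const _) (integrable_finsetSum _ fun t _ => (hi t).2.1),
    integral_finsetSum _ fun t _ => (hi t).2.1, integral_div] at h1
  refine le_trans (le_of_eq ?_) h1
  refine Finset.sum_congr rfl fun t _ => ?_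
  rw [integral_add (hi t).1 ((hi t).2.2.const_mul _), integral_const_mul]

end AscentLoop

theorem le_add_sum_of_error_growth {U E : ℕ → ℝ} {ρ : ℝ} {N : ℕ} (hU : ∀ t, 0 ≤ U t)
    (hρ : 0 ≤ ρ) (hE : ∀ t, E (t + 1) ≤ E t + ρ * U t) {t : ℕ} (ht : t ≤ N) :
    E t ≤ E 0 + ρ * ∑ j ∈ Finset.range N, U j := by
  have h1 : E t ≤ E 0 + ρ * ∑ j ∈ Finset.range t, U j := by
    clear ht
    induction t with
    | zero => simp
    | succ t ih =>
      rw [Finset.sum_range_succ, mul_add]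
      linarith [hE t]
  have h2 : ∑ j ∈ Finset.range t, U j ≤ ∑ j ∈ Finset.range N, U j :=
    Finset.sum_le_sum_of_subset_of_nonneg (Finset.range_subset_range.2 ht) fun j _ _ => hU j
  have := mul_le_mul_of_nonneg_left h2 hρ
  linarith

/-- The real recursion behind the loop: if the errors `E` grow by at most `ρ` times the squared
step directions `U` and `N ρ ≤ r`, then the part `r ∑ U` of `a ∑ U` absorbs the growth of the
errors. -/
theorem sum_le_of_error_growth {A U E : ℕ → ℝ} {a r ρ c : ℝ} {N : ℕ} (hU : ∀ t, 0 ≤ U t)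
    (hρ : 0 ≤ ρ) (hE : ∀ t, E (t + 1) ≤ E t + ρ * U t)
    (hs : ∑ t ∈ Finset.range N, (A t + a * U t) ≤ c + ∑ t ∈ Finset.range N, E t)
    (hN : N * ρ ≤ r) :
    ∑ t ∈ Finset.range N, A t + (a - r) * ∑ t ∈ Finset.range N, U t ≤ c + N * E 0 := by
  have hEt : ∀ t ≤ N, E t ≤ E 0 + ρ * ∑ j ∈ Finset.range N, U j := fun t ht =>
    le_add_sum_of_error_growth hU hρ hE ht
  have hsum : ∑ t ∈ Finset.range N, E t ≤ N * (E 0 + ρ * ∑ j ∈ Finset.range N, U j) := by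
    have := Finset.sum_le_card_nsmul (Finset.range N) E _
      (fun t ht => hEt t (Finset.mem_range.1 ht).le)
    rwa [Finset.card_range, nsmul_eq_mul] at this
  rw [Finset.sum_add_distrib, ← Finset.mul_sum] at hs
  have hS : 0 ≤ ∑ j ∈ Finset.range N, U j := Finset.sum_nonneg fun j _ => hU j
  nlinarith

end Estimators

/-! ### The initialization -/

section Init

theorem iSarahInner_congr {d : ℕ} {Ξ : Type*} {gradH : Vec d → Ξ → Vec d} {J : ISarahParams}
    {ξ ξ' : SampleId → Ξ} {s : ℕ} {w₀ : Vec d} {t : ℕ}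
    (h₁ : ∀ i, ξ (.initBatch s i) = ξ' (.initBatch s i))
    (h₂ : ∀ t' ≤ t, ξ (.initStep s t') = ξ' (.initStep s t')) :
    iSarahInner gradH J ξ s w₀ t = iSarahInner gradH J ξ' s w₀ t := by
  induction t with
  | zero => simp only [iSarahInner, h₁]
  | succ t ih =>
    simp only [iSarahInner, ih fun t' ht' => h₂ t' (ht'.trans t.le_succ), h₂ (t + 1) le_rfl]

theorem iSarahIterate_congr {d : ℕ} {Ξ : Type*} {gradH : Vec d → Ξ → Vec d} {J : ISarahParams}
    {ξ ξ' : SampleId → Ξ} {s : ℕ} {w₀ : Vec d} {t : ℕ}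
    (h₁ : ∀ i, ξ (.initBatch s i) = ξ' (.initBatch s i))
    (h₂ : ∀ t' < t, ξ (.initStep s t') = ξ' (.initStep s t')) :
    iSarahIterate gradH J ξ s w₀ t = iSarahIterate gradH J ξ' s w₀ t := by
  cases t with
  | zero => rfl
  | succ t =>
    simp only [iSarahIterate]
    rw [iSarahInner_congr h₁ fun t' ht' => h₂ t' (Nat.lt_succ_of_le ht')]

theorem iSarahInner_evals {d : ℕ} {Ξ : Type*} (gradH : Vec d → Ξ → Vec d) (J : ISarahParams)
    (ξ : SampleId → Ξ) (s : ℕ) (w₀ : Vec d) (t : ℕ) :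
    (iSarahInner gradH J ξ s w₀ t).evals = J.b + 2 * t := by
  induction t with
  | zero => rfl
  | succ t ih => simp only [iSarahInner, ih]; ring

theorem iSarah_congr {d : ℕ} {Ξ : Type*} {gradH : Vec d → Ξ → Vec d} {J : ISarahParams}
    {ξ ξ' : SampleId → Ξ} {c c' : ChoiceId → ℕ} {w₀ : Vec d} {s : ℕ}
    (h₁ : ∀ s' < s, ∀ i, ξ (.initBatch s' i) = ξ' (.initBatch s' i))
    (h₂ : ∀ s' < s, ∀ t, ξ (.initStep s' t) = ξ' (.initStep s' t))
    (h₃ : ∀ s' < s, c (.init s') = c' (.init s')) :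
    (iSarah gradH J ξ c w₀ s).1 = (iSarah gradH J ξ' c' w₀ s).1 := by
  induction s with
  | zero => rfl
  | succ s ih =>
    simp only [iSarah]
    rw [ih (fun s' hs' => h₁ s' (hs'.trans s.lt_succ_self))
      (fun s' hs' => h₂ s' (hs'.trans s.lt_succ_self))
      (fun s' hs' => h₃ s' (hs'.trans s.lt_succ_self)), h₃ s s.lt_succ_self,
      iSarahIterate_congr (h₁ s s.lt_succ_self) fun t' _ => h₂ s s.lt_succ_self t']

theorem iSarah_evals {d : ℕ} {Ξ : Type*} (gradH : Vec d → Ξ → Vec d) (J : ISarahParams)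
    (ξ : SampleId → Ξ) (c : ChoiceId → ℕ) (w₀ : Vec d) (s : ℕ) :
    (iSarah gradH J ξ c w₀ s).2 = s * (J.b + 2 * (J.m' - 1)) := by
  induction s with
  | zero => simp [iSarah]
  | succ s ih => simp only [iSarah, ih, iSarahInner_evals]; ring

theorem iSarahInner_wPrev {d : ℕ} {Ξ : Type*} (gradH : Vec d → Ξ → Vec d) (J : ISarahParams)
    (ξ : SampleId → Ξ) (s : ℕ) (w₀ : Vec d) (t : ℕ) :
    (iSarahInner gradH J ξ s w₀ t).wPrev = iSarahIterate gradH J ξ s w₀ t := by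
  cases t <;> rfl

theorem iSarahIterate_succ {d : ℕ} {Ξ : Type*} (gradH : Vec d → Ξ → Vec d) (J : ISarahParams)
    (ξ : SampleId → Ξ) (s : ℕ) (w₀ : Vec d) (t : ℕ) :
    iSarahIterate gradH J ξ s w₀ (t + 1)
      = iSarahIterate gradH J ξ s w₀ t - J.γ • (iSarahInner gradH J ξ s w₀ t).v := by
  cases t <;> rfl

theorem gradient_neg_component {d₁ d₂ : ℕ} {Ξ : Type*} (F : Vec d₁ → Vec d₂ → Ξ → ℝ)
    (x : Vec d₁) : (fun w z => gradient (fun w' => -F x w' z) w) = fun w z => -gradY F x w z := by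
  funext w z
  simp only [gradY, gradient]
  rw [← map_neg]
  congr 1
  exact fderiv_fun_neg

variable {d₁ d₂ : ℕ} {Ξ : Type*} [MeasurableSpace Ξ] {P : Measure Ξ} [IsProbabilityMeasure P]
  {m : ℕ} {F : Vec d₁ → Vec d₂ → Ξ → ℝ} {ℓ μ σ : ℝ}

/-- An epoch of iSARAH is a recursive ascent loop for `f(x₀, ·)` with single samples. -/
theorem ascentLoop_iSarah (F : Vec d₁ → Vec d₂ → Ξ → ℝ) (A : Assumptions P F ℓ μ σ)
    (J : ISarahParams) (x₀ : Vec d₁) (s : ℕ)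
    {W : Tape Ξ → Vec d₂} (hW : Measurable W) (hWf : ∀ t, FreeOfSample (.initStep s t) W) :
    AscentLoop F J.γ 1 (fun t i => .initStep s (t + 1 + i)) (fun _ => x₀)
      (fun t τ => iSarahIterate (fun w z => -gradY F x₀ w z) J τ.1 s (W τ) t)
      (fun t τ => -(iSarahInner (fun w z => -gradY F x₀ w z) J τ.1 s (W τ) t).v) where
  step t τ := by rw [iSarahIterate_succ, smul_neg, sub_eq_add_neg]
  update t τ := by
    rw [batchMean_one, batchMean_one, ← iSarahInner_wPrev (t := t)]
    change -(-gradY F x₀ _ _ - -gradY F x₀ _ _ + _) = _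
    rw [show iSarahIterate (fun w z => -gradY F x₀ w z) J τ.1 s (W τ) (t + 1)
      = (iSarahInner (fun w z => -gradY F x₀ w z) J τ.1 s (W τ) t).w from rfl, Nat.add_zero]
    abel
  injective t i j h := by simpa using h
  measurable_x := measurable_const
  measurable_y_zero := hW
  measurable_u_zero := by
    simp only [iSarahInner, batchMean_neg, neg_neg]
    exact A.oracleY.measurable_batchMean measurable_const hW _ _
  free_x t i τ z := rfl
  free_y t i τ z := by
    simp only
    rw [hWf _ τ z]
    refine iSarahIterate_congr (fun i => setSample_apply_of_ne _ _ (by simp)) fun t' ht' =>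
      setSample_apply_of_ne _ _ ?_
    intro h; injection h; omega
  free_u t i τ z := by
    simp only
    rw [hWf _ τ z]
    congr 2
    refine iSarahInner_congr (fun i => setSample_apply_of_ne _ _ (by simp)) fun t' ht' =>
      setSample_apply_of_ne _ _ ?_
    intro h; injection h; omega

omit [MeasurableSpace Ξ] in
theorem freeOfSample_iSarah {gradH : Vec d₂ → Ξ → Vec d₂} {J : ISarahParams} {w₀ : Vec d₂}
    {s : ℕ} {l : SampleId} (h₁ : ∀ s' < s, ∀ i, SampleId.initBatch s' i ≠ l)
    (h₂ : ∀ s' < s, ∀ t, SampleId.initStep s' t ≠ l) :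
    FreeOfSample l (fun τ : Tape Ξ => (iSarah gradH J τ.1 τ.2 w₀ s).1) := fun _ _ =>
  iSarah_congr (fun s' hs' i => setSample_apply_of_ne _ _ (h₁ s' hs' i))
    (fun s' hs' t => setSample_apply_of_ne _ _ (h₂ s' hs' t)) (fun _ _ => rfl)

theorem measurable_iSarah (A : Assumptions P F ℓ μ σ) (J : ISarahParams) (x₀ : Vec d₁)
    (w₀ : Vec d₂) (s : ℕ) :
    Measurable (fun τ : Tape Ξ => (iSarah (fun w z => -gradY F x₀ w z) J τ.1 τ.2 w₀ s).1) := by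
  induction s with
  | zero => exact measurable_const
  | succ s ih =>
    have L := ascentLoop_iSarah F A J x₀ s ih fun t => freeOfSample_iSarah (by simp)
      fun s' hs' t h => by injection h; omega
    have : Measurable (fun p : ℕ × Tape Ξ => iSarahIterate (fun w z => -gradY F x₀ w z) J p.2.1 s
        (iSarah (fun w z => -gradY F x₀ w z) J p.2.1 p.2.2 w₀ s).1 p.1) :=
      measurable_from_prod_countable_right fun t => (L.measurable A t).1
    exact this.comp (f := fun τ : Tape Ξ => (τ.2 (.init s), τ)) (by fun_prop)

/-- One epoch of iSARAH. The step size is small enough to absorb the accumulated sampling errors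
without assuming that every single component function is smooth. -/
theorem integral_sq_iSarah_succ_le (A : Assumptions P F ℓ μ σ) (J : ISarahParams)
    (x₀ : Vec d₁) (w₀ : Vec d₂) (s : ℕ)
    (hJ : ((J.m' : ℝ) + 1) * (ℓ ^ 2 * J.γ ^ 2) ≤ 1 - J.γ * ℓ)
    (hi : Integrable (fun τ : Tape Ξ => ‖objGradY P F x₀
      (iSarah (fun w z => -gradY F x₀ w z) J τ.1 τ.2 w₀ s).1‖ ^ 2) (tapeMeasure P J.m' m)) :
    Integrable (fun τ : Tape Ξ => ‖objGradY P F x₀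
      (iSarah (fun w z => -gradY F x₀ w z) J τ.1 τ.2 w₀ (s + 1)).1‖ ^ 2) (tapeMeasure P J.m' m) ∧
    ∫ τ : Tape Ξ, ‖objGradY P F x₀
      (iSarah (fun w z => -gradY F x₀ w z) J τ.1 τ.2 w₀ (s + 1)).1‖ ^ 2 ∂(tapeMeasure P J.m' m)
    ≤ (∫ τ : Tape Ξ, ‖objGradY P F x₀
      (iSarah (fun w z => -gradY F x₀ w z) J τ.1 τ.2 w₀ s).1‖ ^ 2 ∂(tapeMeasure P J.m' m))
        / (J.γ * μ * (J.m' + 1)) + σ ^ 2 / J.b := by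
  set W : Tape Ξ → Vec d₂ :=
    fun τ => (iSarah (fun w z => -gradY F x₀ w z) J τ.1 τ.2 w₀ s).1 with hWdef
  have hW : Measurable W := measurable_iSarah A J x₀ w₀ s
  have L := ascentLoop_iSarah F A J x₀ s hW fun t => freeOfSample_iSarah (by simp)
      fun s' hs' t h => by injection h; omega
  set y : ℕ → Tape Ξ → Vec d₂ :=
    fun t τ => iSarahIterate (fun w z => -gradY F x₀ w z) J τ.1 s (W τ) t with hy
  set u : ℕ → Tape Ξ → Vec d₂ :=
    fun t τ => -(iSarahInner (fun w z => -gradY F x₀ w z) J τ.1 s (W τ) t).v with hu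
  have hu0 : ∀ τ, u 0 τ = batchMean J.b (fun i => gradY F x₀ (W τ) (τ.1 (.initBatch s i))) := by
    intro τ
    simp only [hu, iSarahInner, batchMean_neg, neg_neg]
  have he0 := A.oracleY.integral_sq_batchMean_sub_le (m' := J.m') (m := m) A.ell_pos.le J.b_pos
    (lab := fun i => .initBatch s i) (fun i j h => by simpa using h) (x := fun _ => x₀) (y := W)
    measurable_const hW (fun i τ z => rfl)
    (fun i => freeOfSample_iSarah (fun s' hs' t h => by injection h; omega) (by simp))
  simp only [← hu0] at he0
  have hint := fun t => L.integrable (m' := J.m') (m := m) A J.γ_pos.le one_pos hi he0.1 t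
  have hsum := L.sum_integral_le (m' := J.m') (m := m) A J.γ_pos one_pos hi he0.1 (J.m' + 1)
  have hgrow := fun t => (L.integral_sq_estimator_le (m' := J.m') (m := m) A one_pos A.oracleY t
    (L.update t) (L.measurable A t).2 (L.free_u t) (hint t).2.1 (hint t).2.2).2
  have hfin := sum_le_of_error_growth
    (U := fun t => ∫ τ, ‖u t τ‖ ^ 2 ∂(tapeMeasure P J.m' m))
    (fun t => integral_nonneg fun τ => by positivity) (by positivity) hgrow hsum
    (r := 1 - J.γ * ℓ) (by push_cast; simpa using hJ)
  rw [sub_self, zero_mul, add_zero] at hfin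
  have hch := integrable_integral_eq_of_choice (P := P) (m' := J.m') (m := m) (j := .init s)
    (φ := fun t τ => ‖objGradY P F x₀ (y t τ)‖ ^ 2)
    (fun t => ((A.oracleY.measurable_field A.ell_pos.le measurable_const
      (L.measurable A t).1).norm.pow_const 2))
    (fun t τ => by positivity)
    (fun t τ c => by
      have : W (setChoice τ (.init s) c) = W τ :=
        iSarah_congr (fun _ _ _ => rfl) (fun _ _ _ => rfl) fun s' hs' =>
          setChoice_apply_of_ne _ _ fun h => by injection h; omega
      simp only [hy, this]; rfl)
    (fun t _ => (hint t).1)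
  refine ⟨hch.1, ?_⟩
  have hb : (0 : ℝ) < J.b := by exact_mod_cast J.b_pos
  have hm : (0 : ℝ) < (J.m' : ℝ) + 1 := by positivity
  have hγ := J.γ_pos
  have hμ := A.mu_pos
  refine hch.2.trans_le ?_
  simp only [choiceBound]
  have h1 : ((J.m' : ℝ) + 1)⁻¹ * ∑ t ∈ Finset.range (J.m' + 1),
        ∫ τ, ‖objGradY P F x₀ (y t τ)‖ ^ 2 ∂(tapeMeasure P J.m' m)
      ≤ ((J.m' : ℝ) + 1)⁻¹ * ((∫ τ, ‖objGradY P F x₀ (y 0 τ)‖ ^ 2 ∂(tapeMeasure P J.m' m))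
        / (J.γ * μ) + ((J.m' : ℝ) + 1) * (σ ^ 2 / J.b)) := by
    refine mul_le_mul_of_nonneg_left (hfin.trans ?_) (by positivity)
    push_cast
    gcongr
    exact he0.2
  refine h1.trans_eq ?_
  rw [mul_add, ← mul_assoc, inv_mul_cancel₀ hm.ne', one_mul]
  congr 1
  change _ * ((∫ τ, ‖objGradY P F x₀ (W τ)‖ ^ 2 ∂(tapeMeasure P J.m' m)) / _) = _
  field_simp
  rfl

/-- The parameters of the initialization. One epoch divides the squared gradient norm by `4` up to
the error of the large batch, and there are so many epochs, namely of order `κ / ε`, that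
`4 ^ T ≥ T ^ 2` suffices. The value of `γ` for `μ ≤ 0` is arbitrary. -/
def initParams (ℓ σ G μ ε : ℝ) : ISarahParams where
  γ := if 0 < μ then 4 / (μ * ((⌈32 * (ℓ / μ) ^ 2⌉₊ : ℝ) + 2)) else 1
  m' := ⌈32 * (ℓ / μ) ^ 2⌉₊ + 1
  b := ⌈3 * σ ^ 2 * (ℓ / μ) ^ 2 * ε⁻¹ ^ 2⌉₊ + 1
  T := ⌈2 * G * (ℓ / μ) * ε⁻¹⌉₊
  γ_pos := by split_ifs <;> positivity
  m'_pos := Nat.succ_pos _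
  b_pos := Nat.succ_pos _

theorem initParams_accurate (A : Assumptions P F ℓ μ σ) (hd : 0 < d₂) {G ε : ℝ} (hε : 0 < ε)
    (x₀ : Vec d₁) (w₀ : Vec d₂) (hG : ‖objGradY P F x₀ w₀‖ ≤ G) :
    Integrable (fun τ : Tape Ξ => ‖objGradY P F x₀
      (sredaInit F (initParams ℓ σ G μ ε) τ.1 τ.2 x₀ w₀).1‖ ^ 2)
      (tapeMeasure P (initParams ℓ σ G μ ε).m' m) ∧
    ∫ τ : Tape Ξ, ‖objGradY P F x₀
      (sredaInit F (initParams ℓ σ G μ ε) τ.1 τ.2 x₀ w₀).1‖ ^ 2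
        ∂(tapeMeasure P (initParams ℓ σ G μ ε).m' m) ≤ (ℓ / μ)⁻¹ ^ 2 * ε ^ 2 := by
  have hl := A.ell_pos
  have hμ := A.mu_pos
  have hμl := A.mu_le_ell hd
  set κ := ℓ / μ with hκ
  have hκ1 : 1 ≤ κ := (one_le_div hμ).2 hμl
  have hκ0 : 0 < κ := by linarith
  have hG0 : 0 ≤ G := (norm_nonneg _).trans hG
  set J := initParams ℓ σ G μ ε with hJdef
  set N : ℝ := (⌈32 * κ ^ 2⌉₊ : ℝ) + 2 with hN
  have hN32 : 32 * κ ^ 2 ≤ N := by have := Nat.le_ceil (32 * κ ^ 2); linarith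
  have hN0 : 0 < N := by positivity
  have hγ : J.γ = 4 / (μ * N) := by rw [hJdef, initParams]; simp only [if_pos hμ]; rfl
  have hm' : (J.m' : ℝ) + 1 = N := by
    rw [hJdef, initParams]; push_cast; rw [hN, hκ]; ring
  have hb : 3 * σ ^ 2 * κ ^ 2 * ε⁻¹ ^ 2 ≤ J.b := by
    rw [hJdef, initParams]; push_cast
    have := Nat.le_ceil (3 * σ ^ 2 * κ ^ 2 * ε⁻¹ ^ 2)
    linarith
  have hT : 2 * G * κ * ε⁻¹ ≤ J.T := Nat.le_ceil _
  have hγl : J.γ * ℓ = 4 * κ / N := by rw [hγ, hκ]; field_simp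
  have hstep : ((J.m' : ℝ) + 1) * (ℓ ^ 2 * J.γ ^ 2) ≤ 1 - J.γ * ℓ := by
    have e1 : ((J.m' : ℝ) + 1) * (ℓ ^ 2 * J.γ ^ 2) = 16 * κ ^ 2 / N := by
      rw [hm', ← mul_pow, mul_comm ℓ, hγl]; field_simp; norm_num
    rw [e1, hγl]
    have e2 : 16 * κ ^ 2 / N ≤ 1 / 2 := by rw [div_le_iff₀ hN0]; linarith
    have e3 : 4 * κ / N ≤ 1 / 2 := by rw [div_le_iff₀ hN0]; nlinarith
    linarith
  -- One epoch contracts by the factor `1 / (γ μ (m' + 1))`.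
  have hrate : J.γ * μ * (J.m' + 1) = 4 := by rw [hm', hγ]; field_simp
  have hJb : (0 : ℝ) < J.b := by exact_mod_cast J.b_pos
  have hvar : σ ^ 2 / J.b ≤ κ⁻¹ ^ 2 * ε ^ 2 / 3 := by
    rw [div_le_iff₀ hJb]
    calc σ ^ 2 = κ⁻¹ ^ 2 * ε ^ 2 / 3 * (3 * σ ^ 2 * κ ^ 2 * ε⁻¹ ^ 2) := by field_simp
      _ ≤ _ := by gcongr
  have key : ∀ s : ℕ, Integrable (fun τ : Tape Ξ => ‖objGradY P F x₀
      (iSarah (fun w z => -gradY F x₀ w z) J τ.1 τ.2 w₀ s).1‖ ^ 2) (tapeMeasure P J.m' m) ∧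
    -- `4 / 9 = (1 / 3) / (1 - 1 / 4)` sums the batch errors of all epochs.
    ∫ τ : Tape Ξ, ‖objGradY P F x₀
      (iSarah (fun w z => -gradY F x₀ w z) J τ.1 τ.2 w₀ s).1‖ ^ 2 ∂(tapeMeasure P J.m' m)
      ≤ G ^ 2 / 4 ^ s + 4 / 9 * (κ⁻¹ ^ 2 * ε ^ 2) := by
    intro s
    induction s with
    | zero =>
      refine ⟨by simp only [iSarah]; exact integrable_const _, ?_⟩
      simp only [iSarah, integral_const, probReal_univ, smul_eq_mul, one_mul, pow_zero, div_one]
      have : ‖objGradY P F x₀ w₀‖ ^ 2 ≤ G ^ 2 := by gcongr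
      have : 0 ≤ κ⁻¹ ^ 2 * ε ^ 2 := by positivity
      linarith
    | succ s ih =>
      have h := integral_sq_iSarah_succ_le (m := m) A J x₀ w₀ s hstep ih.1
      refine ⟨h.1, h.2.trans ?_⟩
      rw [hrate]
      have : G ^ 2 / 4 ^ (s + 1) = G ^ 2 / 4 ^ s / 4 := by rw [pow_succ (4 : ℝ), div_div]
      linarith [ih.2]
  have hfin := key J.T
  simp only [sredaInit, gradient_neg_component]
  refine ⟨hfin.1, hfin.2.trans ?_⟩
  have h4 : G ^ 2 / 4 ^ J.T ≤ κ⁻¹ ^ 2 * ε ^ 2 / 4 := by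
    rw [div_le_iff₀ (by positivity)]
    have h5 : (J.T : ℝ) ≤ 2 ^ J.T := by exact_mod_cast Nat.lt_two_pow_self.le
    have h6 : 2 * G * κ * ε⁻¹ ≤ 2 ^ J.T := hT.trans h5
    have h7 : (2 * G * κ * ε⁻¹) ^ 2 ≤ (2 ^ J.T) ^ 2 := by gcongr
    rw [← pow_mul, mul_comm J.T 2, pow_mul (2 : ℝ) 2, show (2 : ℝ) ^ 2 = 4 by norm_num] at h7
    calc G ^ 2 = κ⁻¹ ^ 2 * ε ^ 2 / 4 * (2 * G * κ * ε⁻¹) ^ 2 := by field_simp; norm_num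
      _ ≤ κ⁻¹ ^ 2 * ε ^ 2 / 4 * 4 ^ J.T := by gcongr
  have : 0 ≤ κ⁻¹ ^ 2 * ε ^ 2 := by positivity
  linarith

end Init

/-! ### The concave maximizer -/

section Maximizer

variable {d₁ d₂ : ℕ} {Ξ : Type*}

theorem concaveMaximizer_congr {F : Vec d₁ → Vec d₂ → Ξ → ℝ} {p : Params} {ξ ξ' : SampleId → Ξ}
    {k : ℕ} {x x' : Vec d₁} {y : Vec d₂} {v : Vec d₁} {u : Vec d₂} {t : ℕ}
    (h : ∀ t' ≤ t, ∀ i, ξ (.small k t' i) = ξ' (.small k t' i)) :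
    concaveMaximizer F p ξ k x x' y v u t = concaveMaximizer F p ξ' k x x' y v u t := by
  induction t with
  | zero => simp only [concaveMaximizer, h 0 le_rfl]
  | succ t ih =>
    simp only [concaveMaximizer, ih fun t' ht' => h t' (ht'.trans t.le_succ), h (t + 1) le_rfl]

theorem concaveMaximizer_evals (F : Vec d₁ → Vec d₂ → Ξ → ℝ) (p : Params) (ξ : SampleId → Ξ)
    (k : ℕ) (x x' : Vec d₁) (y : Vec d₂) (v : Vec d₁) (u : Vec d₂) (t : ℕ) :
    (concaveMaximizer F p ξ k x x' y v u t).evals = 2 * p.S₂ * (t + 1) := by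
  induction t with
  | zero => simp [concaveMaximizer]
  | succ t ih => simp only [concaveMaximizer, ih]; ring

theorem concaveMaximizer_yNext (F : Vec d₁ → Vec d₂ → Ξ → ℝ) (p : Params) (ξ : SampleId → Ξ)
    (k : ℕ) (x x' : Vec d₁) (y : Vec d₂) (v : Vec d₁) (u : Vec d₂) (t : ℕ) :
    (concaveMaximizer F p ξ k x x' y v u t).yNext
      = (concaveMaximizer F p ξ k x x' y v u t).y
        + p.lam • (concaveMaximizer F p ξ k x x' y v u t).u := by
  cases t <;> rfl

variable [MeasurableSpace Ξ] {P : Measure Ξ} [IsProbabilityMeasure P]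
  {m' : ℕ} {F : Vec d₁ → Vec d₂ → Ξ → ℝ} {ℓ μ σ : ℝ}

/-- The inputs of the concave maximizer at iteration `k` are determined before its draws. -/
structure MaximizerInput (k : ℕ) (x x' : Tape Ξ → Vec d₁) (y : Tape Ξ → Vec d₂)
    (v : Tape Ξ → Vec d₁) (u : Tape Ξ → Vec d₂) : Prop where
  measurable : Measurable x ∧ Measurable x' ∧ Measurable y ∧ Measurable v ∧ Measurable u
  free_x : ∀ t i, FreeOfSample (.small k t i) x
  free_x' : ∀ t i, FreeOfSample (.small k t i) x'
  free_y : ∀ t i, FreeOfSample (.small k t i) y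
  free_v : ∀ t i, FreeOfSample (.small k t i) v
  free_u : ∀ t i, FreeOfSample (.small k t i) u
  choice_x : FreeOfChoice (.inner k) x
  choice_x' : FreeOfChoice (.inner k) x'
  choice_y : FreeOfChoice (.inner k) y
  choice_v : FreeOfChoice (.inner k) v
  choice_u : FreeOfChoice (.inner k) u

namespace MaximizerInput

variable {k : ℕ} {x x' : Tape Ξ → Vec d₁} {y : Tape Ξ → Vec d₂} {v : Tape Ξ → Vec d₁}
  {u : Tape Ξ → Vec d₂} {p : Params}

omit [IsProbabilityMeasure P] in
theorem freeOfSample_state (I : MaximizerInput k x x' y v u) (F : Vec d₁ → Vec d₂ → Ξ → ℝ)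
    (p : Params) {t t' i : ℕ} (ht : t < t') :
    FreeOfSample (.small k t' i) (fun τ : Tape Ξ =>
      concaveMaximizer F p τ.1 k (x τ) (x' τ) (y τ) (v τ) (u τ) t) := by
  intro τ z
  simp only
  rw [I.free_x t' i τ z, I.free_x' t' i τ z, I.free_y t' i τ z, I.free_v t' i τ z,
    I.free_u t' i τ z]
  refine concaveMaximizer_congr fun s hs j => setSample_apply_of_ne _ _ ?_
  intro h; injection h; omega

omit [IsProbabilityMeasure P] in
theorem freeOfChoice_state (I : MaximizerInput k x x' y v u) (F : Vec d₁ → Vec d₂ → Ξ → ℝ)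
    (p : Params) (t : ℕ) :
    FreeOfChoice (.inner k) (fun τ : Tape Ξ =>
      concaveMaximizer F p τ.1 k (x τ) (x' τ) (y τ) (v τ) (u τ) t) := by
  intro τ z
  simp only
  rw [I.choice_x τ z, I.choice_x' τ z, I.choice_y τ z, I.choice_v τ z, I.choice_u τ z]
  rfl

theorem ascentLoop (I : MaximizerInput k x x' y v u) (A : Assumptions P F ℓ μ σ) (p : Params) :
    AscentLoop F p.lam p.S₂ (fun t i => .small k (t + 1) i) x'
      (fun t τ => (concaveMaximizer F p τ.1 k (x τ) (x' τ) (y τ) (v τ) (u τ) t).y)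
      (fun t τ => (concaveMaximizer F p τ.1 k (x τ) (x' τ) (y τ) (v τ) (u τ) t).u) where
  step t τ := concaveMaximizer_yNext F p τ.1 k (x τ) (x' τ) (y τ) (v τ) (u τ) t
  update t τ := rfl
  injective t i j h := by simpa using h
  measurable_x := I.measurable.2.1
  measurable_y_zero := I.measurable.2.2.1
  measurable_u_zero :=
    (I.measurable.2.2.2.2.add
      (A.oracleY.measurable_batchMean I.measurable.2.1 I.measurable.2.2.1 _ _)).sub
      (A.oracleY.measurable_batchMean I.measurable.1 I.measurable.2.2.1 _ _)
  free_x t i := I.free_x' _ _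
  free_y t i τ z := congrArg InnerState.y (I.freeOfSample_state F p t.lt_succ_self τ z)
  free_u t i τ z := congrArg InnerState.u (I.freeOfSample_state F p t.lt_succ_self τ z)

theorem measurable_v (I : MaximizerInput k x x' y v u) (A : Assumptions P F ℓ μ σ) (p : Params)
    (t : ℕ) : Measurable (fun τ : Tape Ξ =>
      (concaveMaximizer F p τ.1 k (x τ) (x' τ) (y τ) (v τ) (u τ) t).v) := by
  have L := I.ascentLoop A p
  induction t with
  | zero =>
    exact (I.measurable.2.2.2.1.add
      (A.oracleX.measurable_batchMean I.measurable.2.1 I.measurable.2.2.1 _ _)).sub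
      (A.oracleX.measurable_batchMean I.measurable.1 I.measurable.2.2.1 _ _)
  | succ t ih =>
    exact (ih.add (A.oracleX.measurable_batchMean I.measurable.2.1 (L.measurable A (t + 1)).1
      _ _)).sub (A.oracleX.measurable_batchMean I.measurable.2.1 (L.measurable A t).1 _ _)

/-- The error of an estimate when the maximizer moves from `x` to `x'`. -/
theorem integral_sq_first_update_le (I : MaximizerInput k x x' y v u)
    (A : Assumptions P F ℓ μ σ) {m : ℕ} {n : ℕ} (hn : 0 < n) {d : ℕ}
    {G : Vec d₁ → Vec d₂ → Ξ → Vec d} {g : Vec d₁ → Vec d₂ → Vec d} (O : IsOracle P G g ℓ σ)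
    {w : Tape Ξ → Vec d} (hw : Measurable w) (hwf : ∀ i, FreeOfSample (.small k 0 i) w)
    (he : Integrable (fun τ => ‖w τ - g (x τ) (y τ)‖ ^ 2) (tapeMeasure P m' m))
    {r : ℝ} (hx : ∀ τ, ‖x' τ - x τ‖ ^ 2 ≤ r) :
    Integrable (fun τ => ‖w τ + batchMean n (fun i => G (x' τ) (y τ) (τ.1 (.small k 0 i)))
          - batchMean n (fun i => G (x τ) (y τ) (τ.1 (.small k 0 i))) - g (x' τ) (y τ)‖ ^ 2)
        (tapeMeasure P m' m) ∧
      ∫ τ, ‖w τ + batchMean n (fun i => G (x' τ) (y τ) (τ.1 (.small k 0 i)))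
          - batchMean n (fun i => G (x τ) (y τ) (τ.1 (.small k 0 i))) - g (x' τ) (y τ)‖ ^ 2
        ∂(tapeMeasure P m' m) ≤ (∫ τ, ‖w τ - g (x τ) (y τ)‖ ^ 2 ∂(tapeMeasure P m' m))
          + ℓ ^ 2 * r / n := by
  have h := O.integral_sq_update_sub_le (m' := m') (m := m) A.ell_pos.le hn
    (lab := fun i => .small k 0 i) (fun i j h => by simpa using h) (x := x) (x' := x') (y := y)
    (y' := y) (v := w) (B := fun _ => r) I.measurable.1 I.measurable.2.2.1 I.measurable.2.1
    I.measurable.2.2.1 hw (I.free_x 0) (I.free_y 0) (I.free_x' 0) (I.free_y 0) hwf he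
    (integrable_const _) (fun τ => by simpa using hx τ)
  simpa using h

end MaximizerInput

/-- Arithmetic of the prescribed parameters for the inner loop. `A₀` and `E₀` are the initial mean
squared gradient and error of the loop, `SA` and `S` the sums of the mean squared gradients and
directions. The constant `17 / 120 = 1 / 24 + 1 / 10` is the share of `ζ` that the estimation
error may reach before the next large batch. -/
theorem inner_loop_arith {κ q S₂ m ζ A₀ E₀ SA S : ℝ} (hκ : 1 ≤ κ) (hq : 1 ≤ q)
    (hS₂ : 7368 / 175 * κ * q ≤ S₂) (hm : 28 * κ - 1 ≤ m) (hm' : m ≤ 28 * κ) (hζ : 0 < ζ)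
    (hA₀ : A₀ ≤ 2 * ζ + 2 * (ζ / 25)) (hE₀ : E₀ ≤ 17 / 120 * ζ + ζ / 25 / S₂)
    (hSA : 0 ≤ SA) (hS : 0 ≤ S)
    (h : SA + 1 / 2 * S ≤ 7 / 2 * κ * A₀ + (m + 2) * E₀) :
    (m + 1)⁻¹ * SA ≤ ζ ∧ ζ / 25 / S₂ + 4 / 49 / S₂ * S ≤ ζ / (10 * q) := by
  have hκq : 1 ≤ κ * q := by nlinarith
  have hS₂1 : 42 * (κ * q) ≤ S₂ := by linarith
  have hS₂0 : 0 < S₂ := by linarith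
  have h1 : ζ / 25 / S₂ ≤ ζ / 1050 := by
    rw [div_div]; gcongr; linarith
  have hE : E₀ ≤ 3 / 20 * ζ := by linarith
  have hm1 : 0 < m + 1 := by linarith
  have h2 : SA + 1 / 2 * S ≤ 7 / 2 * κ * (2.08 * ζ) + (m + 2) * (3 / 20 * ζ) := by
    refine h.trans ?_
    have : A₀ ≤ 2.08 * ζ := by linarith
    have e1 : 7 / 2 * κ * A₀ ≤ 7 / 2 * κ * (2.08 * ζ) := by gcongr
    have e2 : (m + 2) * E₀ ≤ (m + 2) * (3 / 20 * ζ) := by gcongr; linarith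
    linarith
  have hκζ : 0 < κ * ζ := by positivity
  constructor
  · rw [inv_mul_le_iff₀ hm1]
    have e1 : (28 * κ) * ζ ≤ (m + 1) * ζ := by gcongr; linarith
    nlinarith
  · have e1 : (m + 2) * (3 / 20 * ζ) ≤ (30 * κ) * (3 / 20 * ζ) := by gcongr; linarith
    have e2 : S ≤ 23.56 * (κ * ζ) := by nlinarith
    have e3 : ζ / 25 / S₂ + 4 / 49 / S₂ * S = (ζ / 25 + 4 / 49 * S) / S₂ := by field_simp
    rw [e3, div_le_div_iff₀ hS₂0 (by positivity)]
    have e4 : ζ ≤ κ * ζ := by nlinarith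
    have e5 : ζ / 25 + 4 / 49 * S ≤ 2 * (κ * ζ) := by linarith
    calc (ζ / 25 + 4 / 49 * S) * (10 * q) ≤ (2 * (κ * ζ)) * (10 * q) := by gcongr
      _ = ζ * (20 * (κ * q)) := by ring
      _ ≤ ζ * S₂ := by gcongr; nlinarith

theorem params_S₂_le {ε : ℝ} : 7368 / 175 * (ℓ / μ) * ((params ℓ μ σ ε).q : ℝ)
    ≤ ((params ℓ μ σ ε).S₂ : ℝ) := Nat.le_ceil _

theorem params_q_pos {ε : ℝ} (hε : 0 < ε) : 0 < (params ℓ μ σ ε).q :=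
  Nat.ceil_pos.2 (inv_pos.2 hε)

/-- One call of the concave maximizer with the prescribed parameters: the accuracy `ζ` of `y` is
preserved, and the errors of the gradient estimates grow by at most `ζ / (10 q)`. -/
theorem maximizer_step (A : Assumptions P F ℓ μ σ) (hd : 0 < d₂) {ε : ℝ} (hε : 0 < ε) {k : ℕ}
    {x x' : Tape Ξ → Vec d₁} {y : Tape Ξ → Vec d₂} {v : Tape Ξ → Vec d₁}
    {u : Tape Ξ → Vec d₂} (I : MaximizerInput k x x' y v u) {p : Params}
    (hp : p = params ℓ μ σ ε) {e : ℝ} (he : e ≤ 17 / 120 * p.ζ)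
    (hx : ∀ τ, ‖x' τ - x τ‖ ^ 2 ≤ p.ζ / (25 * ℓ ^ 2))
    (hyi : Integrable (fun τ => ‖objGradY P F (x τ) (y τ)‖ ^ 2) (tapeMeasure P m' p.m))
    (hy : ∫ τ, ‖objGradY P F (x τ) (y τ)‖ ^ 2 ∂(tapeMeasure P m' p.m) ≤ p.ζ)
    (hvi : Integrable (fun τ => ‖v τ - objGradX P F (x τ) (y τ)‖ ^ 2) (tapeMeasure P m' p.m))
    (hv : ∫ τ, ‖v τ - objGradX P F (x τ) (y τ)‖ ^ 2 ∂(tapeMeasure P m' p.m) ≤ e)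
    (hui : Integrable (fun τ => ‖u τ - objGradY P F (x τ) (y τ)‖ ^ 2) (tapeMeasure P m' p.m))
    (hu : ∫ τ, ‖u τ - objGradY P F (x τ) (y τ)‖ ^ 2 ∂(tapeMeasure P m' p.m) ≤ e)
    {R : ℕ → Tape Ξ → InnerState d₁ d₂} (hR : R = fun t τ =>
      concaveMaximizer F p τ.1 k (x τ) (x' τ) (y τ) (v τ) (u τ) t)
    {y' : Tape Ξ → Vec d₂} {v' : Tape Ξ → Vec d₁} {u' : Tape Ξ → Vec d₂}
    (hy' : ∀ τ, y' τ = (R (τ.2 (.inner k) + 1) τ).y)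
    (hv' : ∀ τ, v' τ = (R (τ.2 (.inner k) + 1) τ).v)
    (hu' : ∀ τ, u' τ = (R (τ.2 (.inner k) + 1) τ).u) :
    (Integrable (fun τ => ‖objGradY P F (x' τ) (y' τ)‖ ^ 2) (tapeMeasure P m' p.m) ∧
      ∫ τ, ‖objGradY P F (x' τ) (y' τ)‖ ^ 2 ∂(tapeMeasure P m' p.m) ≤ p.ζ) ∧
    (Integrable (fun τ => ‖v' τ - objGradX P F (x' τ) (y' τ)‖ ^ 2) (tapeMeasure P m' p.m) ∧
      ∫ τ, ‖v' τ - objGradX P F (x' τ) (y' τ)‖ ^ 2 ∂(tapeMeasure P m' p.m)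
        ≤ e + p.ζ / (10 * p.q)) ∧
    (Integrable (fun τ => ‖u' τ - objGradY P F (x' τ) (y' τ)‖ ^ 2) (tapeMeasure P m' p.m) ∧
      ∫ τ, ‖u' τ - objGradY P F (x' τ) (y' τ)‖ ^ 2 ∂(tapeMeasure P m' p.m)
        ≤ e + p.ζ / (10 * p.q)) := by
  have hl := A.ell_pos
  have hμ := A.mu_pos
  have hμl := A.mu_le_ell hd
  obtain ⟨κ, hκ⟩ : ∃ κ, κ = ℓ / μ := ⟨_, rfl⟩
  have hκ1 : 1 ≤ κ := by rw [hκ]; exact (one_le_div hμ).2 hμl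
  have hκ0 : 0 < κ := by linarith
  have hζ : 0 < p.ζ := by
    rw [hp]; simp only [params]; positivity
  have hlam : p.lam = 2 / (7 * ℓ) := by rw [hp]; rfl
  have hlam0 : 0 < p.lam := by rw [hlam]; positivity
  have hq : 1 ≤ (p.q : ℝ) := by
    rw [hp]; exact_mod_cast params_q_pos hε
  have hS₂ : 7368 / 175 * κ * (p.q : ℝ) ≤ (p.S₂ : ℝ) := by
    rw [hp, hκ]; exact params_S₂_le
  have hS₂0' : (0 : ℝ) < p.S₂ := by nlinarith [mul_pos hκ0 (zero_lt_one.trans_le hq)]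
  have hS₂0 : 0 < p.S₂ := by exact_mod_cast hS₂0'
  have hm : 28 * κ - 1 ≤ (p.m : ℝ) := by rw [hp, hκ]; exact Nat.le_ceil _
  have hm' : (p.m : ℝ) ≤ 28 * κ := by
    rw [hp, hκ]
    have := (Nat.ceil_lt_add_one (a := 28 * (ℓ / μ) - 1) (by rw [← hκ]; linarith)).le
    simpa [params] using this
  have hρ : ℓ ^ 2 * p.lam ^ 2 / p.S₂ = 4 / 49 / p.S₂ := by rw [hlam]; field_simp; norm_num
  have hr : ℓ ^ 2 * (p.ζ / (25 * ℓ ^ 2)) / p.S₂ = p.ζ / 25 / p.S₂ := by field_simp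
  have hlaml : 1 - p.lam * ℓ = 5 / 7 := by rw [hlam]; field_simp; norm_num
  have hlamμ : ∀ a : ℝ, a / (p.lam * μ) = 7 / 2 * κ * a := by
    intro a; rw [hlam, hκ]; field_simp
  have L := I.ascentLoop A p
  have hMx' := I.measurable.2.1
  have hL0 := I.integral_sq_first_update_le (m' := m') (m := p.m) A hS₂0 A.oracleY
    I.measurable.2.2.2.2 (I.free_u 0) hui hx
  have hV0 := I.integral_sq_first_update_le (m' := m') (m := p.m) A hS₂0 A.oracleX
    I.measurable.2.2.2.1 (I.free_v 0) hvi hx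
  rw [hr] at hL0 hV0
  have hA0m : Measurable (fun τ => objGradY P F (x' τ) (y τ)) :=
    A.oracleY.measurable_field hl.le hMx' I.measurable.2.2.1
  have hA0b : ∀ τ, ‖objGradY P F (x' τ) (y τ)‖ ^ 2
      ≤ 2 * ‖objGradY P F (x τ) (y τ)‖ ^ 2 + 2 * (p.ζ / 25) := by
    intro τ
    have e1 := A.oracleY.norm_sub_le_left hl.le (x' τ) (x τ) (y τ)
    have e2 := norm_le_norm_add_norm_sub' (objGradY P F (x' τ) (y τ)) (objGradY P F (x τ) (y τ))
    have e3 : (ℓ * ‖x' τ - x τ‖) ^ 2 ≤ p.ζ / 25 := by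
      rw [mul_pow]
      calc ℓ ^ 2 * ‖x' τ - x τ‖ ^ 2 ≤ ℓ ^ 2 * (p.ζ / (25 * ℓ ^ 2)) := by gcongr; exact hx τ
        _ = p.ζ / 25 := by field_simp
    have e4 := pow_le_pow_left₀ (norm_nonneg _) (e2.trans (add_le_add_right e1 _)) 2
    nlinarith [sq_nonneg (‖objGradY P F (x τ) (y τ)‖ - ℓ * ‖x' τ - x τ‖)]
  have hA0s : Integrable (fun τ => 2 * ‖objGradY P F (x τ) (y τ)‖ ^ 2 + 2 * (p.ζ / 25))
      (tapeMeasure P m' p.m) := (hyi.const_mul 2).add (integrable_const _)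
  have hA0i : Integrable (fun τ => ‖objGradY P F (x' τ) (y τ)‖ ^ 2) (tapeMeasure P m' p.m) :=
    hA0s.mono'
      (hA0m.norm.pow_const 2).aestronglyMeasurable (Filter.Eventually.of_forall fun τ => by
        rw [Real.norm_of_nonneg (by positivity)]; exact hA0b τ)
  have hA0 : ∫ τ, ‖objGradY P F (x' τ) (y τ)‖ ^ 2 ∂(tapeMeasure P m' p.m)
      ≤ 2 * p.ζ + 2 * (p.ζ / 25) := by
    have := integral_mono hA0i hA0s hA0b
    rw [integral_add (hyi.const_mul 2) (integrable_const _), integral_const_mul] at this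
    simp only [integral_const, probReal_univ, smul_eq_mul, one_mul] at this
    linarith
  have hint := fun t => L.integrable (m' := m') (m := p.m) A hlam0.le hS₂0 hA0i hL0.1 t
  have hsum := L.sum_integral_le (m' := m') (m := p.m) A hlam0 hS₂0 hA0i hL0.1 (p.m + 2)
  have hgrow := fun t => (L.integral_sq_estimator_le (m' := m') (m := p.m) A hS₂0 A.oracleY t
    (L.update t) (L.measurable A t).2 (L.free_u t) (hint t).2.1 (hint t).2.2).2
  have hvstep := fun t hi => L.integral_sq_estimator_le (m' := m') (m := p.m) A hS₂0 A.oracleX t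
    (v := fun τ => (concaveMaximizer F p τ.1 k (x τ) (x' τ) (y τ) (v τ) (u τ) t).v)
    (v' := fun τ => (concaveMaximizer F p τ.1 k (x τ) (x' τ) (y τ) (v τ) (u τ) (t + 1)).v)
    (fun τ => rfl) (I.measurable_v A p t)
    (fun i τ z => congrArg InnerState.v (I.freeOfSample_state F p t.lt_succ_self τ z)) hi
    (hint t).2.2
  have hvint : ∀ t, Integrable (fun τ =>
      ‖(concaveMaximizer F p τ.1 k (x τ) (x' τ) (y τ) (v τ) (u τ) t).v - objGradX P F (x' τ)
        (concaveMaximizer F p τ.1 k (x τ) (x' τ) (y τ) (v τ) (u τ) t).y‖ ^ 2)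
      (tapeMeasure P m' p.m) := by
    intro t
    induction t with
    | zero => exact hV0.1
    | succ t ih => exact (hvstep t ih).1
  have hvgrow := fun t => (hvstep t (hvint t)).2
  clear hvstep
  rw [hlaml] at hsum
  rw [hlamμ] at hsum
  simp only [hρ] at hgrow hvgrow
  have hfun : ∀ t τ, concaveMaximizer F p τ.1 k (x τ) (x' τ) (y τ) (v τ) (u τ) t = R t τ := by
    intro t τ; rw [hR]
  have hy0 : ∀ τ, (R 0 τ).y = y τ := by intro τ; rw [hR]; rfl
  have hu0 : ∀ τ, (R 0 τ).u = u τ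
      + batchMean p.S₂ (fun i => gradY F (x' τ) (y τ) (τ.1 (.small k 0 i)))
      - batchMean p.S₂ (fun i => gradY F (x τ) (y τ) (τ.1 (.small k 0 i))) := by
    intro τ; rw [hR]; rfl
  have hv0 : ∀ τ, (R 0 τ).v = v τ
      + batchMean p.S₂ (fun i => gradX F (x' τ) (y τ) (τ.1 (.small k 0 i)))
      - batchMean p.S₂ (fun i => gradX F (x τ) (y τ) (τ.1 (.small k 0 i))) := by
    intro τ; rw [hR]; rfl
  have hMy : ∀ t, Measurable (fun τ => (R t τ).y) := by
    intro t; have := (L.measurable A t).1; simpa only [hfun] using this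
  have hMu : ∀ t, Measurable (fun τ => (R t τ).u) := by
    intro t; have := (L.measurable A t).2; simpa only [hfun] using this
  have hMv : ∀ t, Measurable (fun τ => (R t τ).v) := by
    intro t; have := I.measurable_v A p t; simpa only [hfun] using this
  have hCR : ∀ t, FreeOfChoice (.inner k) (R t) := by
    intro t; have := I.freeOfChoice_state F p t; rw [hR]; exact this
  simp only [hfun] at hint hsum hgrow hvint hvgrow
  clear L hfun hR
  -- The three sequences of mean squares of the loop.
  set SA : ℕ → ℝ := fun t => ∫ τ, ‖objGradY P F (x' τ) (R t τ).y‖ ^ 2 ∂(tapeMeasure P m' p.m)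
    with hSA
  set SU : ℕ → ℝ := fun t => ∫ τ, ‖(R t τ).u‖ ^ 2 ∂(tapeMeasure P m' p.m) with hSU
  set EU : ℕ → ℝ := fun t => ∫ τ, ‖(R t τ).u - objGradY P F (x' τ) (R t τ).y‖ ^ 2
    ∂(tapeMeasure P m' p.m) with hEU
  set EX : ℕ → ℝ := fun t => ∫ τ, ‖(R t τ).v - objGradX P F (x' τ) (R t τ).y‖ ^ 2
    ∂(tapeMeasure P m' p.m) with hEX
  have hSA0 : ∀ t, 0 ≤ SA t := fun t => integral_nonneg fun τ => by positivity
  have hSU0 : ∀ t, 0 ≤ SU t := fun t => integral_nonneg fun τ => by positivity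
  have hEU0 : EU 0 ≤ e + p.ζ / 25 / p.S₂ := by
    have := hL0.2
    simp only [hEU, hu0, hy0]
    linarith
  have hEX0 : EX 0 ≤ e + p.ζ / 25 / p.S₂ := by
    have := hV0.2
    simp only [hEX, hv0, hy0]
    linarith
  have hSAz : SA 0 ≤ 2 * p.ζ + 2 * (p.ζ / 25) := by
    simp only [hSA, hy0]; exact hA0
  have hρ0 : 0 ≤ 4 / 49 / (p.S₂ : ℝ) := by positivity
  -- The accumulated errors use up `3 / 14` of the weight `1 - λ ℓ = 5 / 7` of the squared
  -- directions, which leaves `1 / 2`.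
  have hNρ : ((p.m + 2 : ℕ) : ℝ) * (4 / 49 / (p.S₂ : ℝ)) ≤ 3 / 14 := by
    rw [← mul_div_assoc, div_le_iff₀ hS₂0']
    push_cast
    nlinarith
  have habs := sum_le_of_error_growth hSU0 hρ0 hgrow hsum hNρ
  have harith := inner_loop_arith (m := p.m) (A₀ := SA 0) (E₀ := EU 0)
    (SA := ∑ t ∈ Finset.range (p.m + 2), SA t) (S := ∑ t ∈ Finset.range (p.m + 2), SU t)
    hκ1 hq hS₂ hm hm' hζ hSAz (by linarith)
    (Finset.sum_nonneg fun t _ => hSA0 t) (Finset.sum_nonneg fun t _ => hSU0 t)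
    (by push_cast at habs; norm_num at habs ⊢; linarith)
  have hm1 : (0 : ℝ) < (p.m : ℝ) + 1 := by positivity
  have hc : choiceBound m' p.m (.inner k) = p.m := rfl
  have havg : ∀ {E : ℕ → ℝ}, (∀ t, E (t + 1) ≤ E t + 4 / 49 / (p.S₂ : ℝ) * SU t) →
      E 0 ≤ e + p.ζ / 25 / p.S₂ →
      ((p.m : ℝ) + 1)⁻¹ * ∑ s ∈ Finset.range (p.m + 1), E (s + 1) ≤ e + p.ζ / (10 * p.q) := by
    intro E hE hE0
    rw [inv_mul_le_iff₀ hm1]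
    have := Finset.sum_le_card_nsmul (Finset.range (p.m + 1)) (fun s => E (s + 1))
      (e + p.ζ / (10 * p.q)) (fun s hs => by
        have := le_add_sum_of_error_growth hSU0 hρ0 hE (N := p.m + 2) (t := s + 1)
          (by have := Finset.mem_range.1 hs; omega)
        linarith [harith.2])
    rw [Finset.card_range, nsmul_eq_mul] at this
    push_cast at this
    exact this
  refine ⟨?_, ?_, ?_⟩
  · have h := integrable_integral_eq_of_choice (P := P) (m' := m') (m := p.m) (j := .inner k)
      (φ := fun s τ => ‖objGradY P F (x' τ) (R (s + 1) τ).y‖ ^ 2)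
      (fun s => (A.oracleY.measurable_field hl.le hMx' (hMy _)).norm.pow_const 2)
      (fun s τ => by positivity) (fun s τ c => by simp only; rw [I.choice_x' τ c, hCR _ τ c])
      (fun s _ => (hint (s + 1)).1)
    rw [hc] at h
    simp only [hy']
    refine ⟨h.1, h.2.trans_le (le_trans ?_ harith.1)⟩
    gcongr
    rw [Finset.sum_range_succ' SA (p.m + 1)]
    linarith [hSA0 0]
  · have h := integrable_integral_eq_of_choice (P := P) (m' := m') (m := p.m) (j := .inner k)
      (φ := fun s τ => ‖(R (s + 1) τ).v - objGradX P F (x' τ) (R (s + 1) τ).y‖ ^ 2)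
      (fun s => ((hMv _).sub (A.oracleX.measurable_field hl.le hMx' (hMy _))).norm.pow_const 2)
      (fun s τ => by positivity) (fun s τ c => by simp only; rw [I.choice_x' τ c, hCR _ τ c])
      (fun s _ => hvint (s + 1))
    rw [hc] at h
    simp only [hy', hv']
    exact ⟨h.1, h.2.trans_le (havg hvgrow hEX0)⟩
  · have h := integrable_integral_eq_of_choice (P := P) (m' := m') (m := p.m) (j := .inner k)
      (φ := fun s τ => ‖(R (s + 1) τ).u - objGradY P F (x' τ) (R (s + 1) τ).y‖ ^ 2)
      (fun s => ((hMu _).sub (A.oracleY.measurable_field hl.le hMx' (hMy _))).norm.pow_const 2)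
      (fun s τ => by positivity) (fun s τ c => by simp only; rw [I.choice_x' τ c, hCR _ τ c])
      (fun s _ => (hint (s + 1)).2.1)
    rw [hc] at h
    simp only [hy', hu']
    exact ⟨h.1, h.2.trans_le (havg hgrow hEU0)⟩

end Maximizer

/-! ### The main loop -/

section Main

variable {d₁ d₂ : ℕ} {Ξ : Type*}

/-- The estimate of `∇ₓ f(x_k, y_k)` used in iteration `k`. -/
def stepV (F : Vec d₁ → Vec d₂ → Ξ → ℝ) (p : Params) (ξ : SampleId → Ξ) (k : ℕ)
    (S : State d₁ d₂) : Vec d₁ :=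
  if k % p.q = 0 then batchMean p.S₁ (fun i => gradX F S.x S.y (ξ (.large k i))) else S.v

/-- The estimate of `∇_y f(x_k, y_k)` used in iteration `k`. -/
def stepU (F : Vec d₁ → Vec d₂ → Ξ → ℝ) (p : Params) (ξ : SampleId → Ξ) (k : ℕ)
    (S : State d₁ d₂) : Vec d₂ :=
  if k % p.q = 0 then batchMean p.S₁ (fun i => gradY F S.x S.y (ξ (.large k i))) else S.u

theorem sredaStep_congr {F : Vec d₁ → Vec d₂ → Ξ → ℝ} {p : Params} {ξ ξ' : SampleId → Ξ}
    {c c' : ChoiceId → ℕ} {k : ℕ} {S : State d₁ d₂}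
    (h₁ : ∀ i, ξ (.large k i) = ξ' (.large k i))
    (h₂ : ∀ t i, ξ (.small k t i) = ξ' (.small k t i)) (h₃ : c (.inner k) = c' (.inner k)) :
    sredaStep F p ξ c k S = sredaStep F p ξ' c' k S := by
  have h : ∀ x x' : Vec d₁, ∀ (y : Vec d₂) v u, concaveMaximizer F p ξ k x x' y v u
      = concaveMaximizer F p ξ' k x x' y v u := fun x x' y v u =>
    funext fun t => concaveMaximizer_congr fun t' _ i => h₂ t' i
  simp only [sredaStep, h₁, h₃, h]

theorem sreda_congr {F : Vec d₁ → Vec d₂ → Ξ → ℝ} {J : ISarahParams} {p : Params}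
    {ξ ξ' : SampleId → Ξ} {c c' : ChoiceId → ℕ} {x₀ : Vec d₁} {w₀ : Vec d₂} {k : ℕ}
    (hb : ∀ s i, ξ (.initBatch s i) = ξ' (.initBatch s i))
    (hs : ∀ s t, ξ (.initStep s t) = ξ' (.initStep s t))
    (hc : ∀ s, c (.init s) = c' (.init s))
    (h₁ : ∀ j < k, ∀ i, ξ (.large j i) = ξ' (.large j i))
    (h₂ : ∀ j < k, ∀ t i, ξ (.small j t i) = ξ' (.small j t i))
    (h₃ : ∀ j < k, c (.inner j) = c' (.inner j)) :
    sreda F J p ξ c x₀ w₀ k = sreda F J p ξ' c' x₀ w₀ k := by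
  induction k with
  | zero =>
    have e1 : (sredaInit F J ξ c x₀ w₀).1 = (sredaInit F J ξ' c' x₀ w₀).1 :=
      iSarah_congr (fun s _ => hb s) (fun s _ => hs s) fun s _ => hc s
    have e2 : (sredaInit F J ξ c x₀ w₀).2 = (sredaInit F J ξ' c' x₀ w₀).2 := by
      simp only [sredaInit, iSarah_evals]
    simp only [sreda, e1, e2]
  | succ k ih =>
    simp only [sreda]
    rw [ih (fun j hj => h₁ j (hj.trans k.lt_succ_self)) (fun j hj => h₂ j (hj.trans k.lt_succ_self))
      (fun j hj => h₃ j (hj.trans k.lt_succ_self)),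
      sredaStep_congr (h₁ k k.lt_succ_self) (h₂ k k.lt_succ_self) (h₃ k k.lt_succ_self)]

theorem freeOfSample_sreda_small (F : Vec d₁ → Vec d₂ → Ξ → ℝ) (J : ISarahParams) (p : Params)
    (x₀ : Vec d₁) (w₀ : Vec d₂) (k t i : ℕ) :
    FreeOfSample (.small k t i) (fun τ : Tape Ξ => sreda F J p τ.1 τ.2 x₀ w₀ k) := fun _ _ =>
  sreda_congr (fun _ _ => setSample_apply_of_ne _ _ (by simp))
    (fun _ _ => setSample_apply_of_ne _ _ (by simp)) (fun _ => rfl)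
    (fun _ _ _ => setSample_apply_of_ne _ _ (by simp))
    (fun j hj _ _ => setSample_apply_of_ne _ _ fun h => by injection h; omega)
    (fun _ _ => rfl)

theorem freeOfSample_sreda_large (F : Vec d₁ → Vec d₂ → Ξ → ℝ) (J : ISarahParams) (p : Params)
    (x₀ : Vec d₁) (w₀ : Vec d₂) (k i : ℕ) :
    FreeOfSample (.large k i) (fun τ : Tape Ξ => sreda F J p τ.1 τ.2 x₀ w₀ k) := fun _ _ =>
  sreda_congr (fun _ _ => setSample_apply_of_ne _ _ (by simp))
    (fun _ _ => setSample_apply_of_ne _ _ (by simp)) (fun _ => rfl)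
    (fun j hj _ => setSample_apply_of_ne _ _ fun h => by injection h; omega)
    (fun _ _ _ _ => setSample_apply_of_ne _ _ (by simp)) (fun _ _ => rfl)

theorem freeOfChoice_sreda (F : Vec d₁ → Vec d₂ → Ξ → ℝ) (J : ISarahParams) (p : Params)
    (x₀ : Vec d₁) (w₀ : Vec d₂) (k : ℕ) :
    FreeOfChoice (.inner k) (fun τ : Tape Ξ => sreda F J p τ.1 τ.2 x₀ w₀ k) := fun _ _ =>
  sreda_congr (fun _ _ => rfl) (fun _ _ => rfl)
    (fun _ => setChoice_apply_of_ne _ _ (by simp)) (fun _ _ _ => rfl) (fun _ _ _ _ => rfl)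
    (fun j hj => setChoice_apply_of_ne _ _ fun h => by injection h; omega)

theorem sreda_evals (F : Vec d₁ → Vec d₂ → Ξ → ℝ) (J : ISarahParams) (p : Params)
    (ξ : SampleId → Ξ) (c : ChoiceId → ℕ) (x₀ : Vec d₁) (w₀ : Vec d₂) (k : ℕ) :
    (sreda F J p ξ c x₀ w₀ k).evals = J.T * (J.b + 2 * (J.m' - 1))
      + (∑ j ∈ Finset.range k, if j % p.q = 0 then p.S₁ else 0)
      + k * (2 * p.S₂ * (p.m + 2)) := by
  induction k with
  | zero => simp [sreda, sredaInit, iSarah_evals]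
  | succ k ih =>
    simp only [sreda, sredaStep, concaveMaximizer_evals, ih, Finset.sum_range_succ]
    ring

/-- The step length is at most `ε / (5 κ ℓ)`. -/
theorem norm_step_sq_le {ℓ μ σ ε : ℝ} (hl : 0 < ℓ) (hμ : 0 < μ) (hε : 0 < ε) (v : Vec d₁) :
    ‖(params ℓ μ σ ε).η ‖v‖ • v‖ ^ 2 ≤ (params ℓ μ σ ε).ζ / (25 * ℓ ^ 2) := by
  have h : ‖(params ℓ μ σ ε).η ‖v‖ • v‖ ≤ ε / (5 * (ℓ / μ) * ℓ) := by
    simp only [params]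
    rcases (norm_nonneg v).eq_or_lt with h0 | h0
    · have : v = 0 := norm_eq_zero.1 h0.symm
      rw [this, smul_zero, norm_zero]; positivity
    · rw [norm_smul, Real.norm_of_nonneg (by positivity)]
      calc min (ε / (5 * (ℓ / μ) * ℓ * ‖v‖)) (1 / (10 * (ℓ / μ) * ℓ)) * ‖v‖
          ≤ ε / (5 * (ℓ / μ) * ℓ * ‖v‖) * ‖v‖ := by gcongr; exact min_le_left _ _
        _ = ε / (5 * (ℓ / μ) * ℓ) := by field_simp
  calc ‖(params ℓ μ σ ε).η ‖v‖ • v‖ ^ 2 ≤ (ε / (5 * (ℓ / μ) * ℓ)) ^ 2 := by gcongr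
    _ = _ := by simp only [params]; field_simp; norm_num

/-- Descent of the primal function in one step along an inexact gradient `v`. The step size
interpolates between a normalized and a plain gradient step, which is why the gradient norm itself,
and not its square, is controlled. -/
theorem Phi_step_le [MeasurableSpace Ξ] {P : Measure Ξ} [IsProbabilityMeasure P]
    {F : Vec d₁ → Vec d₂ → Ξ → ℝ} {ℓ μ σ : ℝ} (A : Assumptions P F ℓ μ σ) (hd : 0 < d₂)
    {ε : ℝ} (hε : 0 < ε) (x v : Vec d₁) :
    Phi P F (x - (params ℓ μ σ ε).η ‖v‖ • v)
        + 1 / (20 * (ℓ / μ) * ℓ) * (ε * ‖gradient (Phi P F) x‖)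
      ≤ Phi P F x + 1 / (40 * (ℓ / μ) * ℓ)
        * (2 * ε ^ 2 + 3 * ‖gradient (Phi P F) x - v‖ ^ 2) := by
  have hl := A.ell_pos
  have hμ := A.mu_pos
  obtain ⟨κ, hκ⟩ : ∃ κ, κ = ℓ / μ := ⟨_, rfl⟩
  have hκ1 : 1 ≤ κ := by rw [hκ]; exact (one_le_div hμ).2 (A.mu_le_ell hd)
  have hκ0 : 0 < κ := by linarith
  obtain ⟨c, hc⟩ : ∃ c, c = 1 / (10 * κ * ℓ) := ⟨_, rfl⟩
  have hc0 : 0 < c := by rw [hc]; positivity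
  have hcl : c * (κ * ℓ) = 1 / 10 := by rw [hc]; field_simp
  rw [← hκ, show 1 / (20 * κ * ℓ) = c / 2 by rw [hc]; field_simp; norm_num,
    show 1 / (40 * κ * ℓ) = c / 4 by rw [hc]; field_simp; norm_num]
  set r := ‖v‖ with hr
  set g := gradient (Phi P F) x with hg
  set η := (params ℓ μ σ ε).η r with hη
  have hr0 : 0 ≤ r := norm_nonneg v
  have hη_def : η = min (ε / (5 * κ * ℓ * r)) c := by rw [hη, hc, hκ]; rfl
  have hηc : η ≤ c := by rw [hη_def]; exact min_le_right _ _
  have hη0 : 0 ≤ η := by rw [hη_def]; exact le_min (by positivity) hc0.le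
  -- The step size is chosen so that `η r² = c min(2 ε r, r²)`.
  have hηr : c * (2 * ε * r - ε ^ 2) ≤ η * r ^ 2 := by
    rcases hr0.eq_or_lt with h0 | h0
    · rw [← h0]; nlinarith [sq_nonneg ε]
    · rcases min_choice (ε / (5 * κ * ℓ * r)) c with h | h
      · rw [hη_def, h]
        have : ε / (5 * κ * ℓ * r) * r ^ 2 = c * (2 * ε * r) := by rw [hc]; field_simp; norm_num
        rw [this]; nlinarith [sq_nonneg ε]
      · rw [hη_def, h]; nlinarith [sq_nonneg (r - ε)]
  have h1 := A.Phi_le_linear x (x - η • v)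
  rw [← A.gradient_Phi, ← hg, show x - η • v - x = -(η • v) by abel, inner_neg_right,
    inner_smul_right, norm_neg, norm_smul, Real.norm_of_nonneg hη0, ← hr, ← hκ] at h1
  have h2 := norm_sub_sq_real g v
  rw [← hr] at h2
  have h3 : r ≥ ‖g‖ - ‖g - v‖ := by
    have := norm_le_norm_add_norm_sub' g v
    linarith
  set e := ‖g - v‖ with he
  have h4 : ℓ * (3 / 2 + κ) * (η * r) ^ 2 ≤ η * r ^ 2 / 4 := by
    have e1 : ℓ * (3 / 2 + κ) ≤ 5 / 2 * (κ * ℓ) := by nlinarith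
    have e2 : ℓ * (3 / 2 + κ) * η ≤ 1 / 4 := by
      calc ℓ * (3 / 2 + κ) * η ≤ 5 / 2 * (κ * ℓ) * c := by gcongr
        _ = 1 / 4 := by linarith
    have e3 : 0 ≤ η * r ^ 2 := by positivity
    nlinarith
  have h5 : η * inner ℝ g v = η / 2 * (‖g‖ ^ 2 + r ^ 2 - e ^ 2) := by rw [h2]; ring
  have h6 : 0 ≤ η * ‖g‖ ^ 2 := by positivity
  have h7 : η * e ^ 2 ≤ c * e ^ 2 := by gcongr
  have h8 : Phi P F (x - η • v) ≤ Phi P F x - c / 4 * (2 * ε * r - ε ^ 2) + c / 2 * e ^ 2 := by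
    linarith
  have h9 : 2 * ε * ‖g‖ - 2 * ε ^ 2 - e ^ 2 ≤ 2 * ε * r - ε ^ 2 := by
    nlinarith [sq_nonneg (ε - e)]
  have h10 := mul_le_mul_of_nonneg_left h9 (by positivity : 0 ≤ c / 4)
  linarith

variable [MeasurableSpace Ξ] {P : Measure Ξ} [IsProbabilityMeasure P]
  {m' : ℕ} {F : Vec d₁ → Vec d₂ → Ξ → ℝ} {ℓ μ σ ε : ℝ}

/-- What holds at the start of iteration `k` of a run with the prescribed parameters. Between two
large batches the error bound of the gradient estimates increases linearly. -/
structure RunInvariant (P : Measure Ξ) (F : Vec d₁ → Vec d₂ → Ξ → ℝ) (p : Params) (m' k : ℕ)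
    (S : Tape Ξ → State d₁ d₂) : Prop where
  measurable_x : Measurable (fun τ => (S τ).x)
  measurable_y : Measurable (fun τ => (S τ).y)
  measurable_v : Measurable (fun τ => (S τ).v)
  measurable_u : Measurable (fun τ => (S τ).u)
  grad : Integrable (fun τ => ‖objGradY P F (S τ).x (S τ).y‖ ^ 2) (tapeMeasure P m' p.m) ∧
    ∫ τ, ‖objGradY P F (S τ).x (S τ).y‖ ^ 2 ∂(tapeMeasure P m' p.m) ≤ p.ζ
  error_v : k % p.q ≠ 0 →
    Integrable (fun τ => ‖(S τ).v - objGradX P F (S τ).x (S τ).y‖ ^ 2) (tapeMeasure P m' p.m) ∧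
    ∫ τ, ‖(S τ).v - objGradX P F (S τ).x (S τ).y‖ ^ 2 ∂(tapeMeasure P m' p.m)
      ≤ p.ζ / 24 + (k % p.q : ℕ) * (p.ζ / (10 * p.q))
  error_u : k % p.q ≠ 0 →
    Integrable (fun τ => ‖(S τ).u - objGradY P F (S τ).x (S τ).y‖ ^ 2) (tapeMeasure P m' p.m) ∧
    ∫ τ, ‖(S τ).u - objGradY P F (S τ).x (S τ).y‖ ^ 2 ∂(tapeMeasure P m' p.m)
      ≤ p.ζ / 24 + (k % p.q : ℕ) * (p.ζ / (10 * p.q))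

omit [IsProbabilityMeasure P] in
theorem params_variance_le (A : Assumptions P F ℓ μ σ) (hε : 0 < ε) :
    0 < (params ℓ μ σ ε).S₁ ∧ σ ^ 2 / (params ℓ μ σ ε).S₁ ≤ (params ℓ μ σ ε).ζ / 24 := by
  have hl := A.ell_pos
  have hμ := A.mu_pos
  have hσ := A.sigma_pos
  have h : 24 * σ ^ 2 * (ℓ / μ) ^ 2 * ε⁻¹ ^ 2 ≤ ((params ℓ μ σ ε).S₁ : ℝ) := Nat.le_ceil _
  have h0 : 0 < 24 * σ ^ 2 * (ℓ / μ) ^ 2 * ε⁻¹ ^ 2 := by positivity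
  have hS : (0 : ℝ) < (params ℓ μ σ ε).S₁ := h0.trans_le h
  refine ⟨by exact_mod_cast hS, ?_⟩
  rw [div_le_iff₀ hS]
  have hζ : 0 < (params ℓ μ σ ε).ζ := by simp only [params]; positivity
  calc σ ^ 2 = (params ℓ μ σ ε).ζ / 24 * (24 * σ ^ 2 * (ℓ / μ) ^ 2 * ε⁻¹ ^ 2) := by
        simp only [params]; field_simp
    _ ≤ _ := by gcongr

/-- The estimators used in iteration `k`, after a possible large batch. -/
theorem RunInvariant.step_error {k : ℕ} {S : Tape Ξ → State d₁ d₂} {p : Params}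
    (R : RunInvariant P F p m' k S) (A : Assumptions P F ℓ μ σ) (hε : 0 < ε)
    (hp : p = params ℓ μ σ ε) (hS : ∀ i, FreeOfSample (.large k i) S) :
    (Measurable (fun τ => stepV F p τ.1 k (S τ)) ∧
      Integrable (fun τ => ‖stepV F p τ.1 k (S τ) - objGradX P F (S τ).x (S τ).y‖ ^ 2)
        (tapeMeasure P m' p.m) ∧
      ∫ τ, ‖stepV F p τ.1 k (S τ) - objGradX P F (S τ).x (S τ).y‖ ^ 2 ∂(tapeMeasure P m' p.m)
        ≤ p.ζ / 24 + (k % p.q : ℕ) * (p.ζ / (10 * p.q))) ∧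
    (Measurable (fun τ => stepU F p τ.1 k (S τ)) ∧
      Integrable (fun τ => ‖stepU F p τ.1 k (S τ) - objGradY P F (S τ).x (S τ).y‖ ^ 2)
        (tapeMeasure P m' p.m) ∧
      ∫ τ, ‖stepU F p τ.1 k (S τ) - objGradY P F (S τ).x (S τ).y‖ ^ 2 ∂(tapeMeasure P m' p.m)
        ≤ p.ζ / 24 + (k % p.q : ℕ) * (p.ζ / (10 * p.q))) := by
  by_cases hk : k % p.q = 0
  · obtain ⟨hS₁, hvar⟩ := params_variance_le A hε
    rw [← hp] at hS₁ hvar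
    have hx := fun i => fun τ z => congrArg State.x (hS i τ z)
    have hy := fun i => fun τ z => congrArg State.y (hS i τ z)
    have h1 := A.oracleX.integral_sq_batchMean_sub_le (m' := m') (m := p.m) A.ell_pos.le hS₁
      (lab := fun i => .large k i) (fun i j h => by simpa using h)
      R.measurable_x R.measurable_y hx hy
    have h2 := A.oracleY.integral_sq_batchMean_sub_le (m' := m') (m := p.m) A.ell_pos.le hS₁
      (lab := fun i => .large k i) (fun i j h => by simpa using h)
      R.measurable_x R.measurable_y hx hy
    simp only [stepV, stepU, if_pos hk]
    simp only [hk, Nat.cast_zero, zero_mul, add_zero]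
    exact ⟨⟨A.oracleX.measurable_batchMean R.measurable_x R.measurable_y _ _, h1.1,
      h1.2.trans hvar⟩, ⟨A.oracleY.measurable_batchMean R.measurable_x R.measurable_y _ _, h2.1,
      h2.2.trans hvar⟩⟩
  · simp only [stepV, stepU, if_neg hk]
    exact ⟨⟨R.measurable_v, R.error_v hk⟩, ⟨R.measurable_u, R.error_u hk⟩⟩

theorem error_bound_le {p : Params} (hζ : 0 < p.ζ) (hq : 0 < p.q) (k : ℕ) :
    p.ζ / 24 + (k % p.q : ℕ) * (p.ζ / (10 * p.q)) ≤ 17 / 120 * p.ζ := by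
  have h1 : ((k % p.q : ℕ) : ℝ) ≤ p.q := by exact_mod_cast (Nat.mod_lt k hq).le
  have hq' : (0 : ℝ) < p.q := by exact_mod_cast hq
  have h2 : ((k % p.q : ℕ) : ℝ) * (p.ζ / (10 * p.q)) ≤ p.q * (p.ζ / (10 * p.q)) := by gcongr
  have h3 : p.q * (p.ζ / (10 * p.q)) = p.ζ / 10 := by field_simp
  linarith

omit [IsProbabilityMeasure P] in
theorem params_zeta_pos (A : Assumptions P F ℓ μ σ) (hε : 0 < ε) : 0 < (params ℓ μ σ ε).ζ := by
  have hl := A.ell_pos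
  have hμ := A.mu_pos
  simp only [params]; positivity

omit [IsProbabilityMeasure P] in
theorem measurable_params_step {α : Type*} [MeasurableSpace α] {v : α → Vec d₁}
    (hv : Measurable v) : Measurable (fun τ => (params ℓ μ σ ε).η ‖v τ‖ • v τ) := by
  have : Measurable (params ℓ μ σ ε).η := by
    simp only [params]
    exact ((measurable_id.const_mul _).const_div _).min measurable_const
  exact (this.comp hv.norm).smul hv

theorem maximizerInput_sreda (A : Assumptions P F ℓ μ σ) (hε : 0 < ε) (J : ISarahParams)
    {x₀ : Vec d₁} {w₀ : Vec d₂} {p : Params} (hp : p = params ℓ μ σ ε) {k : ℕ}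
    (R : RunInvariant P F p m' k (fun τ : Tape Ξ => sreda F J p τ.1 τ.2 x₀ w₀ k)) :
    MaximizerInput k (fun τ : Tape Ξ => (sreda F J p τ.1 τ.2 x₀ w₀ k).x)
      (fun τ => (sreda F J p τ.1 τ.2 x₀ w₀ (k + 1)).x)
      (fun τ => (sreda F J p τ.1 τ.2 x₀ w₀ k).y)
      (fun τ => stepV F p τ.1 k (sreda F J p τ.1 τ.2 x₀ w₀ k))
      (fun τ => stepU F p τ.1 k (sreda F J p τ.1 τ.2 x₀ w₀ k)) := by
  have hS := freeOfSample_sreda_small F J p x₀ w₀ k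
  have hC := freeOfChoice_sreda F J p x₀ w₀ k
  have hV : ∀ t i, FreeOfSample (.small k t i)
      (fun τ : Tape Ξ => stepV F p τ.1 k (sreda F J p τ.1 τ.2 x₀ w₀ k)) := by
    intro t i τ z
    have h := hS t i τ z
    simp only at h ⊢
    rw [h]
    simp only [stepV, setSample_apply_of_ne τ z (l := .small k t i) (l' := .large k _) (by simp)]
  have hU : ∀ t i, FreeOfSample (.small k t i)
      (fun τ : Tape Ξ => stepU F p τ.1 k (sreda F J p τ.1 τ.2 x₀ w₀ k)) := by
    intro t i τ z
    have h := hS t i τ z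
    simp only at h ⊢
    rw [h]
    simp only [stepU, setSample_apply_of_ne τ z (l := .small k t i) (l' := .large k _) (by simp)]
  have hVC : FreeOfChoice (.inner k)
      (fun τ : Tape Ξ => stepV F p τ.1 k (sreda F J p τ.1 τ.2 x₀ w₀ k)) := by
    intro τ z
    have h := hC τ z
    simp only at h ⊢
    rw [h]; rfl
  have hUC : FreeOfChoice (.inner k)
      (fun τ : Tape Ξ => stepU F p τ.1 k (sreda F J p τ.1 τ.2 x₀ w₀ k)) := by
    intro τ z
    have h := hC τ z
    simp only at h ⊢
    rw [h]; rfl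
  have hx' : ∀ τ : Tape Ξ, (sreda F J p τ.1 τ.2 x₀ w₀ (k + 1)).x
      = (sreda F J p τ.1 τ.2 x₀ w₀ k).x
        - p.η ‖stepV F p τ.1 k (sreda F J p τ.1 τ.2 x₀ w₀ k)‖
          • stepV F p τ.1 k (sreda F J p τ.1 τ.2 x₀ w₀ k) := fun τ => rfl
  have hstep := R.step_error A hε hp (freeOfSample_sreda_large F J p x₀ w₀ k)
  refine ⟨⟨R.measurable_x, ?_, R.measurable_y, hstep.1.1, hstep.2.1⟩,
    fun t i τ z => congrArg State.x (hS t i τ z), fun t i τ z => ?_,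
    fun t i τ z => congrArg State.y (hS t i τ z), hV, hU,
    fun τ z => congrArg State.x (hC τ z), fun τ z => ?_,
    fun τ z => congrArg State.y (hC τ z), hVC, hUC⟩
  · simp only [hx']
    refine R.measurable_x.sub ?_
    have := measurable_params_step (ℓ := ℓ) (μ := μ) (σ := σ) (ε := ε) hstep.1.1
    rwa [← hp] at this
  · have h1 := hS t i τ z
    have h2 := hV t i τ z
    simp only [hx'] at h1 h2 ⊢
    rw [h2, h1]
  · have h1 := hC τ z
    have h2 := hVC τ z
    simp only [hx'] at h1 h2 ⊢
    rw [h2, h1]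

theorem runInvariant_succ (A : Assumptions P F ℓ μ σ) (hd : 0 < d₂) (hε : 0 < ε)
    (J : ISarahParams) {x₀ : Vec d₁} {w₀ : Vec d₂} {p : Params} (hp : p = params ℓ μ σ ε) {k : ℕ}
    (R : RunInvariant P F p m' k (fun τ : Tape Ξ => sreda F J p τ.1 τ.2 x₀ w₀ k)) :
    RunInvariant P F p m' (k + 1) (fun τ : Tape Ξ => sreda F J p τ.1 τ.2 x₀ w₀ (k + 1)) := by
  have I := maximizerInput_sreda A hε J hp R
  have hstep := R.step_error A hε hp (freeOfSample_sreda_large F J p x₀ w₀ k)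
  have hζ : 0 < p.ζ := by rw [hp]; exact params_zeta_pos A hε
  have hq : 0 < p.q := by rw [hp]; exact params_q_pos hε
  have hfin := maximizer_step (m' := m') A hd hε I hp (error_bound_le hζ hq k)
    (fun τ => by
      have : (sreda F J p τ.1 τ.2 x₀ w₀ (k + 1)).x - (sreda F J p τ.1 τ.2 x₀ w₀ k).x
          = -(p.η ‖stepV F p τ.1 k (sreda F J p τ.1 τ.2 x₀ w₀ k)‖
            • stepV F p τ.1 k (sreda F J p τ.1 τ.2 x₀ w₀ k)) := by
        rw [neg_eq_iff_add_eq_zero.2]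
        change _ + (_ - _ • _ - _) = _
        simp only [stepV]
        abel
      rw [this, norm_neg, hp]
      exact norm_step_sq_le A.ell_pos A.mu_pos hε _)
    R.grad.1 R.grad.2 hstep.1.2.1 hstep.1.2.2 hstep.2.2.1 hstep.2.2.2 rfl
    (y' := fun τ => (sreda F J p τ.1 τ.2 x₀ w₀ (k + 1)).y)
    (v' := fun τ => (sreda F J p τ.1 τ.2 x₀ w₀ (k + 1)).v)
    (u' := fun τ => (sreda F J p τ.1 τ.2 x₀ w₀ (k + 1)).u)
    (fun τ => rfl) (fun τ => rfl) (fun τ => rfl)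
  have hmod : (k + 1) % p.q ≠ 0 → (k + 1) % p.q = k % p.q + 1 := by
    intro h
    have h1 := Nat.mod_lt k hq
    have h2 : (k + 1) % p.q = (k % p.q + 1) % p.q := by simp
    rcases (Nat.succ_le_of_lt h1).eq_or_lt with h3 | h3
    · exact absurd (by rw [h2, ← Nat.succ_eq_add_one, h3, Nat.mod_self]) h
    · rw [h2, Nat.mod_eq_of_lt h3]
  have hcomp : ∀ {d : ℕ} {Z : ℕ → Tape Ξ → Vec d}, (∀ t, Measurable (Z t)) →
      Measurable (fun τ : Tape Ξ => Z (τ.2 (.inner k) + 1) τ) := by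
    intro d Z hZ
    have : Measurable (fun q : ℕ × Tape Ξ => Z (q.1 + 1) q.2) :=
      measurable_from_prod_countable_right fun t => hZ (t + 1)
    exact this.comp (f := fun τ : Tape Ξ => (τ.2 (.inner k), τ)) (by fun_prop)
  refine ⟨I.measurable.2.1, hcomp fun t => ((I.ascentLoop A p).measurable A t).1,
    hcomp fun t => I.measurable_v A p t, hcomp fun t => ((I.ascentLoop A p).measurable A t).2,
    hfin.1, fun h => ⟨hfin.2.1.1, hfin.2.1.2.trans_eq ?_⟩,
    fun h => ⟨hfin.2.2.1, hfin.2.2.2.trans_eq ?_⟩⟩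
  all_goals rw [hmod h]; push_cast; ring

theorem runInvariant_sreda (A : Assumptions P F ℓ μ σ) (hd : 0 < d₂) (hε : 0 < ε)
    (J : ISarahParams) (x₀ : Vec d₁) (w₀ : Vec d₂) {p : Params} (hp : p = params ℓ μ σ ε)
    (h0 : Integrable (fun τ : Tape Ξ => ‖objGradY P F x₀ (sredaInit F J τ.1 τ.2 x₀ w₀).1‖ ^ 2)
        (tapeMeasure P m' p.m) ∧
      ∫ τ : Tape Ξ, ‖objGradY P F x₀ (sredaInit F J τ.1 τ.2 x₀ w₀).1‖ ^ 2
        ∂(tapeMeasure P m' p.m) ≤ p.ζ) (k : ℕ) :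
    RunInvariant P F p m' k (fun τ : Tape Ξ => sreda F J p τ.1 τ.2 x₀ w₀ k) := by
  induction k with
  | zero =>
    refine ⟨measurable_const, ?_, measurable_const, measurable_const, h0, fun h => ?_, fun h => ?_⟩
    · have := measurable_iSarah A J x₀ w₀ J.T
      rw [← gradient_neg_component] at this
      exact this
    · exact absurd (Nat.zero_mod _) h
    · exact absurd (Nat.zero_mod _) h
  | succ k ih => exact runInvariant_succ A hd hε J hp ih

/-- The average gradient norm of the primal function along a run. -/
theorem sum_integral_norm_gradient_le (A : Assumptions P F ℓ μ σ) (hd : 0 < d₂) (hε : 0 < ε)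
    (J : ISarahParams) (x₀ : Vec d₁) (w₀ : Vec d₂) {p : Params} (hp : p = params ℓ μ σ ε)
    (h0 : Integrable (fun τ : Tape Ξ => ‖objGradY P F x₀ (sredaInit F J τ.1 τ.2 x₀ w₀).1‖ ^ 2)
        (tapeMeasure P m' p.m) ∧
      ∫ τ : Tape Ξ, ‖objGradY P F x₀ (sredaInit F J τ.1 τ.2 x₀ w₀).1‖ ^ 2
        ∂(tapeMeasure P m' p.m) ≤ p.ζ) :
    (∀ k, Measurable (fun τ : Tape Ξ => (sreda F J p τ.1 τ.2 x₀ w₀ k).x)) ∧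
    (∀ k, Integrable (fun τ : Tape Ξ =>
      ‖gradient (Phi P F) (sreda F J p τ.1 τ.2 x₀ w₀ k).x‖) (tapeMeasure P m' p.m)) ∧
    ∀ K : ℕ, 100 * (ℓ / μ) * ℓ * ε⁻¹ ^ 2 * (Phi P F x₀ - PhiStar P F) / 9 ≤ K →
      ∑ k ∈ Finset.range K, ∫ τ : Tape Ξ,
        ‖gradient (Phi P F) (sreda F J p τ.1 τ.2 x₀ w₀ k).x‖ ∂(tapeMeasure P m' p.m)
      ≤ K * (25 / 4 * ε) := by
  have hl := A.ell_pos
  have hμ := A.mu_pos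
  have R := runInvariant_sreda (m' := m') A hd hε J x₀ w₀ hp h0
  have hζ : 0 < p.ζ := by rw [hp]; exact params_zeta_pos A hε
  have hq : 0 < p.q := by rw [hp]; exact params_q_pos hε
  obtain ⟨κ, hκ⟩ : ∃ κ, κ = ℓ / μ := ⟨_, rfl⟩
  have hκ1 : 1 ≤ κ := by rw [hκ]; exact (one_le_div hμ).2 (A.mu_le_ell hd)
  have hκ0 : 0 < κ := by linarith
  have hζε : κ ^ 2 * p.ζ = ε ^ 2 := by rw [hp, hκ]; simp only [params]; field_simp
  set X : ℕ → Tape Ξ → Vec d₁ := fun k τ => (sreda F J p τ.1 τ.2 x₀ w₀ k).x with hX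
  set V : ℕ → Tape Ξ → Vec d₁ := fun k τ => stepV F p τ.1 k (sreda F J p τ.1 τ.2 x₀ w₀ k) with hV
  have hXs : ∀ k τ, X (k + 1) τ = X k τ - p.η ‖V k τ‖ • V k τ := fun k τ => rfl
  have hXm : ∀ k, Measurable (X k) := fun k => (R k).measurable_x
  have hVm : ∀ k, Measurable (V k) := fun k =>
    ((R k).step_error A hε hp (freeOfSample_sreda_large F J p x₀ w₀ k)).1.1
  have hgm : ∀ k, Measurable (fun τ => gradient (Phi P F) (X k τ)) := fun k =>
    A.continuous_gradient_Phi.measurable.comp (hXm k)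
  have hgi : ∀ k, Integrable (fun τ => ‖gradient (Phi P F) (X k τ)‖) (tapeMeasure P m' p.m) := by
    intro k
    induction k with
    | zero => exact integrable_const ‖gradient (Phi P F) x₀‖
    | succ k ih =>
      refine (ih.add (integrable_const (ℓ * (1 + ℓ / μ) * (1 + p.ζ / (25 * ℓ ^ 2))))).mono'
        (hgm _).norm.aestronglyMeasurable (Filter.Eventually.of_forall fun τ => ?_)
      rw [Real.norm_of_nonneg (norm_nonneg _)]
      have e1 := A.norm_gradient_Phi_sub_le (X (k + 1) τ) (X k τ)
      have e2 := norm_le_norm_add_norm_sub' (gradient (Phi P F) (X (k + 1) τ))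
        (gradient (Phi P F) (X k τ))
      have e3 : ‖X (k + 1) τ - X k τ‖ ≤ 1 + p.ζ / (25 * ℓ ^ 2) := by
        have h := norm_step_sq_le (σ := σ) hl hμ hε (V k τ)
        rw [← hp] at h
        rw [hXs, sub_sub_cancel_left, norm_neg]
        nlinarith [sq_nonneg (‖p.η ‖V k τ‖ • V k τ‖ - 1)]
      have e4 : ℓ * (1 + ℓ / μ) * ‖X (k + 1) τ - X k τ‖
          ≤ ℓ * (1 + ℓ / μ) * (1 + p.ζ / (25 * ℓ ^ 2)) := by gcongr
      simp only [Pi.add_apply]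
      linarith
  -- The error of the direction `V k` has an optimization part and an estimation part.
  have herr : ∀ k, Integrable (fun τ => ‖gradient (Phi P F) (X k τ) - V k τ‖ ^ 2)
      (tapeMeasure P m' p.m) ∧
      ∫ τ, ‖gradient (Phi P F) (X k τ) - V k τ‖ ^ 2 ∂(tapeMeasure P m' p.m)
        ≤ 23 / 10 * ε ^ 2 := by
    intro k
    have hs := ((R k).step_error A hε hp (freeOfSample_sreda_large F J p x₀ w₀ k)).1
    have hb : ∀ τ : Tape Ξ, ‖gradient (Phi P F) (X k τ) - V k τ‖ ^ 2
        ≤ 2 * κ ^ 2 * ‖objGradY P F (sreda F J p τ.1 τ.2 x₀ w₀ k).x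
            (sreda F J p τ.1 τ.2 x₀ w₀ k).y‖ ^ 2
          + 2 * ‖V k τ - objGradX P F (sreda F J p τ.1 τ.2 x₀ w₀ k).x
            (sreda F J p τ.1 τ.2 x₀ w₀ k).y‖ ^ 2 := by
      intro τ
      have e1 := A.norm_gradient_Phi_sub_objGradX_le (X k τ) (sreda F J p τ.1 τ.2 x₀ w₀ k).y
      rw [← hκ] at e1
      have e2 := norm_sub_le_norm_sub_add_norm_sub (gradient (Phi P F) (X k τ))
        (objGradX P F (X k τ) (sreda F J p τ.1 τ.2 x₀ w₀ k).y) (V k τ)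
      rw [norm_sub_rev (objGradX P F (X k τ) _) (V k τ)] at e2
      have e3 := pow_le_pow_left₀ (norm_nonneg _) (e2.trans (add_le_add_left e1 _)) 2
      simp only [hX] at e3 ⊢
      nlinarith [sq_nonneg (κ * ‖objGradY P F (sreda F J p τ.1 τ.2 x₀ w₀ k).x
            (sreda F J p τ.1 τ.2 x₀ w₀ k).y‖ - ‖V k τ - objGradX P F
            (sreda F J p τ.1 τ.2 x₀ w₀ k).x (sreda F J p τ.1 τ.2 x₀ w₀ k).y‖)]
    have hi1 := (R k).grad.1.const_mul (2 * κ ^ 2)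
    have hi2 := hs.2.1.const_mul 2
    have hi := (hi1.add hi2).mono' (((hgm k).sub (hVm k)).norm.pow_const 2).aestronglyMeasurable
      (Filter.Eventually.of_forall fun τ => by
        rw [Real.norm_of_nonneg (by positivity)]; exact hb τ)
    refine ⟨hi, (integral_mono hi (hi1.add hi2) hb).trans ?_⟩
    rw [integral_add' hi1 hi2, integral_const_mul, integral_const_mul]
    have e1 := (R k).grad.2
    have e2 := hs.2.2.trans (error_bound_le hζ hq k)
    have e3 : p.ζ ≤ κ ^ 2 * p.ζ := by
      have : 1 ≤ κ ^ 2 := one_le_pow₀ hκ1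
      nlinarith
    have e4 := mul_le_mul_of_nonneg_left e1 (by positivity : 0 ≤ 2 * κ ^ 2)
    linarith
  refine ⟨hXm, hgi, fun K hK => ?_⟩
  obtain ⟨c, hc⟩ : ∃ c, c = 1 / (40 * κ * ℓ) := ⟨_, rfl⟩
  have hc0 : 0 < c := by rw [hc]; positivity
  have hpt : ∀ τ, ∑ k ∈ Finset.range K, 2 * c * (ε * ‖gradient (Phi P F) (X k τ)‖)
      ≤ (Phi P F x₀ - PhiStar P F) + ∑ k ∈ Finset.range K,
        c * (2 * ε ^ 2 + 3 * ‖gradient (Phi P F) (X k τ) - V k τ‖ ^ 2) := by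
    intro τ
    have hstep : ∀ k, 2 * c * (ε * ‖gradient (Phi P F) (X k τ)‖)
        ≤ (Phi P F (X k τ) - Phi P F (X (k + 1) τ))
          + c * (2 * ε ^ 2 + 3 * ‖gradient (Phi P F) (X k τ) - V k τ‖ ^ 2) := by
      intro k
      have h := Phi_step_le A hd hε (X k τ) (V k τ)
      rw [← hp, ← hXs, ← hκ, ← hc, show 1 / (20 * κ * ℓ) = 2 * c by
        rw [hc]; field_simp; norm_num] at h
      linarith
    have h := Finset.sum_le_sum fun k (_ : k ∈ Finset.range K) => hstep k
    rw [Finset.sum_add_distrib, Finset.sum_range_sub' (fun k => Phi P F (X k τ))] at h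
    have h1 := A.PhiStar_le (X K τ)
    have h2 : Phi P F (X 0 τ) = Phi P F x₀ := rfl
    linarith
  have hi1 : ∀ k, Integrable (fun τ => 2 * c * (ε * ‖gradient (Phi P F) (X k τ)‖))
      (tapeMeasure P m' p.m) := fun k => ((hgi k).const_mul _).const_mul _
  have hi2 : ∀ k, Integrable (fun τ => 2 * ε ^ 2 + 3 * ‖gradient (Phi P F) (X k τ) - V k τ‖ ^ 2)
      (tapeMeasure P m' p.m) := fun k => (integrable_const _).add ((herr k).1.const_mul _)
  have hi3 : ∀ k, Integrable (fun τ =>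
      c * (2 * ε ^ 2 + 3 * ‖gradient (Phi P F) (X k τ) - V k τ‖ ^ 2))
      (tapeMeasure P m' p.m) := fun k => (hi2 k).const_mul _
  have hint : ∫ τ, ∑ k ∈ Finset.range K, 2 * c * (ε * ‖gradient (Phi P F) (X k τ)‖)
        ∂(tapeMeasure P m' p.m) ≤ ∫ τ, ((Phi P F x₀ - PhiStar P F) + ∑ k ∈ Finset.range K,
        c * (2 * ε ^ 2 + 3 * ‖gradient (Phi P F) (X k τ) - V k τ‖ ^ 2))
        ∂(tapeMeasure P m' p.m) :=
    integral_mono (integrable_finsetSum _ fun k _ => hi1 k)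
      ((integrable_const _).add (integrable_finsetSum _ fun k _ => hi3 k)) hpt
  rw [integral_finsetSum _ fun k _ => hi1 k, integral_add (integrable_const _)
    (integrable_finsetSum _ fun k _ => hi3 k), integral_finsetSum _ fun k _ => hi3 k] at hint
  simp only [integral_const_mul] at hint
  have hsum : ∑ k ∈ Finset.range K, c * ∫ τ, (2 * ε ^ 2
      + 3 * ‖gradient (Phi P F) (X k τ) - V k τ‖ ^ 2) ∂(tapeMeasure P m' p.m)
      ≤ K * (c * (89 / 10 * ε ^ 2)) := by
    have := Finset.sum_le_card_nsmul (Finset.range K) (fun k => c * ∫ τ, (2 * ε ^ 2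
      + 3 * ‖gradient (Phi P F) (X k τ) - V k τ‖ ^ 2) ∂(tapeMeasure P m' p.m))
      (c * (89 / 10 * ε ^ 2)) (fun k _ => by
        rw [integral_add (integrable_const _) ((herr k).1.const_mul _),
          integral_const_mul (3 : ℝ)]
        simp only [integral_const, probReal_univ, smul_eq_mul, one_mul]
        have := (herr k).2
        gcongr
        linarith)
    rwa [Finset.card_range, nsmul_eq_mul] at this
  rw [← Finset.mul_sum, ← Finset.mul_sum] at hint
  simp only [integral_const, probReal_univ, smul_eq_mul, one_mul] at hint
  have hΔ : Phi P F x₀ - PhiStar P F ≤ K * (c * (18 / 5 * ε ^ 2)) := by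
    rw [← hκ] at hK
    have : Phi P F x₀ - PhiStar P F = (c * (18 / 5 * ε ^ 2))
        * (100 * κ * ℓ * ε⁻¹ ^ 2 * (Phi P F x₀ - PhiStar P F) / 9) := by
      rw [hc]; field_simp; ring
    rw [this, mul_comm (K : ℝ)]
    gcongr
  have hfin : 2 * c * ε * (∑ k ∈ Finset.range K,
      ∫ τ, ‖gradient (Phi P F) (X k τ)‖ ∂(tapeMeasure P m' p.m))
      ≤ 2 * c * ε * (K * (25 / 4 * ε)) := by
    have e1 : 2 * c * ε * (K * (25 / 4 * ε))
      = K * (c * (18 / 5 * ε ^ 2)) + K * (c * (89 / 10 * ε ^ 2)) := by ring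
    rw [e1]
    linarith
  exact le_of_mul_le_mul_left hfin (by positivity)

end Main

/-! ### Output and complexity -/

section Output

variable {d₁ d₂ : ℕ} {Ξ : Type*} [MeasurableSpace Ξ] {P : Measure Ξ} [IsProbabilityMeasure P]
  {F : Vec d₁ → Vec d₂ → Ξ → ℝ} {ℓ μ σ ε : ℝ}

theorem measurable_sredaInit (A : Assumptions P F ℓ μ σ) (J : ISarahParams) (x₀ : Vec d₁)
    (w₀ : Vec d₂) : Measurable (fun τ : Tape Ξ => (sredaInit F J τ.1 τ.2 x₀ w₀).1) := by
  have := measurable_iSarah A J x₀ w₀ J.T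
  rw [← gradient_neg_component] at this
  exact this

omit [IsProbabilityMeasure P] in
theorem IsTape.measurable {Ω : Type*} [MeasurableSpace Ω] {Q : Measure Ω} {m' m : ℕ}
    {ξ : SampleId → Ω → Ξ} {c : ChoiceId → Ω → ℕ} (h : IsTape Q P m' m ξ c) :
    Measurable (fun ω => ((fun i => ξ i ω), (fun j => c j ω))) :=
  (measurable_pi_lambda _ h.measurable_sample).prodMk (measurable_pi_lambda _ h.measurable_choice)

/-- The accuracy of the initialization is a property of the law of the draws. -/
theorem initAccurate_iff (A : Assumptions P F ℓ μ σ) (J : ISarahParams) (x₀ : Vec d₁)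
    (w₀ : Vec d₂) {m : ℕ} (ζ : ℝ) {Ω : Type*} [MeasurableSpace Ω] {Q : Measure Ω}
    [IsProbabilityMeasure Q] {ξ : SampleId → Ω → Ξ} {c : ChoiceId → Ω → ℕ}
    (h : IsTape Q P J.m' m ξ c) :
    InitAccurate Q P F x₀ ζ (fun ω => (sredaInit F J (ξ · ω) (c · ω) x₀ w₀).1) ↔
      Integrable (fun τ : Tape Ξ => ‖objGradY P F x₀ (sredaInit F J τ.1 τ.2 x₀ w₀).1‖ ^ 2)
        (tapeMeasure P J.m' m) ∧
      ∫ τ : Tape Ξ, ‖objGradY P F x₀ (sredaInit F J τ.1 τ.2 x₀ w₀).1‖ ^ 2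
        ∂(tapeMeasure P J.m' m) ≤ ζ := by
  have hm : Measurable (fun τ : Tape Ξ =>
      ‖objGradY P F x₀ (sredaInit F J τ.1 τ.2 x₀ w₀).1‖ ^ 2) :=
    (A.oracleY.measurable_field A.ell_pos.le measurable_const
      (measurable_sredaInit A J x₀ w₀)).norm.pow_const 2
  rw [← h.map_eq, integrable_map_measure hm.aestronglyMeasurable h.measurable.aemeasurable,
    integral_map h.measurable.aemeasurable hm.aestronglyMeasurable]
  rfl

/-- At an accurate starting point the expected objective is close to the primal function. -/
theorem integrable_obj_of_initAccurate (A : Assumptions P F ℓ μ σ) {Ω : Type*}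
    [MeasurableSpace Ω] {Q : Measure Ω} [IsProbabilityMeasure Q] {x₀ : Vec d₁} {ζ : ℝ}
    {y₀ : Ω → Vec d₂} (hy : Measurable y₀) (h : InitAccurate Q P F x₀ ζ y₀) :
    Integrable (fun ω => obj P F x₀ (y₀ ω)) Q ∧
      ∫ ω, obj P F x₀ (y₀ ω) ∂Q ≤ Phi P F x₀ ∧
      Phi P F x₀ ≤ (∫ ω, obj P F x₀ (y₀ ω) ∂Q) + ζ / (2 * μ) := by
  have hμ := A.mu_pos
  have hm : Measurable (fun ω => obj P F x₀ (y₀ ω)) :=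
    (A.continuous_obj_right x₀).measurable.comp hy
  have hb := fun ω => A.Phi_sub_obj_le x₀ (y₀ ω)
  have hi2 := h.1.div_const (2 * μ)
  have hi : Integrable (fun ω => obj P F x₀ (y₀ ω)) Q := by
    refine ((integrable_const |Phi P F x₀|).add hi2).mono' hm.aestronglyMeasurable
      (Filter.Eventually.of_forall fun ω => ?_)
    have e1 := A.obj_le_Phi x₀ (y₀ ω)
    have e2 := hb ω
    have e3 := abs_le.1 (le_refl |Phi P F x₀|)
    have e4 : 0 ≤ ‖objGradY P F x₀ (y₀ ω)‖ ^ 2 / (2 * μ) := by positivity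
    simp only [Pi.add_apply]
    exact abs_le.2 ⟨by linarith, by linarith⟩
  refine ⟨hi, ?_, ?_⟩
  · have := integral_mono hi (integrable_const (Phi P F x₀)) fun ω => A.obj_le_Phi x₀ (y₀ ω)
    simpa using this
  · have h1 : ∫ _, Phi P F x₀ ∂Q ≤ ∫ ω, (obj P F x₀ (y₀ ω)
        + ‖objGradY P F x₀ (y₀ ω)‖ ^ 2 / (2 * μ)) ∂Q :=
      integral_mono (integrable_const _) (hi.add hi2) fun ω => by
        simp only
        linarith [hb ω]
    rw [integral_add hi hi2, integral_div] at h1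
    simp only [integral_const, probReal_univ, smul_eq_mul, one_mul] at h1
    have h2 : (∫ ω, ‖objGradY P F x₀ (y₀ ω)‖ ^ 2 ∂Q) / (2 * μ) ≤ ζ / (2 * μ) := by
      gcongr; exact h.2
    linarith

/-- Evaluation of a random sequence at an independent uniform index. -/
theorem integrable_integral_eq_of_uniform {m' m : ℕ} {Ω : Type*} [MeasurableSpace Ω]
    {Q : Measure Ω} [IsProbabilityMeasure Q] {ξ : SampleId → Ω → Ξ} {c : ChoiceId → Ω → ℕ}
    (h : IsTape Q P m' m ξ c) {K : ℕ} {kHat : Ω → ℕ} (hk : Measurable kHat)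
    (hlaw : Measure.map kHat Q = uniformOn (Set.Iio K))
    (hind : IndepFun kHat (fun ω => ((fun i => ξ i ω), (fun j => c j ω))) Q)
    {N : ℕ → Tape Ξ → ℝ} (hN : ∀ k, Measurable (N k)) (h0 : ∀ k τ, 0 ≤ N k τ)
    (hi : ∀ k, Integrable (N k) (tapeMeasure P m' m)) :
    0 < K ∧ Integrable (fun ω => N (kHat ω) ((ξ · ω), (c · ω))) Q ∧
      ∫ ω, N (kHat ω) ((ξ · ω), (c · ω)) ∂Q
        = (K : ℝ)⁻¹ * ∑ k ∈ Finset.range K, ∫ τ, N k τ ∂(tapeMeasure P m' m) := by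
  have hprob : IsProbabilityMeasure (uniformOn (Set.Iio K) : Measure ℕ) := by
    rw [← hlaw]; exact Measure.isProbabilityMeasure_map hk.aemeasurable
  have hK : 0 < K := by
    rcases Nat.eq_zero_or_pos K with h1 | h1
    · exfalso
      have h2 := hprob.measure_univ
      rw [h1, show Set.Iio 0 = (∅ : Set ℕ) by ext; simp, uniformOn_empty_meas] at h2
      simp at h2
    · exact h1
  have hset : Set.Iio K = ((Finset.range K : Finset ℕ) : Set ℕ) := by ext x; simp
  have hpair := (indepFun_iff_map_prod_eq_prod_map_map hk.aemeasurable
    h.measurable.aemeasurable).1 hind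
  rw [h.map_eq, hlaw] at hpair
  have hNu : Measurable (fun p : ℕ × Tape Ξ => N p.1 p.2) := measurable_from_prod_countable_right hN
  have hm : Measurable (fun ω => N (kHat ω) ((ξ · ω), (c · ω))) :=
    hNu.comp (hk.prodMk h.measurable)
  have hS0 : 0 ≤ (K : ℝ)⁻¹ * ∑ k ∈ Finset.range K, ∫ τ, N k τ ∂(tapeMeasure P m' m) :=
    mul_nonneg (by positivity) (Finset.sum_nonneg fun s _ => integral_nonneg (h0 s))
  have key : ∫⁻ ω, ENNReal.ofReal (N (kHat ω) ((ξ · ω), (c · ω))) ∂Q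
      = ENNReal.ofReal ((K : ℝ)⁻¹ * ∑ k ∈ Finset.range K,
          ∫ τ, N k τ ∂(tapeMeasure P m' m)) := by
    have e1 := lintegral_map (μ := Q) hNu.ennreal_ofReal (hk.prodMk h.measurable)
    rw [hpair, lintegral_prod _ hNu.ennreal_ofReal.aemeasurable, hset,
      lintegral_uniformOn_finset] at e1
    rw [← e1, ENNReal.ofReal_mul (by positivity), ENNReal.ofReal_inv_of_pos (by positivity),
      ENNReal.ofReal_sum_of_nonneg (fun s _ => integral_nonneg (h0 s)), Finset.card_range,
      ENNReal.ofReal_natCast]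
    congr 1
    refine Finset.sum_congr rfl fun k _ => ?_
    rw [ofReal_integral_eq_lintegral_ofReal (hi k) (Filter.Eventually.of_forall (h0 k))]
  have hint : Integrable (fun ω => N (kHat ω) ((ξ · ω), (c · ω))) Q := by
    refine ⟨hm.aestronglyMeasurable, ?_⟩
    rw [hasFiniteIntegral_iff_ofReal (Filter.Eventually.of_forall fun ω => h0 _ _), key]
    exact ENNReal.ofReal_lt_top
  refine ⟨hK, hint, ?_⟩
  rw [← ofReal_integral_eq_lintegral_ofReal hint (Filter.Eventually.of_forall fun ω => h0 _ _)]
    at key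
  exact (ENNReal.ofReal_eq_ofReal_iff (integral_nonneg fun ω => h0 _ _) hS0).1 key

end Output

section Complexity

theorem sum_ite_mod_mul_le (q S K : ℕ) (hq : 0 < q) :
    (∑ j ∈ Finset.range K, if j % q = 0 then S else 0) * q ≤ (K + q) * S := by
  have hcount : ∀ K : ℕ, (∑ j ∈ Finset.range K, if j % q = 0 then 1 else 0) * q + 1 ≤ K + q := by
    intro K
    induction K with
    | zero => simp only [Finset.range_zero, Finset.sum_empty]; omega
    | succ K ih =>
      rw [Finset.sum_range_succ]
      set n := ∑ j ∈ Finset.range K, if j % q = 0 then 1 else 0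
      by_cases hK : K % q = 0
      · rw [if_pos hK]
        obtain ⟨j, rfl⟩ := Nat.dvd_of_mod_eq_zero hK
        have h1 : n * q < (j + 1) * q := by nlinarith
        have h2 : n ≤ j := Nat.lt_succ_iff.1 (lt_of_mul_lt_mul_right h1 (Nat.zero_le q))
        nlinarith
      · rw [if_neg hK, add_zero]; omega
  have h1 : (∑ j ∈ Finset.range K, if j % q = 0 then S else 0)
      = (∑ j ∈ Finset.range K, if j % q = 0 then 1 else 0) * S := by
    rw [Finset.sum_mul]
    exact Finset.sum_congr rfl fun j _ => by split_ifs <;> simp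
  rw [h1, mul_right_comm]
  exact Nat.mul_le_mul_right S (Nat.le_of_succ_le (hcount K))

theorem natCeil_le_add_one {a : ℝ} (ha : 0 ≤ a) : (⌈a⌉₊ : ℝ) ≤ a + 1 :=
  (Nat.ceil_lt_add_one ha).le

/-- The number of gradient evaluations of the initialization is of order `κ³ ε⁻³`. -/
theorem initParams_evals_le {ℓ σ G μ ε : ℝ} (hκ : 1 ≤ ℓ / μ) (hG : 0 ≤ G)
    (hε : 0 < ε) (hε1 : ε ≤ 1) :
    (((initParams ℓ σ G μ ε).T * ((initParams ℓ σ G μ ε).b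
        + 2 * ((initParams ℓ σ G μ ε).m' - 1)) : ℕ) : ℝ)
      ≤ (2 * G + 1) * (3 * σ ^ 2 + 68) * ((ℓ / μ) ^ 3 * ε⁻¹ ^ 3) := by
  simp only [initParams, Nat.add_sub_cancel]
  push_cast
  obtain ⟨κ, hκe⟩ : ∃ κ, κ = ℓ / μ := ⟨_, rfl⟩
  rw [← hκe] at hκ ⊢
  have hi1 : 1 ≤ ε⁻¹ := (one_le_inv₀ hε).2 hε1
  have hX : 1 ≤ κ * ε⁻¹ := by nlinarith
  have hX2 : 1 ≤ (κ * ε⁻¹) ^ 2 := one_le_pow₀ hX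
  have hT : (⌈2 * G * κ * ε⁻¹⌉₊ : ℝ) ≤ (2 * G + 1) * (κ * ε⁻¹) := by
    refine (natCeil_le_add_one (by positivity)).trans ?_
    nlinarith
  have hb : (⌈3 * σ ^ 2 * κ ^ 2 * ε⁻¹ ^ 2⌉₊ : ℝ) + 1 ≤ (3 * σ ^ 2 + 2) * (κ * ε⁻¹) ^ 2 := by
    have := natCeil_le_add_one (a := 3 * σ ^ 2 * κ ^ 2 * ε⁻¹ ^ 2) (by positivity)
    have h2 : (3 * σ ^ 2 + 2) * (κ * ε⁻¹) ^ 2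
      = 3 * σ ^ 2 * κ ^ 2 * ε⁻¹ ^ 2 + 2 * (κ * ε⁻¹) ^ 2 := by ring
    linarith
  have hm : (⌈32 * κ ^ 2⌉₊ : ℝ) ≤ 33 * (κ * ε⁻¹) ^ 2 := by
    have := natCeil_le_add_one (a := 32 * κ ^ 2) (by positivity)
    have h2 : κ ^ 2 ≤ (κ * ε⁻¹) ^ 2 := by
      have : κ ≤ κ * ε⁻¹ := by nlinarith
      gcongr
    linarith
  calc (⌈2 * G * κ * ε⁻¹⌉₊ : ℝ) * ((⌈3 * σ ^ 2 * κ ^ 2 * ε⁻¹ ^ 2⌉₊ : ℝ) + 1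
        + 2 * (⌈32 * κ ^ 2⌉₊ : ℝ))
      ≤ ((2 * G + 1) * (κ * ε⁻¹)) * ((3 * σ ^ 2 + 2) * (κ * ε⁻¹) ^ 2
        + 2 * (33 * (κ * ε⁻¹) ^ 2)) := by gcongr
    _ = _ := by ring

/-- The number of gradient evaluations of `K` iterations of the main loop is of order
`κ³ ε⁻³`. -/
theorem params_evals_le {ℓ σ D μ ε : ℝ} (hℓ : 0 < ℓ) (hκ : 1 ≤ ℓ / μ) (hD : 0 ≤ D)
    (hε : 0 < ε) (hε1 : ε ≤ 1) {K : ℕ} {p : Params} (hp : p = params ℓ μ σ ε)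
    (hK : (K : ℝ) ≤ (12 * ℓ * D + 7) * (ℓ / μ * ε⁻¹ ^ 2)) :
    (((∑ j ∈ Finset.range K, if j % p.q = 0 then p.S₁ else 0)
        + K * (2 * p.S₂ * (p.m + 2)) : ℕ) : ℝ)
      ≤ ((12 * ℓ * D + 8) * (24 * σ ^ 2 + 1) + 5280 * (12 * ℓ * D + 7))
        * ((ℓ / μ) ^ 3 * ε⁻¹ ^ 3) := by
  obtain ⟨κ, hκe⟩ : ∃ κ, κ = ℓ / μ := ⟨_, rfl⟩
  have hκ0 : 0 < κ := by rw [hκe]; linarith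
  have hi1 : 1 ≤ ε⁻¹ := (one_le_inv₀ hε).2 hε1
  have hi0 : 0 < ε⁻¹ := by positivity
  have hqp : 0 < p.q := by rw [hp]; exact params_q_pos hε
  have hq0 : (0 : ℝ) < p.q := by exact_mod_cast hqp
  have hq1 : ε⁻¹ ≤ p.q := by rw [hp]; exact Nat.le_ceil _
  have hq2 : (p.q : ℝ) ≤ 2 * ε⁻¹ := by
    have : (p.q : ℝ) ≤ ε⁻¹ + 1 := by rw [hp]; exact natCeil_le_add_one hi0.le
    linarith
  have hS₁ : (p.S₁ : ℝ) ≤ 24 * σ ^ 2 * κ ^ 2 * ε⁻¹ ^ 2 + 1 := by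
    rw [hp, hκe]; exact natCeil_le_add_one (by positivity)
  have hS₂ : (p.S₂ : ℝ) ≤ 7368 / 175 * κ * p.q + 1 := by
    rw [hp, hκe]
    exact natCeil_le_add_one (by rw [← hκe]; positivity)
  have hm : (p.m : ℝ) ≤ 28 * κ - 1 + 1 := by
    rw [hp, hκe]; exact natCeil_le_add_one (by linarith)
  rw [← hκe] at hκ hK ⊢
  have hX : 1 ≤ κ * ε⁻¹ := by nlinarith
  have hX2 : 1 ≤ (κ * ε⁻¹) ^ 2 := one_le_pow₀ hX
  have hS₁' : (p.S₁ : ℝ) ≤ (24 * σ ^ 2 + 1) * (κ * ε⁻¹) ^ 2 := by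
    have h2 : (24 * σ ^ 2 + 1) * (κ * ε⁻¹) ^ 2
      = 24 * σ ^ 2 * κ ^ 2 * ε⁻¹ ^ 2 + (κ * ε⁻¹) ^ 2 := by ring
    linarith
  have hS₂' : (p.S₂ : ℝ) ≤ 88 * (κ * ε⁻¹) := by
    have h1 : 7368 / 175 * κ * p.q ≤ 7368 / 175 * κ * (2 * ε⁻¹) := by gcongr
    nlinarith
  have hm' : (p.m : ℝ) + 2 ≤ 30 * κ := by linarith
  have hlD : 0 ≤ ℓ * D := by positivity
  have hlarge : ((∑ j ∈ Finset.range K, if j % p.q = 0 then p.S₁ else 0 : ℕ) : ℝ)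
      ≤ (12 * ℓ * D + 8) * (κ * ε⁻¹) * p.S₁ := by
    have h1 : (((∑ j ∈ Finset.range K, if j % p.q = 0 then p.S₁ else 0) * p.q : ℕ) : ℝ)
        ≤ ((K + p.q) * p.S₁ : ℕ) := by exact_mod_cast sum_ite_mod_mul_le p.q p.S₁ K hqp
    rw [Nat.cast_mul, Nat.cast_mul, Nat.cast_add] at h1
    refine le_of_mul_le_mul_right (h1.trans ?_) hq0
    rw [mul_right_comm]
    gcongr
    calc (K : ℝ) + p.q ≤ (12 * ℓ * D + 7) * (κ * ε⁻¹ ^ 2) + p.q := by gcongr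
      _ = (12 * ℓ * D + 7) * (κ * ε⁻¹) * ε⁻¹ + 1 * p.q := by ring
      _ ≤ (12 * ℓ * D + 7) * (κ * ε⁻¹) * p.q + (κ * ε⁻¹) * p.q := by gcongr
      _ = _ := by ring
  rw [Nat.cast_add, Nat.cast_mul, Nat.cast_mul, Nat.cast_mul, Nat.cast_add, Nat.cast_ofNat]
  calc _ ≤ (12 * ℓ * D + 8) * (κ * ε⁻¹) * ((24 * σ ^ 2 + 1) * (κ * ε⁻¹) ^ 2)
        + ((12 * ℓ * D + 7) * (κ * ε⁻¹ ^ 2)) * (2 * (88 * (κ * ε⁻¹)) * (30 * κ)) := by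
        refine add_le_add (hlarge.trans ?_) ?_
        · gcongr
        · gcongr
    _ = _ := by ring

end Complexity

end Sreda
end

theorem theorem1 (ℓ σ D G : ℝ) :
    -- `C` and the parameters of the initialization depend only on `ℓ, σ, D, G`, and the latter
    -- also on `μ, ε`
    ∃ (C : ℝ) (init : ℝ → ℝ → ISarahParams),
    ∀ (d₁ d₂ : ℕ) (Ξ : Type*) [MeasurableSpace Ξ] (P : Measure Ξ) [IsProbabilityMeasure P]
      (F : Vec d₁ → Vec d₂ → Ξ → ℝ) (μ ε : ℝ) (x₀ : Vec d₁) (w₀ : Vec d₂),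
      0 < d₂ → 0 < ε → Assumptions P F ℓ μ σ →
      Phi P F x₀ - PhiStar P F ≤ D → ‖objGradY P F x₀ w₀‖ ≤ G →
      Differentiable ℝ (Phi P F) ∧
      -- for all parameters of the initialization with which it reaches the accuracy `ζ`, and every
      -- run of the algorithm: the bound on the output
      (∀ (J : ISarahParams) (Ω : Type*) [MeasurableSpace Ω] (Q : Measure Ω)
        [IsProbabilityMeasure Q] (ξ : SampleId → Ω → Ξ) (c : ChoiceId → Ω → ℕ),
        let p := params ℓ μ σ ε
        let y₀ := fun ω => (sredaInit F J (ξ · ω) (c · ω) x₀ w₀).1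
        let K := numIter ℓ μ ε (deltaF Q P F ℓ μ ε x₀ y₀)
        IsTape Q P J.m' p.m ξ c →
        InitAccurate Q P F x₀ p.ζ y₀ →
        Integrable (fun ω => obj P F x₀ (y₀ ω)) Q ∧
        ∀ kHat : Ω → ℕ, Measurable kHat →
          Measure.map kHat Q = uniformOn (Set.Iio K) →
          IndepFun kHat (fun ω => ((fun i => ξ i ω), (fun j => c j ω))) Q →
          let xHat := fun ω => (sreda F J p (ξ · ω) (c · ω) x₀ w₀ (kHat ω)).x
          Integrable (fun ω => ‖gradient (Phi P F) (xHat ω)‖) Q ∧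
          ∫ ω, ‖gradient (Phi P F) (xHat ω)‖ ∂Q ≤ 1073 / 108 * ε) ∧
      -- the initialization `init` reaches the accuracy `ζ`, and with it the whole run of the
      -- algorithm makes `O(κ³ ε⁻³)` stochastic gradient evaluations
      (∀ (Ω : Type*) [MeasurableSpace Ω] (Q : Measure Ω)
        [IsProbabilityMeasure Q] (ξ : SampleId → Ω → Ξ) (c : ChoiceId → Ω → ℕ),
        let J := init μ ε
        let p := params ℓ μ σ ε
        let y₀ := fun ω => (sredaInit F J (ξ · ω) (c · ω) x₀ w₀).1
        let K := numIter ℓ μ ε (deltaF Q P F ℓ μ ε x₀ y₀)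
        IsTape Q P J.m' p.m ξ c →
        InitAccurate Q P F x₀ p.ζ y₀ ∧
        (ε ≤ 1 → ∀ ω, ((sreda F J p (ξ · ω) (c · ω) x₀ w₀ K).evals : ℝ)
          ≤ C * (ℓ / μ) ^ 3 * ε⁻¹ ^ 3)) := by
  refine ⟨(2 * G + 1) * (3 * σ ^ 2 + 68)
      + ((12 * ℓ * D + 8) * (24 * σ ^ 2 + 1) + 5280 * (12 * ℓ * D + 7)),
    fun μ ε => initParams ℓ σ G μ ε, ?_⟩
  intro d₁ d₂ Ξ _ P _ F μ ε x₀ w₀ hd hε A hD hG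
  have hl := A.ell_pos
  have hμ := A.mu_pos
  have hκ : 1 ≤ ℓ / μ := (one_le_div hμ).2 (A.mu_le_ell hd)
  refine ⟨A.differentiable_Phi, ?_, ?_⟩
  · intro J Ω _ Q _ ξ c p y₀ K hT hI
    have hy₀ : Measurable y₀ := (measurable_sredaInit A J x₀ w₀).comp hT.measurable
    obtain ⟨hobj, -, hΦ⟩ := integrable_obj_of_initAccurate A hy₀ hI
    refine ⟨hobj, fun kHat hk hlaw hind => ?_⟩
    obtain ⟨hXm, hXi, hsum⟩ := sum_integral_norm_gradient_le (m' := J.m') A hd hε J x₀ w₀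
      (p := p) rfl ((initAccurate_iff A J x₀ w₀ p.ζ hT).1 hI)
    obtain ⟨hK, hint, heq⟩ := integrable_integral_eq_of_uniform hT hk hlaw hind
      (N := fun k τ => ‖gradient (Phi P F) (sreda F J p τ.1 τ.2 x₀ w₀ k).x‖)
      (fun k => (A.continuous_gradient_Phi.measurable.comp (hXm k)).norm)
      (fun k τ => norm_nonneg _) hXi
    refine ⟨hint, heq.trans_le ?_⟩
    have hK0 : (0 : ℝ) < K := by exact_mod_cast hK
    rw [inv_mul_le_iff₀ hK0]
    refine (hsum K (le_trans ?_ (Nat.le_ceil _))).trans ?_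
    · have hΔ : Phi P F x₀ - PhiStar P F ≤ deltaF Q P F ℓ μ ε x₀ y₀ := by
        unfold deltaF
        have : p.ζ = (ℓ / μ)⁻¹ ^ 2 * ε ^ 2 := rfl
        rw [this] at hΦ
        linarith
      gcongr
    · exact mul_le_mul_of_nonneg_left (by linarith) hK0.le
  · intro Ω _ Q _ ξ c J p y₀ K hT
    have hI : InitAccurate Q P F x₀ p.ζ y₀ :=
      (initAccurate_iff A J x₀ w₀ p.ζ hT).2 (initParams_accurate A hd hε x₀ w₀ hG)
    refine ⟨hI, fun hε1 ω => ?_⟩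
    have hy₀ : Measurable y₀ := (measurable_sredaInit A J x₀ w₀).comp hT.measurable
    obtain ⟨-, hΦ, -⟩ := integrable_obj_of_initAccurate A hy₀ hI
    have hG0 : 0 ≤ G := (norm_nonneg _).trans hG
    have hD0 : 0 ≤ D := le_trans (sub_nonneg.2 (A.PhiStar_le x₀)) hD
    have hK : (K : ℝ) ≤ (12 * ℓ * D + 7) * (ℓ / μ * ε⁻¹ ^ 2) := by
      have hΔ : deltaF Q P F ℓ μ ε x₀ y₀ ≤ D + (ℓ / μ)⁻¹ ^ 2 * ε ^ 2 / (2 * μ) := by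
        unfold deltaF; linarith
      have h1 : (K : ℝ) ≤ (⌈100 * (ℓ / μ) * ℓ * ε⁻¹ ^ 2
          * (D + (ℓ / μ)⁻¹ ^ 2 * ε ^ 2 / (2 * μ)) / 9⌉₊ : ℝ) := by
        simp only [K, numIter]
        gcongr
      have h2 := h1.trans (natCeil_le_add_one (by positivity))
      have h3 : 100 * (ℓ / μ) * ℓ * ε⁻¹ ^ 2 * (D + (ℓ / μ)⁻¹ ^ 2 * ε ^ 2 / (2 * μ)) / 9
          = 100 / 9 * (ℓ * D) * (ℓ / μ * ε⁻¹ ^ 2) + 50 / 9 := by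
        field_simp; ring
      have h4 : 1 ≤ ℓ / μ * ε⁻¹ ^ 2 := by
        have : 1 ≤ ε⁻¹ ^ 2 := one_le_pow₀ ((one_le_inv₀ hε).2 hε1)
        nlinarith
      have h5 : 0 ≤ (ℓ * D) * (ℓ / μ * ε⁻¹ ^ 2) := by positivity
      rw [h3] at h2
      linarith
    have e1 := initParams_evals_le (σ := σ) hκ hG0 hε hε1
    have e2 := params_evals_le (σ := σ) (p := p) hl hκ hD0 hε hε1 rfl hK
    have e3 : ((sreda F J p (ξ · ω) (c · ω) x₀ w₀ K).evals : ℝ)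
        = ((J.T * (J.b + 2 * (J.m' - 1)) : ℕ) : ℝ)
          + (((∑ j ∈ Finset.range K, if j % p.q = 0 then p.S₁ else 0)
            + K * (2 * p.S₂ * (p.m + 2)) : ℕ) : ℝ) := by
      rw [sreda_evals, add_assoc, Nat.cast_add]
    rw [e3]
    refine (add_le_add e1 e2).trans_eq ?_
    ring
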